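/- All manifolds, maps and forms are smooth. An exterior differential system (EDS) on a manifold $M$ is a differential ideal $\mathcal I\subset\Omega^*(M)$ each of whose homogeneous components is the space of sections of a subbundle of $\Lambda^pT^*M$. It is hyperbolic of class $s$ if $\dim M=s+4$ and, near each point, it is algebraically generated by $\theta^1,\dots,\theta^s,\hat\sigma^1\wedge\hat\sigma^2,\check\sigma^1\wedge\check\sigma^2$ for some local coframe $\theta^i,\hat\sigma^a,\check\sigma^a$; its two singular Pfaffian systems are $\hat V=\mathrm{span}\{\theta^i,\hat\sigma^a\}$ and $\check V=\mathrm{span}\{\theta^i,\check\sigma^a\}$ (they are unique up to interchange). For a subbundle $V\subset T^*M$, $V^\infty_x$ denotes the span of the differentials $df_x$ of the functions $f$ defined near $x$ with $df\in V$. The prolongation $M^{[1]}$ of a hyperbolic system of class $s$ is the $(s+6)$-dimensional manifold of its 2-dimensional integral elements $(x,P)$, $P\subset T_xM$, with the EDS $\mathcal I^{[1]}$ generated by the pullbacks at $(x,P)$ of the covectors at $x$ that annihilate $P$. It is hyperbolic of class $s+2$. A submersion $\mathbf p:N\to M$ makes an EDS $\mathcal E$ on $N$ an integrable extension of $\mathcal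 I$ on $M$ if $\mathcal E$ is algebraically generated by $\mathbf p^*\mathcal I$ and the sections of a subbundle $J\subset T^*N$ whose annihilator is a complement of $\ker\mathbf p_*$. Let $\mathcal I_1$ be the Monge-Ampère system of the wave equation $u_{xy}=0$ on a 5-manifold $N_1$ (locally, in coordinates $x,y,u,p,q$, generated by $du-p\,dx-q\,dy$, $dp\wedge dx$, $dq\wedge dy$). Let $\mathcal I_2$ be a hyperbolic Monge-Ampère system on a 5-manifold $N_2$ (a class 1 hyperbolic system whose 1-forms are contact forms) such that, at all points, the singular systems satisfy $\operatorname{rank}\hat V_2^\infty=\operatorname{rank}\check V_2^\infty=1$ for $\mathcal I_2$ and $\operatorname{rank}\hat V_{2,[1]}^\infty=\operatorname{rank}\check V_{2,[1]}^\infty=2$ for $\mathcal I_2^{[1]}$. Let $\mathcal B$ be an EDS on a 6-manifold $N$ and $\mathbf p_1:N\to N_1$, $\mathbf p_2:N\to N_2$ maps which make $\mathcal B$ an integrable extension of $\mathcal I_1$ and of $\mathcal I_2$ (a Bäcklund transformation with 1-dimensional fibres). Then $\mathcal B$ is hyperbolic of class 2. Let $\hat W_{[1]},\check W_{[1]}$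 be the singular Pfaffian systems of $\mathcal B^{[1]}$ on $N^{[1]}$, let $\mathbf p_2^{[1]}:N^{[1]}\to N_2^{[1]}$, $(x,P)\mapsto(\mathbf p_2(x),\mathbf p_{2*}P)$, and let a subscript $\mathrm{sb}$ denote the part of a space of covectors that annihilates $\ker \mathbf p^{[1]}_{2*}$. Then the set $$\widetilde N=\{\,e\in N^{[1]}\ :\ \operatorname{rank}(\hat W^\infty_{[1]})_{\mathrm{sb},e}=2\ \text{ and }\ \operatorname{rank}(\check W^\infty_{[1]})_{\mathrm{sb},e}=2\,\}$$ is an open and dense subset of $N^{[1]}$. -/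

import Mathlib

open scoped Manifold ContDiff Topology

noncomputable section

namespace EDS

theorem update_castAdd {X : Type*} {p q : ℕ} (v : Fin (p + q) → X) (i : Fin p) (z : X) :
    (fun a => Function.update v (Fin.castAdd q i) z (Fin.castAdd q a)) =
        Function.update (fun a => v (Fin.castAdd q a)) i z ∧
      (fun a => Function.update v (Fin.castAdd q i) z (Fin.natAdd p a)) =
        fun a => v (Fin.natAdd p a) :=
  ⟨Function.update_comp_eq_of_injective v (Fin.castAdd_injective p q) i z,
    funext fun a => Function.update_of_ne (by simp [Fin.ext_iff]; omega) _ _⟩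

theorem update_natAdd {X : Type*} {p q : ℕ} (v : Fin (p + q) → X) (j : Fin q) (z : X) :
    (fun a => Function.update v (Fin.natAdd p j) z (Fin.natAdd p a)) =
        Function.update (fun a => v (Fin.natAdd p a)) j z ∧
      (fun a => Function.update v (Fin.natAdd p j) z (Fin.castAdd q a)) =
        fun a => v (Fin.castAdd q a) :=
  ⟨Function.update_comp_eq_of_injective v (Fin.natAdd_injective q p) j z,
    funext fun a => Function.update_of_ne (by simp [Fin.ext_iff]; omega) _ _⟩

/-- Alternating `p`-forms on `E`. -/
abbrev Form (E : Type*) [NormedAddCommGroup E] [NormedSpace ℝ E] (p : ℕ) : Type _ :=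
  E [⋀^Fin p]→L[ℝ] ℝ

section LinearAlgebra

variable {E F : Type*} [NormedAddCommGroup E] [NormedSpace ℝ E]
  [NormedAddCommGroup F] [NormedSpace ℝ F]

/-- The product `(v₁, …, v_{p+q}) ↦ α (v₁, …, v_p) * β (v_{p+1}, …, v_{p+q})`. -/
def tensorForm {p q : ℕ} (α : Form E p) (β : Form E q) :
    ContinuousMultilinearMap ℝ (fun _ : Fin (p + q) => E) ℝ where
  toFun v := α (fun i => v (Fin.castAdd q i)) * β (fun j => v (Fin.natAdd p j))
  map_update_add' := by
    intro inst v k x y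
    obtain rfl := Subsingleton.elim inst (instDecidableEqFin (p + q))
    refine Fin.addCases (fun i => ?_) (fun j => ?_) k
    · simp only [(update_castAdd v i _).1, (update_castAdd v i _).2, α.map_update_add, add_mul]
    · simp only [(update_natAdd v j _).1, (update_natAdd v j _).2, β.map_update_add, mul_add]
  map_update_smul' := by
    intro inst v k c x
    obtain rfl := Subsingleton.elim inst (instDecidableEqFin (p + q))
    refine Fin.addCases (fun i => ?_) (fun j => ?_) k
    · simp only [(update_castAdd v i _).1, (update_castAdd v i _).2, α.map_update_smul,
        smul_eq_mul, mul_assoc]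
    · simp only [(update_natAdd v j _).1, (update_natAdd v j _).2, β.map_update_smul,
        smul_eq_mul, mul_left_comm]
  cont :=
    (α.cont.comp (by fun_prop : Continuous fun (v : Fin (p + q) → E) i => v (Fin.castAdd q i))).mul
      (β.cont.comp (by fun_prop : Continuous fun (v : Fin (p + q) → E) j => v (Fin.natAdd p j)))

/-- The wedge product of alternating forms, `(α ∧ β)(v) = 1/(p! q!) ∑_σ sgn σ ⬝ (α ⊗ β)(v ∘ σ)`. -/
def wedge {p q : ℕ} (α : Form E p) (β : Form E q) :
    Form E (p + q) :=
  ((p.factorial * q.factorial : ℝ)⁻¹) •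
    ContinuousMultilinearMap.alternatization (tensorForm α β)

theorem wedge_apply {p q : ℕ} (α : Form E p) (β : Form E q)
    (v : Fin (p + q) → E) :
    wedge α β v = ((p.factorial * q.factorial : ℝ)⁻¹) *
      ∑ σ : Equiv.Perm (Fin (p + q)), Equiv.Perm.sign σ •
        (α (fun i => v (σ (Fin.castAdd q i))) * β (fun j => v (σ (Fin.natAdd p j)))) := by
  simp only [wedge, ContinuousAlternatingMap.smul_apply,
    ContinuousMultilinearMap.alternatization_apply_apply, smul_eq_mul]
  rfl

/-- A covector regarded as an alternating `1`-form. -/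
def oneForm (α : E →L[ℝ] ℝ) : Form E 1 :=
  ContinuousAlternatingMap.ofSubsingleton ℝ E ℝ 0 α

@[simp] theorem oneForm_apply (α : E →L[ℝ] ℝ) (v : Fin 1 → E) : oneForm α v = α (v 0) := rfl

/-- The 2-form `α ∧ β` for covectors `α`, `β`. -/
def wedge₂ (α β : E →L[ℝ] ℝ) : Form E 2 := wedge (oneForm α) (oneForm β)

theorem wedge₂_apply (α β : E →L[ℝ] ℝ) (v : Fin 2 → E) :
    wedge₂ α β v = α (v 0) * β (v 1) - α (v 1) * β (v 0) := by
  have h : (Finset.univ : Finset (Equiv.Perm (Fin 2))) = {1, Equiv.swap 0 1} := by decide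
  have hne : (1 : Equiv.Perm (Fin 2)) ≠ Equiv.swap 0 1 := by decide
  have hs : Equiv.Perm.sign (Equiv.swap (0 : Fin 2) 1) = -1 := by decide
  have key := wedge_apply (oneForm α) (oneForm β) v
  rw [wedge₂, key]
  have e0 : (Fin.castAdd 1 (0 : Fin 1) : Fin 2) = 0 := rfl
  change _ * ∑ σ ∈ (Finset.univ : Finset (Equiv.Perm (Fin 2))), _ = _
  rw [h, Finset.sum_pair hne, hs]
  simp [e0]
  ring

theorem wedge_comp {p q : ℕ} (α : Form F p) (β : Form F q) (L : E →L[ℝ] F) :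
    (wedge α β).compContinuousLinearMap L =
      wedge (α.compContinuousLinearMap L) (β.compContinuousLinearMap L) := by
  ext v
  simp only [ContinuousAlternatingMap.compContinuousLinearMap_apply, wedge_apply]
  rfl

theorem oneForm_comp (α : F →L[ℝ] ℝ) (L : E →L[ℝ] F) :
    (oneForm α).compContinuousLinearMap L = oneForm (α.comp L) := rfl

theorem wedge₂_comp (α β : F →L[ℝ] ℝ) (L : E →L[ℝ] F) :
    (wedge₂ α β).compContinuousLinearMap L = wedge₂ (α.comp L) (β.comp L) :=
  wedge_comp _ _ L

variable (E) in
/-- A homogeneous ideal of the exterior algebra `⨁ₚ Λᵖ E*`. -/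
@[ext] structure FormIdeal where
  carrier : ∀ p : ℕ, Submodule ℝ (Form E p)
  wedge_left : ∀ {p q : ℕ} (η : Form E q) {γ : Form E p}, γ ∈ carrier p →
    wedge η γ ∈ carrier (q + p)
  wedge_right : ∀ {p q : ℕ} (η : Form E q) {γ : Form E p}, γ ∈ carrier p →
    wedge γ η ∈ carrier (p + q)

namespace FormIdeal

/-- The smallest homogeneous ideal containing a set of forms (of various degrees). -/
def span (G : Set (Σ p : ℕ, Form E p)) : FormIdeal E where
  carrier p := ⨅ (𝔞 : FormIdeal E) (_ : ∀ g ∈ G, g.2 ∈ 𝔞.carrier g.1), 𝔞.carrier p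
  wedge_left η γ hγ := by
    simp only [Submodule.mem_iInf] at hγ ⊢
    exact fun 𝔞 h => 𝔞.wedge_left η (hγ 𝔞 h)
  wedge_right η γ hγ := by
    simp only [Submodule.mem_iInf] at hγ ⊢
    exact fun 𝔞 h => 𝔞.wedge_right η (hγ 𝔞 h)

theorem mem_span {G : Set (Σ p : ℕ, Form E p)} {p : ℕ} {γ : Form E p} :
    γ ∈ (span G).carrier p ↔
      ∀ 𝔞 : FormIdeal E, (∀ g ∈ G, g.2 ∈ 𝔞.carrier g.1) → γ ∈ 𝔞.carrier p := by
  simp only [span, Submodule.mem_iInf]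

theorem subset_span {G : Set (Σ p : ℕ, Form E p)} {g : Σ p : ℕ, Form E p} (hg : g ∈ G) :
    g.2 ∈ (span G).carrier g.1 :=
  mem_span.2 fun _ h => h g hg

theorem span_eq_of {G G' : Set (Σ p : ℕ, Form E p)}
    (h : ∀ g ∈ G, g.2 ∈ (span G').carrier g.1) (h' : ∀ g ∈ G', g.2 ∈ (span G).carrier g.1) :
    span G = span G' := by
  ext p γ
  exact ⟨fun hγ => mem_span.1 hγ _ h, fun hγ => mem_span.1 hγ _ h'⟩

/-- The ideal of all forms whose restriction to the subspace `P` vanishes. -/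
def vanishing (P : Submodule ℝ E) : FormIdeal E where
  carrier p :=
    { carrier := {γ | ∀ v : Fin p → E, (∀ i, v i ∈ P) → γ v = 0}
      add_mem' := fun h h' v hv => by simp [h v hv, h' v hv]
      zero_mem' := fun v _ => rfl
      smul_mem' := fun c γ h v hv => by simp [h v hv] }
  wedge_left η γ h v hv := by
    rw [wedge_apply, Finset.sum_eq_zero, mul_zero]
    intro σ _
    rw [h _ fun i => hv _, mul_zero, smul_zero]
  wedge_right η γ h v hv := by
    rw [wedge_apply, Finset.sum_eq_zero, mul_zero]
    intro σ _
    rw [h _ fun i => hv _, zero_mul, smul_zero]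

/-- The ideal of all forms whose pullback by `L` lies in `𝔞`. -/
def comap (L : E →L[ℝ] F) (𝔞 : FormIdeal E) : FormIdeal F where
  carrier p :=
    { carrier := {γ | γ.compContinuousLinearMap L ∈ 𝔞.carrier p}
      add_mem' := fun h h' => (𝔞.carrier p).add_mem h h'
      zero_mem' := (𝔞.carrier p).zero_mem
      smul_mem' := fun c _ h => (𝔞.carrier p).smul_mem c h }
  wedge_left η γ h := by
    change (wedge η γ).compContinuousLinearMap L ∈ 𝔞.carrier _
    rw [wedge_comp]
    exact 𝔞.wedge_left _ h
  wedge_right η γ h := by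
    change (wedge γ η).compContinuousLinearMap L ∈ 𝔞.carrier _
    rw [wedge_comp]
    exact 𝔞.wedge_right _ h

theorem mem_comap {L : E →L[ℝ] F} {𝔞 : FormIdeal E} {p : ℕ} {γ : Form F p} :
    γ ∈ (comap L 𝔞).carrier p ↔ γ.compContinuousLinearMap L ∈ 𝔞.carrier p := Iff.rfl

end FormIdeal

/-- The 2-plane (see `finrank_slopePlane`)
`{θ = 0, σ_{1-i} = a σ_i, τ_{1-j} = b τ_j}` for a coframe `θ, σ, τ`. -/
def slopePlane {s : ℕ} (θ : Fin s → E →L[ℝ] ℝ) (σ τ : Fin 2 → E →L[ℝ] ℝ) (i j : Fin 2)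
    (a b : ℝ) : Submodule ℝ E where
  carrier := {v | (∀ k, θ k v = 0) ∧ σ (1 - i) v = a * σ i v ∧ τ (1 - j) v = b * τ j v}
  add_mem' := by
    rintro v w ⟨h1, h2, h3⟩ ⟨h1', h2', h3'⟩
    refine ⟨fun k => by simp [h1, h1'], by simp [h2, h2', mul_add], by simp [h3, h3', mul_add]⟩
  zero_mem' := by simp
  smul_mem' := by
    rintro c v ⟨h1, h2, h3⟩
    refine ⟨fun k => by simp [h1], by simp [h2, mul_left_comm], by simp [h3, mul_left_comm]⟩

theorem mem_slopePlane {s : ℕ} {θ : Fin s → E →L[ℝ] ℝ} {σ τ : Fin 2 → E →L[ℝ] ℝ} {i j : Fin 2}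
    {a b : ℝ} {v : E} : v ∈ slopePlane θ σ τ i j a b ↔
      (∀ k, θ k v = 0) ∧ σ (1 - i) v = a * σ i v ∧ τ (1 - j) v = b * τ j v := Iff.rfl

/-- The number `a` such that `β = a α` on the subspace `P`. -/
def slope (P : Submodule ℝ E) (α β : E →L[ℝ] ℝ) : ℝ :=
  open Classical in if h : ∃ a : ℝ, ∀ v ∈ P, β v = a * α v then h.choose else 0

theorem slope_eq {P : Submodule ℝ E} {α β : E →L[ℝ] ℝ} {a : ℝ} (h : ∀ v ∈ P, β v = a * α v)
    {v : E} (hv : v ∈ P) (hα : α v ≠ 0) : slope P α β = a := by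
  have h' : ∃ a : ℝ, ∀ v ∈ P, β v = a * α v := ⟨a, h⟩
  rw [slope, dif_pos h']
  exact mul_right_cancel₀ hα ((h'.choose_spec v hv).symm.trans (h v hv))

theorem exists_slope {P : Submodule ℝ E} {α β : E →L[ℝ] ℝ}
    (h : ∀ v ∈ P, ∀ w ∈ P, α v * β w = α w * β v) {v : E} (hv : v ∈ P) (hα : α v ≠ 0) :
    ∀ w ∈ P, β w = (β v / α v) * α w := by
  intro w hw
  field_simp
  linarith [h v hv w hw]

section Frame

variable {s : ℕ} {θ : Fin s → E →L[ℝ] ℝ} {σ τ : Fin 2 → E →L[ℝ] ℝ}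

/-- The values of the covectors `θ, σ, τ` on a vector. -/
def frameMap (θ : Fin s → E →L[ℝ] ℝ) (σ τ : Fin 2 → E →L[ℝ] ℝ) :
    E →L[ℝ] (Fin s → ℝ) × (Fin 2 → ℝ) × (Fin 2 → ℝ) :=
  (ContinuousLinearMap.pi θ).prod ((ContinuousLinearMap.pi σ).prod (ContinuousLinearMap.pi τ))

@[simp] theorem frameMap_apply (v : E) :
    frameMap θ σ τ v = (fun k => θ k v, fun k => σ k v, fun k => τ k v) := rfl

theorem fin2_cases (i k : Fin 2) : k = i ∨ k = 1 - i := by revert i k; decide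

theorem fin2_ne (i : Fin 2) : 1 - i ≠ i := by revert i; decide

theorem fin2_sub_sub (i : Fin 2) : 1 - (1 - i) = i := by revert i; decide

theorem fin2_fun_ext {f g : Fin 2 → ℝ} (i : Fin 2) (h : f i = g i) (h' : f (1 - i) = g (1 - i)) :
    f = g := by
  funext k
  rcases fin2_cases i k with rfl | rfl <;> assumption

theorem finrank_slopePlane (hb : Function.Bijective (frameMap θ σ τ)) (i j : Fin 2) (a b : ℝ) :
    Module.finrank ℝ (slopePlane θ σ τ i j a b) = 2 := by
  let L : slopePlane θ σ τ i j a b →ₗ[ℝ] ℝ × ℝ :=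
    ((σ i).toLinearMap.prod (τ j).toLinearMap).comp (Submodule.subtype _)
  have hL : Function.Bijective L := by
    constructor
    · rw [injective_iff_map_eq_zero]
      rintro ⟨v, hv0⟩ hv
      obtain ⟨h1, h2, h3⟩ := mem_slopePlane.1 hv0
      have hσ : σ i v = 0 := congrArg Prod.fst hv
      have hτ : τ j v = 0 := congrArg Prod.snd hv
      rw [hσ, mul_zero] at h2
      rw [hτ, mul_zero] at h3
      apply Subtype.ext
      apply hb.1
      rw [Submodule.coe_zero, map_zero]
      refine Prod.ext (funext h1) (Prod.ext (fin2_fun_ext i hσ h2) (fin2_fun_ext j hτ h3))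
    · rintro ⟨x, y⟩
      obtain ⟨v, hv⟩ := hb.2 (0, fun k => if k = i then x else a * x,
        fun k => if k = j then y else b * y)
      have h1 := congrArg Prod.fst hv
      have h2 := congrArg (fun w => w.2.1) hv
      have h3 := congrArg (fun w => w.2.2) hv
      simp only [frameMap_apply, funext_iff] at h1 h2 h3
      refine ⟨⟨v, h1, ?_, ?_⟩, ?_⟩
      · rw [h2, h2, if_pos rfl, if_neg (fin2_ne i)]
      · rw [h3, h3, if_pos rfl, if_neg (fin2_ne j)]
      · refine Prod.ext ((h2 i).trans (if_pos rfl)) ((h3 j).trans (if_pos rfl))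
  rw [(LinearEquiv.ofBijective L hL).finrank_eq]
  simp

theorem eq_slopePlane {P : Submodule ℝ E} (hb : Function.Bijective (frameMap θ σ τ))
    (hP : Module.finrank ℝ P = 2) {i j : Fin 2} {a b : ℝ}
    (h1 : ∀ k, ∀ v ∈ P, θ k v = 0) (h2 : ∀ v ∈ P, σ (1 - i) v = a * σ i v)
    (h3 : ∀ v ∈ P, τ (1 - j) v = b * τ j v) : slopePlane θ σ τ i j a b = P := by
  have hf := finrank_slopePlane hb i j a b
  have : FiniteDimensional ℝ (slopePlane θ σ τ i j a b) :=
    Module.finite_of_finrank_pos (by omega)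
  exact (Submodule.eq_of_le_of_finrank_eq (fun v hv => mem_slopePlane.2 ⟨fun k => h1 k v hv, h2 v hv, h3 v hv⟩)
    (hP.trans hf.symm)).symm

theorem exists_ne_zero {P : Submodule ℝ E} (hb : Function.Bijective (frameMap θ σ τ))
    (hP : Module.finrank ℝ P = 2)
    (h1 : ∀ k, ∀ v ∈ P, θ k v = 0) (h3 : ∀ v ∈ P, ∀ w ∈ P, τ 0 v * τ 1 w = τ 0 w * τ 1 v) :
    ∃ i, ∃ v ∈ P, σ i v ≠ 0 := by
  by_contra! h
  let L : P →ₗ[ℝ] ℝ × ℝ := ((τ 0).toLinearMap.prod (τ 1).toLinearMap).comp (Submodule.subtype _)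
  have hL : Function.Injective L := by
    rw [injective_iff_map_eq_zero]
    rintro ⟨v, hv⟩ hv'
    have e0 : τ 0 v = 0 := congrArg Prod.fst hv'
    have e1 : τ 1 v = 0 := congrArg Prod.snd hv'
    apply Subtype.ext
    apply hb.1
    rw [Submodule.coe_zero, map_zero]
    exact Prod.ext (funext fun k => h1 k v hv) (Prod.ext (funext fun k => h k v hv)
      (fin2_fun_ext 0 e0 e1))
  have hs : Function.Surjective L := by
    have : FiniteDimensional ℝ P := Module.finite_of_finrank_pos (by omega)
    exact (LinearMap.injective_iff_surjective_of_finrank_eq_finrank (by simp [hP])).1 hL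
  obtain ⟨⟨v, hv⟩, hv'⟩ := hs (1, 0)
  obtain ⟨⟨w, hw⟩, hw'⟩ := hs (0, 1)
  have a1 : τ 0 v = 1 := congrArg Prod.fst hv'
  have a2 : τ 1 v = 0 := congrArg Prod.snd hv'
  have a3 : τ 0 w = 0 := congrArg Prod.fst hw'
  have a4 : τ 1 w = 1 := congrArg Prod.snd hw'
  have := h3 v hv w hw
  rw [a1, a2, a3, a4] at this
  norm_num at this

end Frame

end LinearAlgebra

section Manifolds

variable (E : Type*) [NormedAddCommGroup E] [NormedSpace ℝ E]
  (E' : Type*) [NormedAddCommGroup E'] [NormedSpace ℝ E']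
  {M : Type*} [TopologicalSpace M] [ChartedSpace E M]
  {M' : Type*} [TopologicalSpace M'] [ChartedSpace E' M']

/-- The tangent map of `f` at `x`. In Mathlib the tangent spaces of a manifold modelled on `E` are
copies of `E`. -/
def tangentMap (f : M → M') (x : M) : E →L[ℝ] E' := mfderiv 𝓘(ℝ, E) 𝓘(ℝ, E') f x

/-- The differential of a function. -/
def differential (f : M → ℝ) (x : M) : E →L[ℝ] ℝ := tangentMap E ℝ f x

variable {E E'}

/-- The expression in the preferred chart around `x₀` of a field of `p`-forms. -/
def inChart {p : ℕ} (γ : M → Form E p) (x₀ : M) (z : E) : Form E p :=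
  (γ ((extChartAt 𝓘(ℝ, E) x₀).symm z)).compContinuousLinearMap
    (tangentMap E E (extChartAt 𝓘(ℝ, E) x₀).symm z)

/-- The field of forms `γ` is smooth on the open set `U`. -/
def SmoothFormOn {p : ℕ} (γ : M → Form E p) (U : Set M) : Prop :=
  ∀ x₀ : M, ContDiffOn ℝ ∞ (inChart γ x₀)
    ((extChartAt 𝓘(ℝ, E) x₀).target ∩ (extChartAt 𝓘(ℝ, E) x₀).symm ⁻¹' U)

/-- The field of covectors `α` is smooth on the open set `U`. -/
def SmoothCovectorOn (α : M → E →L[ℝ] ℝ) (U : Set M) : Prop :=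
  SmoothFormOn (fun x => oneForm (α x)) U

/-- The exterior derivative at `x`, computed in the preferred chart around `x`. -/
def extDerivAt {p : ℕ} (γ : M → Form E p) (x : M) : Form E (p + 1) :=
  (extDeriv (inChart γ x) (extChartAt 𝓘(ℝ, E) x x)).compContinuousLinearMap
    (tangentMap E E (extChartAt 𝓘(ℝ, E) x) x)

variable (E M) in
/-- An exterior differential system: a differential ideal of `Ω^*(M)` of constant rank, given by
the fibres of the subbundles `I^p ⊆ Λ^p T^*M`. -/
structure ExtDiffSystem where
  ideal : M → FormIdeal E
  locally_spanned : ∀ (p : ℕ) (x : M), ∃ U : Set M, IsOpen U ∧ x ∈ U ∧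
    ∃ (r : ℕ) (γ : Fin r → M → Form E p), (∀ i, SmoothFormOn (γ i) U) ∧
      ∀ y ∈ U, LinearIndependent ℝ (fun i => γ i y) ∧
        Submodule.span ℝ (Set.range fun i => γ i y) = (ideal y).carrier p
  closed : ∀ (p : ℕ) (U : Set M), IsOpen U → ∀ γ : M → Form E p, SmoothFormOn γ U →
    (∀ y ∈ U, γ y ∈ (ideal y).carrier p) →
      ∀ y ∈ U, extDerivAt γ y ∈ (ideal y).carrier (p + 1)

/-- A smooth coframe `θ¹, …, θˢ, σ¹, σ², τ¹, τ²` on `U`. -/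
structure Coframe (s : ℕ) (U : Set M) where
  θ : Fin s → M → E →L[ℝ] ℝ
  σ : Fin 2 → M → E →L[ℝ] ℝ
  τ : Fin 2 → M → E →L[ℝ] ℝ
  smooth_θ : ∀ k, SmoothCovectorOn (θ k) U
  smooth_σ : ∀ k, SmoothCovectorOn (σ k) U
  smooth_τ : ∀ k, SmoothCovectorOn (τ k) U
  bijective : ∀ y ∈ U, Function.Bijective
    (frameMap (fun k => θ k y) (fun k => σ k y) (fun k => τ k y))

/-- The forms `θ¹, …, θˢ, σ¹ ∧ σ², τ¹ ∧ τ²` at the point `y`. -/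
def Coframe.generators {s : ℕ} {U : Set M} (c : Coframe (E := E) s U) (y : M) :
    Set (Σ p : ℕ, Form E p) :=
  {g | ∃ k, g = ⟨1, oneForm (c.θ k y)⟩} ∪
    {⟨2, wedge₂ (c.σ 0 y) (c.σ 1 y)⟩, ⟨2, wedge₂ (c.τ 0 y) (c.τ 1 y)⟩}

/-- On `U` the field of ideals `I` is algebraically generated by
`θ¹, …, θˢ, σ¹ ∧ σ², τ¹ ∧ τ²`. -/
def Coframe.IsAdapted {s : ℕ} {U : Set M} (c : Coframe (E := E) s U) (I : M → FormIdeal E) :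
    Prop :=
  ∀ y ∈ U, I y = FormIdeal.span (c.generators y)

variable (E M) in
/-- A hyperbolic exterior differential system of class `s`. -/
structure HyperbolicSystem (s : ℕ) extends ExtDiffSystem E M where
  exists_coframe : ∀ x : M, ∃ U : Set M, IsOpen U ∧ x ∈ U ∧
    ∃ c : Coframe (E := E) s U, c.IsAdapted ideal

/-- `W₁` and `W₂` are, on the open set `U`, the two singular Pfaffian systems of the class `s`
hyperbolic system `I`. -/
def IsSingularPair (s : ℕ) (I : M → FormIdeal E) (U : Set M)
    (W₁ W₂ : M → Submodule ℝ (E →L[ℝ] ℝ)) : Prop :=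
  ∀ x ∈ U, ∃ V : Set M, IsOpen V ∧ x ∈ V ∧ ∃ c : Coframe (E := E) s V, c.IsAdapted I ∧
    ∀ y ∈ V,
      W₁ y = Submodule.span ℝ (Set.range (fun k => c.θ k y) ∪ Set.range (fun k => c.σ k y)) ∧
      W₂ y = Submodule.span ℝ (Set.range (fun k => c.θ k y) ∪ Set.range (fun k => c.τ k y))

/-- The fibre at `x` of the bundle `W^∞` of first integrals of `W`: the span of the differentials
at `x` of the smooth functions `f` with `df ∈ W` near `x`. -/
def firstIntegrals (W : M → Submodule ℝ (E →L[ℝ] ℝ)) (x : M) : Submodule ℝ (E →L[ℝ] ℝ) :=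
  Submodule.span ℝ {α | ∃ (U : Set M) (f : M → ℝ), IsOpen U ∧ x ∈ U ∧
    ContMDiffOn 𝓘(ℝ, E) 𝓘(ℝ, ℝ) ∞ f U ∧ (∀ y ∈ U, differential E f y ∈ W y) ∧
      α = differential E f x}

/-- Both singular Pfaffian systems of the class `s` hyperbolic system `I` have exactly `r`
independent first integrals at every point. -/
def FirstIntegralsHaveRank (s : ℕ) (I : M → FormIdeal E) (r : ℕ) : Prop :=
  ∀ (U : Set M) (W₁ W₂ : M → Submodule ℝ (E →L[ℝ] ℝ)), IsOpen U → IsSingularPair s I U W₁ W₂ →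
    ∀ x ∈ U, Module.finrank ℝ (firstIntegrals W₁ x) = r ∧
      Module.finrank ℝ (firstIntegrals W₂ x) = r

/-- The covectors at `x` which are semi-basic for `f`. -/
def semibasic (f : M → M') (x : M) : Submodule ℝ (E →L[ℝ] ℝ) where
  carrier := {α | ∀ v : E, tangentMap E E' f x v = 0 → α v = 0}
  add_mem' := fun h h' v hv => by simp [h v hv, h' v hv]
  zero_mem' := fun v _ => rfl
  smul_mem' := fun c α h v hv => by simp [h v hv]

/-- The subspace of vectors annihilated by a space of covectors. -/
def annihilator (J : Submodule ℝ (E →L[ℝ] ℝ)) : Submodule ℝ E where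
  carrier := {v | ∀ α ∈ J, α v = 0}
  add_mem' := fun h h' α hα => by simp [h α hα, h' α hα]
  zero_mem' := fun α _ => map_zero α
  smul_mem' := fun c v h α hα => by simp [h α hα]

/-- `J` is a smooth subbundle of `T^*M`. -/
def IsSmoothSubbundle (J : M → Submodule ℝ (E →L[ℝ] ℝ)) : Prop :=
  ∀ x : M, ∃ U : Set M, IsOpen U ∧ x ∈ U ∧ ∃ (r : ℕ) (ξ : Fin r → M → E →L[ℝ] ℝ),
    (∀ i, SmoothCovectorOn (ξ i) U) ∧
      ∀ y ∈ U, LinearIndependent ℝ (fun i => ξ i y) ∧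
        Submodule.span ℝ (Set.range fun i => ξ i y) = J y

/-- `f : (𝓔, M) → (𝓘, M')` is an integrable extension: `f` is a submersion and there is a subbundle
`J ⊆ T^*M`, with `ann J` complementary to the tangent spaces of the fibres of `f`, such that `𝓔` is
algebraically generated by `J` and `f^* 𝓘`. -/
def IsIntegrableExtension (f : M → M') (𝓔 : ExtDiffSystem E M) (𝓘 : ExtDiffSystem E' M') : Prop :=
  ContMDiff 𝓘(ℝ, E) 𝓘(ℝ, E') ∞ f ∧ (∀ x, Function.Surjective (tangentMap E E' f x)) ∧
    ∃ J : M → Submodule ℝ (E →L[ℝ] ℝ), IsSmoothSubbundle J ∧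
      (∀ x, IsCompl (annihilator (J x)) (LinearMap.ker (tangentMap E E' f x).toLinearMap)) ∧
      ∀ x, 𝓔.ideal x = FormIdeal.span
        ({g | ∃ α ∈ J x, g = ⟨1, oneForm α⟩} ∪
          {g | ∃ (p : ℕ) (γ : Form E' p), γ ∈ (𝓘.ideal (f x)).carrier p ∧
            g = ⟨p, γ.compContinuousLinearMap (tangentMap E E' f x)⟩})

/-- The class 1 hyperbolic system is a (hyperbolic) Monge-Ampère system: its 1-forms are contact
forms. -/
def IsMongeAmpere (𝓘 : HyperbolicSystem E M 1) : Prop :=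
  ∀ (U : Set M) (θ : M → Form E 1), IsOpen U → SmoothFormOn θ U →
    (∀ y ∈ U, θ y ∈ (𝓘.ideal y).carrier 1) →
      ∀ y ∈ U, θ y ≠ 0 → wedge (θ y) (wedge (extDerivAt θ y) (extDerivAt θ y)) ≠ 0

/-- The Monge-Ampère system of the wave equation `u_{xy} = 0`: around each point there are local
coordinates `x, y, u, p = u_x, q = u_y` in which the system is algebraically generated by
`du - p dx - q dy`, `dp ∧ dx` and `dq ∧ dy`. -/
def IsWaveSystem (𝓘 : ExtDiffSystem E M) : Prop :=
  ∀ m : M, ∃ (U : Set M) (x y u p q : M → ℝ), IsOpen U ∧ m ∈ U ∧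
    (∀ f ∈ [x, y, u, p, q], ContMDiffOn 𝓘(ℝ, E) 𝓘(ℝ, ℝ) ∞ f U) ∧
    ∀ z ∈ U,
      Function.Bijective (fun (v : E) (i : Fin 5) => differential E (![x, y, u, p, q] i) z v) ∧
      𝓘.ideal z = FormIdeal.span
        {⟨1, oneForm (differential E u z - p z • differential E x z - q z • differential E y z)⟩,
          ⟨2, wedge₂ (differential E p z) (differential E x z)⟩,
          ⟨2, wedge₂ (differential E q z) (differential E y z)⟩}

/-- A 2-dimensional integral element: a 2-plane in a tangent space on which all forms of the
system vanish. -/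
@[ext] structure IntegralElement (𝓘 : ExtDiffSystem E M) where
  base : M
  plane : Submodule ℝ E
  finrank_plane : Module.finrank ℝ plane = 2
  vanish : ∀ (p : ℕ), ∀ γ ∈ (𝓘.ideal base).carrier p, ∀ v : Fin p → E, (∀ i, v i ∈ plane) →
    γ v = 0

/-- The differential ideal, at the point `x`, generated by the Pfaffian system `C`: it is generated
algebraically by the sections of `C` and their exterior derivatives. -/
def pfaffianIdeal (C : M → Submodule ℝ (E →L[ℝ] ℝ)) (x : M) : FormIdeal E :=
  FormIdeal.span
    ({g | ∃ α ∈ C x, g = ⟨1, oneForm α⟩} ∪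
      {g | ∃ (U : Set M) (θ : M → E →L[ℝ] ℝ), IsOpen U ∧ x ∈ U ∧ SmoothCovectorOn θ U ∧
        (∀ y ∈ U, θ y ∈ C y) ∧ g = ⟨2, extDerivAt (fun y => oneForm (θ y)) x⟩})

end Manifolds

section Prolongation

variable {E : Type*} [NormedAddCommGroup E] [NormedSpace ℝ E] [FiniteDimensional ℝ E]
  {M : Type*} [TopologicalSpace M] [ChartedSpace E M] [IsManifold 𝓘(ℝ, E) ∞ M] {s : ℕ}

theorem isOpen_target_inter (x₀ : M) {U : Set M} (hU : IsOpen U) :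
    IsOpen ((extChartAt 𝓘(ℝ, E) x₀).target ∩ (extChartAt 𝓘(ℝ, E) x₀).symm ⁻¹' U) :=
  (continuousOn_extChartAt_symm x₀).isOpen_inter_preimage (isOpen_extChartAt_target x₀) hU

theorem isInvertible_tangentMap_symm (x₀ : M) {z : E} (hz : z ∈ (extChartAt 𝓘(ℝ, E) x₀).target) :
    (tangentMap E E (extChartAt 𝓘(ℝ, E) x₀).symm z).IsInvertible := by
  have h := isInvertible_mfderivWithin_extChartAt_symm (I := 𝓘(ℝ, E)) hz
  rw [modelWithCornersSelf_coe, Set.range_id, mfderivWithin_univ] at h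
  exact h

/-- The expression in the preferred chart around `x₀` of a covector field. -/
def covectorInChart (α : M → E →L[ℝ] ℝ) (x₀ : M) (z : E) : E →L[ℝ] ℝ :=
  (α ((extChartAt 𝓘(ℝ, E) x₀).symm z)).comp (tangentMap E E (extChartAt 𝓘(ℝ, E) x₀).symm z)

theorem SmoothCovectorOn.contDiffOn {α : M → E →L[ℝ] ℝ} {U : Set M} (h : SmoothCovectorOn α U)
    (x₀ : M) : ContDiffOn ℝ ∞ (covectorInChart α x₀)
      ((extChartAt 𝓘(ℝ, E) x₀).target ∩ (extChartAt 𝓘(ℝ, E) x₀).symm ⁻¹' U) := by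
  have := (ContinuousAlternatingMap.ofSubsingletonLIE (𝕜 := ℝ) (E := E) (F := ℝ)
    (0 : Fin 1)).symm.contDiff (n := ∞) |>.comp_contDiffOn (h x₀)
  exact this

/-- The coefficients of the coframe in the preferred chart around `x₀`. -/
def Coframe.inChart {U : Set M} (c : Coframe (E := E) s U) (x₀ : M) (z : E) :
    E →L[ℝ] (Fin s → ℝ) × (Fin 2 → ℝ) × (Fin 2 → ℝ) :=
  (frameMap (fun k => c.θ k ((extChartAt 𝓘(ℝ, E) x₀).symm z))
    (fun k => c.σ k ((extChartAt 𝓘(ℝ, E) x₀).symm z))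
    (fun k => c.τ k ((extChartAt 𝓘(ℝ, E) x₀).symm z))).comp
      (tangentMap E E (extChartAt 𝓘(ℝ, E) x₀).symm z)

theorem Coframe.contDiffOn_inChart {U : Set M} (c : Coframe (E := E) s U) (x₀ : M) :
    ContDiffOn ℝ ∞ (c.inChart x₀)
      ((extChartAt 𝓘(ℝ, E) x₀).target ∩ (extChartAt 𝓘(ℝ, E) x₀).symm ⁻¹' U) := by
  rw [contDiffOn_clm_apply]
  intro v
  have h : ∀ {α : M → E →L[ℝ] ℝ}, SmoothCovectorOn α U → ContDiffOn ℝ ∞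
      (fun z => covectorInChart α x₀ z v)
      ((extChartAt 𝓘(ℝ, E) x₀).target ∩ (extChartAt 𝓘(ℝ, E) x₀).symm ⁻¹' U) :=
    fun hα => (hα.contDiffOn x₀).clm_apply contDiffOn_const
  exact (contDiffOn_pi.2 fun k => h (c.smooth_θ k)).prodMk
    ((contDiffOn_pi.2 fun k => h (c.smooth_σ k)).prodMk
      (contDiffOn_pi.2 fun k => h (c.smooth_τ k)))

theorem Coframe.isInvertible_inChart {U : Set M} (c : Coframe (E := E) s U) (x₀ : M) {z : E}
    (hz : z ∈ (extChartAt 𝓘(ℝ, E) x₀).target) (hz' : (extChartAt 𝓘(ℝ, E) x₀).symm z ∈ U) :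
    (c.inChart x₀ z).IsInvertible := by
  have hb := (c.bijective _ hz').comp (isInvertible_tangentMap_symm x₀ hz).bijective
  exact ⟨(LinearEquiv.ofBijective (c.inChart x₀ z).toLinearMap hb).toContinuousLinearEquiv, rfl⟩

/-- The prolongation space `M^{[1]}` of a hyperbolic system: the space of all its 2-dimensional
integral elements (for a hyperbolic system each of these is regular). -/
def Prolongation (H : HyperbolicSystem E M s) : Type _ := IntegralElement H.toExtDiffSystem

variable {H : HyperbolicSystem E M s}

theorem Coframe.IsAdapted.vanish {U : Set M} {c : Coframe (E := E) s U} (h : c.IsAdapted H.ideal)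
    (e : Prolongation H) (he : e.base ∈ U) :
    (∀ k, ∀ v ∈ e.plane, c.θ k e.base v = 0) ∧
    (∀ v ∈ e.plane, ∀ w ∈ e.plane,
      c.σ 0 e.base v * c.σ 1 e.base w = c.σ 0 e.base w * c.σ 1 e.base v) ∧
    (∀ v ∈ e.plane, ∀ w ∈ e.plane,
      c.τ 0 e.base v * c.τ 1 e.base w = c.τ 0 e.base w * c.τ 1 e.base v) := by
  have hI := h e.base he
  have key : ∀ g ∈ c.generators e.base, ∀ v : Fin g.1 → E, (∀ i, v i ∈ e.plane) → g.2 v = 0 :=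
    fun g hg v hv => e.vanish g.1 g.2 (by rw [hI]; exact FormIdeal.subset_span hg) v hv
  refine ⟨fun k v hv => ?_, fun v hv w hw => ?_, fun v hv w hw => ?_⟩
  · exact key _ (Or.inl ⟨k, rfl⟩) (fun _ => v) fun _ => hv
  · have := key _ (Or.inr (Or.inl rfl)) ![v, w] (by simp [Fin.forall_fin_two, hv, hw])
    simp only [wedge₂_apply] at this
    exact sub_eq_zero.1 this
  · have := key _ (Or.inr (Or.inr rfl)) ![v, w] (by simp [Fin.forall_fin_two, hv, hw])
    simp only [wedge₂_apply] at this
    exact sub_eq_zero.1 this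

theorem mul_eq_of_fin2 {α : Fin 2 → E →L[ℝ] ℝ} {v w : E} (h : α 0 v * α 1 w = α 0 w * α 1 v)
    (i : Fin 2) : α i v * α (1 - i) w = α i w * α (1 - i) v := by
  revert i
  rw [Fin.forall_fin_two]
  refine ⟨h, ?_⟩
  change α 1 v * α 0 w = α 1 w * α 0 v
  linarith

/-- The data of a chart of the prolongation space around the integral element `center`: an adapted
coframe on a neighbourhood `U` of the base point and indices `i`, `j`. The chart is defined at the
2-planes on which `σ_i ≠ 0` and `τ_j ≠ 0`, and its coordinates are the coordinates of the base
point together with the slopes `a`, `b`, where `σ_{1-i} = a σ_i` and `τ_{1-j} = b τ_j` on the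
2-plane. -/
structure ProlongationChart (H : HyperbolicSystem E M s) where
  center : Prolongation H
  U : Set M
  isOpen : IsOpen U
  mem : center.base ∈ U
  coframe : Coframe (E := E) s U
  adapted : coframe.IsAdapted H.ideal
  i : Fin 2
  j : Fin 2
  ne_i : ∃ v ∈ center.plane, coframe.σ i center.base v ≠ 0
  ne_j : ∃ v ∈ center.plane, coframe.τ j center.base v ≠ 0

namespace ProlongationChart

variable (d d' : ProlongationChart H)

/-- The preferred chart of `M` at the center. -/
def φ : PartialEquiv M E := extChartAt 𝓘(ℝ, E) d.center.base

/-- The 2-plane at `y` with slopes `a`, `b`. -/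
def planeAt (y : M) (a b : ℝ) : Submodule ℝ E :=
  slopePlane (fun k => d.coframe.θ k y) (fun k => d.coframe.σ k y) (fun k => d.coframe.τ k y)
    d.i d.j a b

/-- The integral element at `y` with slopes `a`, `b`. -/
def elementAt (y : M) (hy : y ∈ d.U) (a b : ℝ) : Prolongation H where
  base := y
  plane := d.planeAt y a b
  finrank_plane := finrank_slopePlane (d.coframe.bijective y hy) _ _ _ _
  vanish := by
    intro p γ hγ
    rw [d.adapted y hy] at hγ
    refine FormIdeal.mem_span.1 hγ (FormIdeal.vanishing (d.planeAt y a b)) ?_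
    have aux : ∀ (i : Fin 2) (α : Fin 2 → E →L[ℝ] ℝ) (a : ℝ) (v w : E),
        α (1 - i) v = a * α i v → α (1 - i) w = a * α i w → α 0 v * α 1 w - α 0 w * α 1 v = 0 := by
      intro i α a v w
      fin_cases i
      · intro h h'
        replace h : α 1 v = a * α 0 v := h
        replace h' : α 1 w = a * α 0 w := h'
        rw [h, h']; ring
      · intro h h'
        replace h : α 0 v = a * α 1 v := h
        replace h' : α 0 w = a * α 1 w := h'
        rw [h, h']; ring
    rintro g (⟨k, rfl⟩ | rfl | rfl) v hv
    · exact (mem_slopePlane.1 (hv 0)).1 k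
    · exact (wedge₂_apply _ _ v).trans (aux d.i (fun k => d.coframe.σ k y) a _ _
        (mem_slopePlane.1 (hv 0)).2.1 (mem_slopePlane.1 (hv 1)).2.1)
    · exact (wedge₂_apply _ _ v).trans (aux d.j (fun k => d.coframe.τ k y) b _ _
        (mem_slopePlane.1 (hv 0)).2.2 (mem_slopePlane.1 (hv 1)).2.2)

/-- The slopes of an integral element. -/
def slopes (e : Prolongation H) : ℝ × ℝ :=
  (slope e.plane (d.coframe.σ d.i e.base) (d.coframe.σ (1 - d.i) e.base),
    slope e.plane (d.coframe.τ d.j e.base) (d.coframe.τ (1 - d.j) e.base))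

theorem slopes_eq {e : Prolongation H} (he : e.base ∈ d.U) {v w : E} (hv : v ∈ e.plane)
    (hv' : d.coframe.σ d.i e.base v ≠ 0) (hw : w ∈ e.plane)
    (hw' : d.coframe.τ d.j e.base w ≠ 0) :
    d.slopes e = (d.coframe.σ (1 - d.i) e.base v / d.coframe.σ d.i e.base v,
      d.coframe.τ (1 - d.j) e.base w / d.coframe.τ d.j e.base w) := by
  obtain ⟨-, h2, h3⟩ := d.adapted.vanish e he
  refine Prod.ext ?_ ?_
  · exact slope_eq (exists_slope (fun v hv w hw => mul_eq_of_fin2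
      (α := fun k => d.coframe.σ k e.base) (h2 v hv w hw) d.i) hv hv') hv hv'
  · exact slope_eq (exists_slope (fun v hv w hw => mul_eq_of_fin2
      (α := fun k => d.coframe.τ k e.base) (h3 v hv w hw) d.j) hw hw') hw hw'

theorem plane_eq {e : Prolongation H} (he : e.base ∈ d.U)
    (hσ : ∃ v ∈ e.plane, d.coframe.σ d.i e.base v ≠ 0)
    (hτ : ∃ v ∈ e.plane, d.coframe.τ d.j e.base v ≠ 0) :
    d.planeAt e.base (d.slopes e).1 (d.slopes e).2 = e.plane := by
  obtain ⟨h1, h2, h3⟩ := d.adapted.vanish e he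
  obtain ⟨v, hv, hv'⟩ := hσ
  obtain ⟨w, hw, hw'⟩ := hτ
  rw [d.slopes_eq he hv hv' hw hw']
  exact eq_slopePlane (d.coframe.bijective _ he) e.finrank_plane h1
    (exists_slope (fun v hv w hw => mul_eq_of_fin2
      (α := fun k => d.coframe.σ k e.base) (h2 v hv w hw) d.i) hv hv')
    (exists_slope (fun v hv w hw => mul_eq_of_fin2
      (α := fun k => d.coframe.τ k e.base) (h3 v hv w hw) d.j) hw hw')

/-- The vector at `y` with `θ = 0` and with the prescribed values of `σ_i`, `τ_j` that lies in the
2-plane with slopes `a`, `b`, as values of the coframe. -/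
def vec (x y a b : ℝ) : (Fin s → ℝ) × (Fin 2 → ℝ) × (Fin 2 → ℝ) :=
  (0, fun k => if k = d.i then x else a * x, fun k => if k = d.j then y else b * y)

theorem mem_planeAt {y : M} {a b : ℝ} {v : E} (hv : v ∈ d.planeAt y a b) :
    frameMap (fun k => d.coframe.θ k y) (fun k => d.coframe.σ k y) (fun k => d.coframe.τ k y) v =
      d.vec (d.coframe.σ d.i y v) (d.coframe.τ d.j y v) a b := by
  obtain ⟨h1, h2, h3⟩ := mem_slopePlane.1 hv
  refine Prod.ext (funext h1) (Prod.ext (fin2_fun_ext d.i ?_ ?_) (fin2_fun_ext d.j ?_ ?_))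
  · simp [vec]
  · simp [vec, fin2_ne, h2]
  · simp [vec]
  · simp [vec, fin2_ne, h3]

theorem mem_planeAt_of {y : M} {a b x t : ℝ} {v : E}
    (h : frameMap (fun k => d.coframe.θ k y) (fun k => d.coframe.σ k y)
      (fun k => d.coframe.τ k y) v = d.vec x t a b) :
    v ∈ d.planeAt y a b ∧ d.coframe.σ d.i y v = x ∧ d.coframe.τ d.j y v = t := by
  have h1 := congrArg Prod.fst h
  have h2 := congrArg (fun w => w.2.1) h
  have h3 := congrArg (fun w => w.2.2) h
  simp only [frameMap_apply, funext_iff, vec] at h1 h2 h3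
  refine ⟨mem_slopePlane.2 ⟨h1, ?_, ?_⟩, ?_, ?_⟩
  · rw [h2, h2, if_pos rfl, if_neg (fin2_ne _)]
  · rw [h3, h3, if_pos rfl, if_neg (fin2_ne _)]
  · rw [h2, if_pos rfl]
  · rw [h3, if_pos rfl]

theorem exists_mem_planeAt {y : M} (hy : y ∈ d.U) (a b : ℝ) :
    (∃ v ∈ d.planeAt y a b, d.coframe.σ d.i y v ≠ 0) ∧
      ∃ v ∈ d.planeAt y a b, d.coframe.τ d.j y v ≠ 0 := by
  obtain ⟨v, hv⟩ := (d.coframe.bijective y hy).2 (d.vec 1 1 a b)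
  obtain ⟨h1, h2, h3⟩ := d.mem_planeAt_of hv
  exact ⟨⟨v, h1, by rw [h2]; exact one_ne_zero⟩, ⟨v, h1, by rw [h3]; exact one_ne_zero⟩⟩

/-- The chart of the prolongation space defined by the data `d`. -/
def chart : PartialEquiv (Prolongation H) (E × ℝ × ℝ) where
  toFun e := (d.φ e.base, d.slopes e)
  invFun w := open Classical in
    if h : d.φ.symm w.1 ∈ d.U then d.elementAt (d.φ.symm w.1) h w.2.1 w.2.2 else d.center
  source := {e | e.base ∈ d.φ.source ∧ e.base ∈ d.U ∧
    (∃ v ∈ e.plane, d.coframe.σ d.i e.base v ≠ 0) ∧ ∃ v ∈ e.plane, d.coframe.τ d.j e.base v ≠ 0}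
  target := {w | w.1 ∈ d.φ.target ∧ d.φ.symm w.1 ∈ d.U}
  map_source' e he := ⟨d.φ.map_source he.1, by simpa only [d.φ.left_inv he.1] using he.2.1⟩
  map_target' w hw := by
    rw [dif_pos hw.2]
    exact ⟨d.φ.map_target hw.1, hw.2, d.exists_mem_planeAt hw.2 _ _⟩
  left_inv' e he := by
    obtain ⟨h1, h2, h3, h4⟩ := he
    have hb : d.φ.symm (d.φ e.base) = e.base := d.φ.left_inv h1
    have hm : d.φ.symm (d.φ e.base) ∈ d.U := by rwa [hb]
    rw [dif_pos hm]
    refine IntegralElement.ext hb ?_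
    change d.planeAt (d.φ.symm (d.φ e.base)) _ _ = _
    rw [hb]
    exact d.plane_eq h2 h3 h4
  right_inv' w hw := by
    obtain ⟨h1, h2⟩ := hw
    rw [dif_pos h2]
    refine Prod.ext (d.φ.right_inv h1) ?_
    obtain ⟨⟨v, hv, hv'⟩, ⟨u, hu, hu'⟩⟩ := d.exists_mem_planeAt h2 w.2.1 w.2.2
    refine (d.slopes_eq (e := d.elementAt _ h2 w.2.1 w.2.2) h2 hv hv' hu hu').trans ?_
    refine Prod.ext ?_ ?_
    · exact (div_eq_iff hv').2 (mem_slopePlane.1 hv).2.1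
    · exact (div_eq_iff hu').2 (mem_slopePlane.1 hu).2.2

/-- The set of chart values of integral elements whose base point lies in both coframe domains and
in both charts of `M`. -/
def overlap : Set (E × ℝ × ℝ) :=
  {w | w.1 ∈ d.φ.target ∧ d.φ.symm w.1 ∈ d.U ∧ d.φ.symm w.1 ∈ d'.U ∧ d.φ.symm w.1 ∈ d'.φ.source}

theorem isOpen_overlap : IsOpen (d.overlap d') := by
  have h1 := isOpen_target_inter (E := E) d.center.base
    ((d.isOpen.inter d'.isOpen).inter (isOpen_extChartAt_source (I := 𝓘(ℝ, E)) d'.center.base))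
  convert! h1.preimage (continuous_fst (X := E) (Y := ℝ × ℝ)) using 1
  ext w
  simp only [overlap, φ]
  constructor
  · rintro ⟨a, b, c, e⟩; exact ⟨a, ⟨b, c⟩, e⟩
  · rintro ⟨a, ⟨b, c⟩, e⟩; exact ⟨a, b, c, e⟩

/-- A vector in the 2-plane with given chart value, read in the chart of `M`. -/
def vecInChart (x t : ℝ) (w : E × ℝ × ℝ) : E :=
  (d.coframe.inChart d.center.base w.1).inverse (d.vec x t w.2.1 w.2.2)

theorem contDiffOn_vecInChart (x t : ℝ) : ContDiffOn ℝ ∞ (d.vecInChart x t) (d.overlap d') := by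
  have hf : ContDiffOn ℝ ∞ (fun w : E × ℝ × ℝ => d.coframe.inChart d.center.base w.1)
      (d.overlap d') :=
    (d.coframe.contDiffOn_inChart d.center.base).comp contDiff_fst.contDiffOn
      fun w hw => ⟨hw.1, hw.2.1⟩
  refine ContDiffOn.clm_apply (f := fun w : E × ℝ × ℝ =>
    (d.coframe.inChart d.center.base w.1).inverse) ?_ ?_
  · intro w hw
    exact (ContinuousLinearMap.IsInvertible.contDiffAt_map_inverse
      (d.coframe.isInvertible_inChart d.center.base hw.1 hw.2.1)).comp_contDiffWithinAt w (hf w hw)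
  · refine (contDiffOn_const).prodMk ((contDiffOn_pi.2 fun k => ?_).prodMk
      (contDiffOn_pi.2 fun k => ?_))
    · by_cases h : k = d.i
      · simp only [h, if_true]; exact contDiffOn_const
      · simp only [h, if_false]; fun_prop
    · by_cases h : k = d.j
      · simp only [h, if_true]; exact contDiffOn_const
      · simp only [h, if_false]; fun_prop

/-- The corresponding tangent vector of `M`. -/
def vecAt (x t : ℝ) (w : E × ℝ × ℝ) : E :=
  tangentMap E E (extChartAt 𝓘(ℝ, E) d.center.base).symm w.1 (d.vecInChart x t w)

theorem frameMap_vecAt (x t : ℝ) {w : E × ℝ × ℝ} (hw : w ∈ d.overlap d') :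
    frameMap (fun k => d.coframe.θ k (d.φ.symm w.1)) (fun k => d.coframe.σ k (d.φ.symm w.1))
      (fun k => d.coframe.τ k (d.φ.symm w.1)) (d.vecAt x t w) = d.vec x t w.2.1 w.2.2 :=
  (d.coframe.isInvertible_inChart d.center.base hw.1 hw.2.1).self_apply_inverse _

theorem contDiffOn_apply_vecAt {α : M → E →L[ℝ] ℝ} (hα : SmoothCovectorOn α d'.U) (x t : ℝ) :
    ContDiffOn ℝ ∞ (fun w : E × ℝ × ℝ => α (d.φ.symm w.1) (d.vecAt x t w)) (d.overlap d') := by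
  have h1 : ContDiffOn ℝ ∞ (fun w : E × ℝ × ℝ => covectorInChart α d.center.base w.1)
      (d.overlap d') :=
    (hα.contDiffOn d.center.base).comp contDiff_fst.contDiffOn fun w hw => ⟨hw.1, hw.2.2.1⟩
  exact h1.clm_apply (d.contDiffOn_vecInChart d' x t)

theorem vecAt_mem (x t : ℝ) {w : E × ℝ × ℝ} (hw : w ∈ d.overlap d') :
    d.vecAt x t w ∈ d.planeAt (d.φ.symm w.1) w.2.1 w.2.2 :=
  (d.mem_planeAt_of (d.frameMap_vecAt d' x t hw)).1

/-- A covector that does not vanish on the 2-plane does not vanish on one of two vectors. -/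
theorem exists_ne_iff (α : E →L[ℝ] ℝ) {w : E × ℝ × ℝ} (hw : w ∈ d.overlap d') :
    (∃ v ∈ d.planeAt (d.φ.symm w.1) w.2.1 w.2.2, α v ≠ 0) ↔
      α (d.vecAt 1 0 w) ≠ 0 ∨ α (d.vecAt 0 1 w) ≠ 0 := by
  constructor
  · rintro ⟨v, hv, hne⟩
    by_contra! h
    apply hne
    set y := d.φ.symm w.1
    have : v = d.coframe.σ d.i y v • d.vecAt 1 0 w + d.coframe.τ d.j y v • d.vecAt 0 1 w := by
      apply (d.coframe.bijective y hw.2.1).1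
      rw [d.mem_planeAt hv, map_add, map_smul, map_smul, d.frameMap_vecAt d' 1 0 hw,
        d.frameMap_vecAt d' 0 1 hw]
      refine Prod.ext (by simp [vec]) (Prod.ext (funext fun k => ?_) (funext fun k => ?_))
      · by_cases h : k = d.i <;> simp [vec, h, mul_comm]
      · by_cases h : k = d.j <;> simp [vec, h, mul_comm]
    rw [this, map_add, map_smul, map_smul, h.1, h.2]
    simp
  · rintro (h | h)
    · exact ⟨_, d.vecAt_mem d' 1 0 hw, h⟩
    · exact ⟨_, d.vecAt_mem d' 0 1 hw, h⟩

/-- The transition map between two charts. -/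
def transition : PartialEquiv (E × ℝ × ℝ) (E × ℝ × ℝ) := d.chart.symm.trans d'.chart

theorem chart_symm_apply {w : E × ℝ × ℝ} (hw : d.φ.symm w.1 ∈ d.U) :
    d.chart.symm w = d.elementAt (d.φ.symm w.1) hw w.2.1 w.2.2 := dif_pos hw

theorem mem_transition_source {w : E × ℝ × ℝ} :
    w ∈ (d.transition d').source ↔ w ∈ d.overlap d' ∧
      (∃ v ∈ d.planeAt (d.φ.symm w.1) w.2.1 w.2.2, d'.coframe.σ d'.i (d.φ.symm w.1) v ≠ 0) ∧
      ∃ v ∈ d.planeAt (d.φ.symm w.1) w.2.1 w.2.2, d'.coframe.τ d'.j (d.φ.symm w.1) v ≠ 0 := by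
  rw [transition, PartialEquiv.trans_source, PartialEquiv.symm_source]
  constructor
  · rintro ⟨⟨h1, h2⟩, h3⟩
    rw [Set.mem_preimage, d.chart_symm_apply h2] at h3
    exact ⟨⟨h1, h2, h3.2.1, h3.1⟩, h3.2.2⟩
  · rintro ⟨⟨h1, h2, h3, h4⟩, h5⟩
    refine ⟨⟨h1, h2⟩, ?_⟩
    rw [Set.mem_preimage, d.chart_symm_apply h2]
    exact ⟨h4, h3, h5⟩

theorem isOpen_transition_source : IsOpen (d.transition d').source := by
  have key : ∀ {α : M → E →L[ℝ] ℝ}, SmoothCovectorOn α d'.U → IsOpen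
      {w | w ∈ d.overlap d' ∧ (α (d.φ.symm w.1) (d.vecAt 1 0 w) ≠ 0 ∨
        α (d.φ.symm w.1) (d.vecAt 0 1 w) ≠ 0)} := by
    intro α hα
    have h : ∀ x t : ℝ, IsOpen (d.overlap d' ∩
        (fun w : E × ℝ × ℝ => α (d.φ.symm w.1) (d.vecAt x t w)) ⁻¹' {0}ᶜ) := fun x t =>
      (d.contDiffOn_apply_vecAt d' hα x t).continuousOn.isOpen_inter_preimage
        (d.isOpen_overlap d') isOpen_compl_singleton
    convert! (h 1 0).union (h 0 1) using 1
    ext w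
    constructor
    · rintro ⟨h, h' | h'⟩
      exacts [Or.inl ⟨h, h'⟩, Or.inr ⟨h, h'⟩]
    · rintro (⟨h, h'⟩ | ⟨h, h'⟩)
      exacts [⟨h, Or.inl h'⟩, ⟨h, Or.inr h'⟩]
  convert! (key (d'.coframe.smooth_σ d'.i)).inter (key (d'.coframe.smooth_τ d'.j)) using 1
  ext w
  rw [mem_transition_source]
  constructor
  · rintro ⟨h, h1, h2⟩
    exact ⟨⟨h, (d.exists_ne_iff d' _ h).1 h1⟩, ⟨h, (d.exists_ne_iff d' _ h).1 h2⟩⟩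
  · rintro ⟨⟨h, h1⟩, ⟨-, h2⟩⟩
    exact ⟨h, (d.exists_ne_iff d' _ h).2 h1, (d.exists_ne_iff d' _ h).2 h2⟩

theorem contDiffOn_transition : ContDiffOn ℝ ∞ (d.transition d') (d.transition d').source := by
  intro w hw
  have hopen := d.isOpen_transition_source d'
  obtain ⟨h, h1, h2⟩ := (d.mem_transition_source d').1 hw
  have aux : ∀ {α : E →L[ℝ] ℝ}, (∃ v ∈ d.planeAt (d.φ.symm w.1) w.2.1 w.2.2, α v ≠ 0) →
      ∃ x t : ℝ, α (d.vecAt x t w) ≠ 0 := by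
    intro α hα
    rcases (d.exists_ne_iff d' _ h).1 hα with h | h
    exacts [⟨1, 0, h⟩, ⟨0, 1, h⟩]
  obtain ⟨x, t, h1⟩ := aux h1
  obtain ⟨x', t', h2⟩ := aux h2
  have ho : d.overlap d' ∈ 𝓝 w := (d.isOpen_overlap d').mem_nhds h
  have sm : ∀ {α : M → E →L[ℝ] ℝ}, SmoothCovectorOn α d'.U → ∀ x t : ℝ,
      ContDiffAt ℝ ∞ (fun w : E × ℝ × ℝ => α (d.φ.symm w.1) (d.vecAt x t w)) w := fun hα x t =>
    (d.contDiffOn_apply_vecAt d' hα x t).contDiffAt ho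
  have hbase : ContDiffAt ℝ ∞ (fun w : E × ℝ × ℝ => d'.φ (d.φ.symm w.1)) w := by
    have hs := (contDiffOn_ext_coord_change (I := 𝓘(ℝ, E)) (n := ∞) d'.center.base d.center.base)
    have hs' : ContDiffOn ℝ ∞ (fun w : E × ℝ × ℝ => d'.φ (d.φ.symm w.1)) (d.overlap d') := by
      refine hs.comp contDiff_fst.contDiffOn fun w hw => ?_
      exact ⟨hw.1, hw.2.2.2⟩
    exact hs'.contDiffAt ho
  have hall := hbase.prodMk (((sm (d'.coframe.smooth_σ (1 - d'.i)) x t).div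
    (sm (d'.coframe.smooth_σ d'.i) x t) h1).prodMk
    ((sm (d'.coframe.smooth_τ (1 - d'.j)) x' t').div (sm (d'.coframe.smooth_τ d'.j) x' t') h2))
  refine (hall.congr_of_eventuallyEq ?_).contDiffWithinAt
  have n1 := (sm (d'.coframe.smooth_σ d'.i) x t).continuousAt.eventually_ne h1
  have n2 := (sm (d'.coframe.smooth_τ d'.j) x' t').continuousAt.eventually_ne h2
  filter_upwards [ho, n1, n2] with u hu hu1 hu2
  change d'.chart (d.chart.symm u) = _
  rw [d.chart_symm_apply hu.2.1]
  exact Prod.ext rfl (d'.slopes_eq (e := d.elementAt _ hu.2.1 u.2.1 u.2.2) hu.2.2.1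
    (d.vecAt_mem d' x t hu) hu1 (d.vecAt_mem d' x' t' hu) hu2)

theorem exists_center (e : Prolongation H) : ∃ d : ProlongationChart H, d.center = e := by
  obtain ⟨U, hU, hx, c, hc⟩ := H.exists_coframe e.base
  obtain ⟨h1, h2, h3⟩ := hc.vanish e hx
  have hb := c.bijective _ hx
  obtain ⟨i, hi⟩ := exists_ne_zero hb e.finrank_plane h1 h3
  have hb' : Function.Bijective (frameMap (fun k => c.θ k e.base) (fun k => c.τ k e.base)
      (fun k => c.σ k e.base)) := by
    have hsw : Function.Bijective (fun w : (Fin s → ℝ) × (Fin 2 → ℝ) × (Fin 2 → ℝ) =>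
        ((w.1, w.2.2, w.2.1) : (Fin s → ℝ) × (Fin 2 → ℝ) × (Fin 2 → ℝ))) :=
      Function.Involutive.bijective fun w => rfl
    exact hsw.comp hb
  obtain ⟨j, hj⟩ := exists_ne_zero hb' e.finrank_plane h1 h2
  exact ⟨⟨e, U, hU, hx, c, hc, i, j, hi, hj⟩, rfl⟩

end ProlongationChart

/-- The charts of the prolongation space. -/
def prolongationCore (H : HyperbolicSystem E M s) :
    ChartedSpaceCore (E × ℝ × ℝ) (Prolongation H) where
  atlas := Set.range ProlongationChart.chart
  chartAt e := (ProlongationChart.exists_center e).choose.chart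
  mem_chart_source e := by
    obtain h := (ProlongationChart.exists_center e).choose_spec
    set d := (ProlongationChart.exists_center e).choose
    rw [← h]
    exact ⟨mem_extChartAt_source _, d.mem, d.ne_i, d.ne_j⟩
  chart_mem_atlas e := ⟨_, rfl⟩
  open_source := by
    rintro _ _ ⟨d, rfl⟩ ⟨d', rfl⟩
    exact d.isOpen_transition_source d'
  continuousOn_toFun := by
    rintro _ _ ⟨d, rfl⟩ ⟨d', rfl⟩
    exact (d.contDiffOn_transition d').continuousOn

instance : TopologicalSpace (Prolongation H) := (prolongationCore H).toTopologicalSpace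

instance : ChartedSpace (E × ℝ × ℝ) (Prolongation H) := (prolongationCore H).toChartedSpace

instance : IsManifold 𝓘(ℝ, E × ℝ × ℝ) ∞ (Prolongation H) := by
  refine isManifold_of_contDiffOn _ _ _ fun e e' he he' => ?_
  obtain ⟨f, ⟨d, rfl⟩, rfl⟩ : ∃ (f : PartialEquiv (Prolongation H) (E × ℝ × ℝ))
      (hf : f ∈ (prolongationCore H).atlas), e = (prolongationCore H).openPartialHomeomorph f hf := by
    simpa only [atlas, ChartedSpace.atlas, ChartedSpaceCore.toChartedSpace, Set.mem_iUnion,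
      Set.mem_singleton_iff] using he
  obtain ⟨f', ⟨d', rfl⟩, rfl⟩ : ∃ (f : PartialEquiv (Prolongation H) (E × ℝ × ℝ))
      (hf : f ∈ (prolongationCore H).atlas), e' = (prolongationCore H).openPartialHomeomorph f hf := by
    simpa only [atlas, ChartedSpace.atlas, ChartedSpaceCore.toChartedSpace, Set.mem_iUnion,
      Set.mem_singleton_iff] using he'
  have h := d.contDiffOn_transition d'
  simp only [modelWithCornersSelf_coe, modelWithCornersSelf_coe_symm, Set.range_id, Set.inter_univ,
    Set.preimage_id, Function.comp_id, Function.id_comp]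
  exact h

/-- The projection `M^{[1]} → M`. -/
def Prolongation.proj (e : Prolongation H) : M := e.base

/-- The canonical Pfaffian system on the prolongation space: its fibre at the 2-plane `P ⊆ T_xM`
consists of the pullbacks of the covectors at `x` which annihilate `P`. -/
def contactSystem (H : HyperbolicSystem E M s) (e : Prolongation H) :
    Submodule ℝ (E × ℝ × ℝ →L[ℝ] ℝ) :=
  Submodule.span ℝ {β | ∃ α : E →L[ℝ] ℝ, (∀ v ∈ e.plane, α v = 0) ∧
    β = α.comp (tangentMap (E × ℝ × ℝ) E Prolongation.proj e)}

/-- The prolongation of the hyperbolic system: the differential system on the prolongation space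
generated by the canonical Pfaffian system. -/
def prolongedIdeal (H : HyperbolicSystem E M s) : Prolongation H → FormIdeal (E × ℝ × ℝ) :=
  pfaffianIdeal (contactSystem H)

end Prolongation

section Extension

variable {E : Type*} [NormedAddCommGroup E] [NormedSpace ℝ E]
  {M : Type*} [TopologicalSpace M] [ChartedSpace E M]
  {E' : Type*} [NormedAddCommGroup E'] [NormedSpace ℝ E']
  {M' : Type*} [TopologicalSpace M'] [ChartedSpace E' M']

/-- The prolonged map `f^{[1]}`, which sends the 2-plane `P ⊆ T_xM` to `f_*(P) ⊆ T_{f(x)}M'`. -/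
def IsIntegrableExtension.prolong {f : M → M'} {𝓔 : ExtDiffSystem E M} {𝓘 : ExtDiffSystem E' M'}
    (h : IsIntegrableExtension f 𝓔 𝓘) (e : IntegralElement 𝓔) : IntegralElement 𝓘 where
  base := f e.base
  plane := e.plane.map (tangentMap E E' f e.base).toLinearMap
  finrank_plane := by
    obtain ⟨-, -, J, -, hcompl, hgen⟩ := h
    have hinj : Function.Injective
        ((tangentMap E E' f e.base).toLinearMap.domRestrict e.plane) := by
      rw [injective_iff_map_eq_zero]
      rintro ⟨v, hv⟩ hv0
      refine Subtype.ext (Submodule.disjoint_def.1 (hcompl e.base).disjoint v (fun α hα => ?_) hv0)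
      refine e.vanish 1 (oneForm α) ?_ (fun _ => v) fun _ => hv
      rw [hgen]
      exact FormIdeal.subset_span (g := ⟨1, oneForm α⟩) (Or.inl ⟨α, hα, rfl⟩)
    rw [← LinearMap.range_domRestrict, LinearMap.finrank_range_of_inj hinj, e.finrank_plane]
  vanish := by
    obtain ⟨-, -, J, -, -, hgen⟩ := h
    intro p γ hγ v hv
    choose w hw hwv using hv
    have := e.vanish p (γ.compContinuousLinearMap (tangentMap E E' f e.base)) (by
      rw [hgen]
      exact FormIdeal.subset_span
        (g := ⟨p, γ.compContinuousLinearMap (tangentMap E E' f e.base)⟩) (Or.inr ⟨p, γ, hγ, rfl⟩)) w hw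
    have hv' : v = fun i => tangentMap E E' f e.base (w i) := funext fun i => (hwv i).symm
    rw [hv']
    exact this

theorem smoothCovectorOn_of {α : M → E →L[ℝ] ℝ} {U : Set M}
    (h : ∀ x₀, ContDiffOn ℝ ∞ (covectorInChart α x₀)
      ((extChartAt 𝓘(ℝ, E) x₀).target ∩ (extChartAt 𝓘(ℝ, E) x₀).symm ⁻¹' U)) :
    SmoothCovectorOn α U := fun x₀ =>
  (ContinuousAlternatingMap.ofSubsingletonLIE (𝕜 := ℝ) (E := E) (F := ℝ)
    (0 : Fin 1)).contDiff (n := ∞) |>.comp_contDiffOn (h x₀)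

theorem SmoothCovectorOn.mono {α : M → E →L[ℝ] ℝ} {U V : Set M} (h : SmoothCovectorOn α U)
    (hVU : V ⊆ U) : SmoothCovectorOn α V := fun x₀ =>
  (h x₀).mono fun _ hz => ⟨hz.1, hVU hz.2⟩

theorem mdifferentiableAt_chart_symm [IsManifold 𝓘(ℝ, E) ∞ M] (x₀ : M) {z : E}
    (hz : z ∈ (extChartAt 𝓘(ℝ, E) x₀).target) :
    MDifferentiableAt 𝓘(ℝ, E) 𝓘(ℝ, E) (extChartAt 𝓘(ℝ, E) x₀).symm z :=
  ((contMDiffOn_extChartAt_symm (I := 𝓘(ℝ, E)) (n := ∞) x₀).contMDiffAt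
    ((isOpen_extChartAt_target x₀).mem_nhds hz)).mdifferentiableAt (by simp)

/-- The pullback of a smooth covector field by a smooth map is smooth. -/
theorem SmoothCovectorOn.pullback [IsManifold 𝓘(ℝ, E) ∞ M] [IsManifold 𝓘(ℝ, E') ∞ M']
    [FiniteDimensional ℝ E] [FiniteDimensional ℝ E'] {f : M → M'} (hf : ContMDiff 𝓘(ℝ, E) 𝓘(ℝ, E') ∞ f)
    {α : M' → E' →L[ℝ] ℝ} {U : Set M'} (hU : IsOpen U) (h : SmoothCovectorOn α U) :
    SmoothCovectorOn (fun y => (α (f y)).comp (tangentMap E E' f y)) (f ⁻¹' U) := by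
  refine smoothCovectorOn_of fun x₀ z hz => ?_
  obtain ⟨hz, hzU⟩ := hz
  set φ := extChartAt 𝓘(ℝ, E) x₀ with hφ
  set m' := f (φ.symm z) with hm'
  set ψ := extChartAt 𝓘(ℝ, E') m' with hψ
  set g : E → E' := fun u => ψ (f (φ.symm u)) with hg
  have hO : IsOpen (φ.target ∩ φ.symm ⁻¹' (f ⁻¹' (U ∩ ψ.source))) :=
    isOpen_target_inter x₀ ((hU.inter (isOpen_extChartAt_source m')).preimage hf.continuous)
  have hmem : z ∈ φ.target ∩ φ.symm ⁻¹' (f ⁻¹' (U ∩ ψ.source)) :=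
    ⟨hz, hzU, mem_extChartAt_source _⟩
  have hgs : ContDiffOn ℝ ∞ g (φ.target ∩ φ.symm ⁻¹' (f ⁻¹' (U ∩ ψ.source))) := by
    rw [← contMDiffOn_iff_contDiffOn]
    refine (contMDiffOn_extChartAt (n := ∞) (x := m')).comp
      ((hf.contMDiffOn (s := Set.univ)).comp
        ((contMDiffOn_extChartAt_symm (n := ∞) x₀).mono Set.inter_subset_left) fun _ _ => trivial) ?_
    intro u hu
    have := hu.2.2
    rwa [hψ, extChartAt_source] at this
  have hgz : g z ∈ ψ.target ∩ ψ.symm ⁻¹' U :=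
    ⟨ψ.map_source hmem.2.2, by
      change ψ.symm (ψ (f (φ.symm z))) ∈ U
      rw [ψ.left_inv hmem.2.2]; exact hzU⟩
  have hgd : ContDiffAt ℝ ∞ g z := hgs.contDiffAt (hO.mem_nhds hmem)
  have hαs : ContDiffAt ℝ ∞ (covectorInChart α m') (g z) :=
    (h.contDiffOn m').contDiffAt ((isOpen_target_inter m' hU).mem_nhds hgz)
  have hall : ContDiffAt ℝ ∞ (fun u => (covectorInChart α m' (g u)).comp (fderiv ℝ g u)) z :=
    (hαs.comp z hgd).clm_comp (hgd.fderiv_right (m := ∞) (by simp))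
  refine (hall.congr_of_eventuallyEq ?_).contDiffWithinAt
  filter_upwards [hO.mem_nhds hmem] with u hu
  have hu' : f (φ.symm u) ∈ ψ.source := hu.2.2
  have e1 : ψ.symm (g u) = f (φ.symm u) := ψ.left_inv hu'
  have d1 : MDifferentiableAt 𝓘(ℝ, E) 𝓘(ℝ, E) φ.symm u := mdifferentiableAt_chart_symm x₀ hu.1
  have d2 : MDifferentiableAt 𝓘(ℝ, E) 𝓘(ℝ, E') f (φ.symm u) := hf.mdifferentiableAt (by simp)
  have d3 : MDifferentiableAt 𝓘(ℝ, E') 𝓘(ℝ, E') ψ.symm (g u) :=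
    mdifferentiableAt_chart_symm m' (ψ.map_source hu')
  have d4 : DifferentiableAt ℝ g u :=
    (hgs.contDiffAt (hO.mem_nhds hu)).differentiableAt (by simp)
  have c1 := mfderiv_comp u d2 d1
  have c2 := mfderiv_comp u d3 d4.mdifferentiableAt
  have c3 : mfderiv 𝓘(ℝ, E) 𝓘(ℝ, E') (f ∘ φ.symm) u =
      mfderiv 𝓘(ℝ, E) 𝓘(ℝ, E') (ψ.symm ∘ g) u := by
    refine Filter.EventuallyEq.mfderiv_eq ?_
    filter_upwards [hO.mem_nhds hu] with t ht
    exact (ψ.left_inv ht.2.2).symm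
  have key : (tangentMap E E' f (φ.symm u)).comp (tangentMap E E φ.symm u) =
      (tangentMap E' E' ψ.symm (g u)).comp (fderiv ℝ g u) := by
    rw [mfderiv_eq_fderiv] at c2
    exact c1.symm.trans (c3.trans c2)
  change ((α (f (φ.symm u))).comp (tangentMap E E' f (φ.symm u))).comp
    (tangentMap E E φ.symm u) =
      ((α (ψ.symm (g u))).comp (tangentMap E' E' ψ.symm (g u))).comp (fderiv ℝ g u)
  rw [ContinuousLinearMap.comp_assoc, ContinuousLinearMap.comp_assoc, key, e1]

variable [FiniteDimensional ℝ E] [FiniteDimensional ℝ E']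
  [IsManifold 𝓘(ℝ, E) ∞ M] [IsManifold 𝓘(ℝ, E') ∞ M'] {s : ℕ}

/-- If `ann J` is a complement of a line `K`, then `J` has rank 1. -/
theorem finrank_eq_one {J : Submodule ℝ (E →L[ℝ] ℝ)} {K : Submodule ℝ E}
    (hK : Module.finrank ℝ K = 1) (h : IsCompl (annihilator J) K) : Module.finrank ℝ J = 1 := by
  obtain ⟨⟨k, hk⟩, hk0, hspan⟩ := finrank_eq_one_iff'.1 hK
  apply le_antisymm
  · let ρ : J →ₗ[ℝ] ℝ :=
      { toFun := fun α => α.1 k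
        map_add' := fun _ _ => rfl
        map_smul' := fun _ _ => rfl }
    have hρ : Function.Injective ρ := by
      rw [injective_iff_map_eq_zero]
      rintro ⟨α, hα⟩ h0
      replace h0 : α k = 0 := h0
      apply Subtype.ext
      ext v
      obtain ⟨a, ha, b, hb, rfl⟩ := Submodule.mem_sup.1 (h.sup_eq_top ▸ Submodule.mem_top (x := v))
      obtain ⟨c, hc⟩ := hspan ⟨b, hb⟩
      have hc' : c • k = b := congrArg Subtype.val hc
      change α (a + b) = 0
      rw [map_add, show α a = 0 from ha α hα, ← hc', map_smul, h0]
      simp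
    simpa using LinearMap.finrank_le_finrank_of_injective hρ
  · by_contra! hlt
    have hJ : J = ⊥ := Submodule.finrank_eq_zero.1 (by omega)
    have hk' : k ∈ annihilator J := by
      intro α hα
      rw [hJ, Submodule.mem_bot] at hα
      rw [hα]; rfl
    have := Submodule.disjoint_def.1 h.disjoint k hk' hk
    exact hk0 (Subtype.ext this)

/-- An integrable extension with 1-dimensional fibres of a class `s` hyperbolic system is a class
`s + 1` hyperbolic system. -/
theorem exists_coframe_of_extension {f : M → M'} {𝓔 : ExtDiffSystem E M}
    {𝓘 : HyperbolicSystem E' M' s} (h : IsIntegrableExtension f 𝓔 𝓘.toExtDiffSystem)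
    (hdim : Module.finrank ℝ E = Module.finrank ℝ E' + 1) (x : M) :
    ∃ U : Set M, IsOpen U ∧ x ∈ U ∧
      ∃ c : Coframe (E := E) (s + 1) U, c.IsAdapted 𝓔.ideal := by
  obtain ⟨hf, hsurj, J, hJ, hcompl, hgen⟩ := h
  obtain ⟨U, hU, hxU, c, hc⟩ := 𝓘.exists_coframe (f x)
  obtain ⟨V, hV, hxV, r, ξ, hξ, hξJ⟩ := hJ x
  have hker : ∀ y, Module.finrank ℝ (LinearMap.ker (tangentMap E E' f y).toLinearMap) = 1 := by
    intro y
    have h1 := LinearMap.finrank_range_add_finrank_ker (tangentMap E E' f y).toLinearMap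
    rw [LinearMap.range_eq_top.2 (hsurj y), finrank_top] at h1
    omega
  have hr : r = 1 := by
    obtain ⟨h1, h2⟩ := hξJ x hxV
    have h3 := finrank_span_eq_card h1
    rw [h2, finrank_eq_one (hker x) (hcompl x), Fintype.card_fin] at h3
    exact h3.symm
  subst hr
  have hJspan : ∀ y ∈ V, J y = Submodule.span ℝ {ξ 0 y} := by
    intro y hy
    rw [← (hξJ y hy).2]
    congr 1
    ext α
    simp [Fin.exists_fin_one, eq_comm]
  have hpull : ∀ {α : M' → E' →L[ℝ] ℝ}, SmoothCovectorOn α U →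
      SmoothCovectorOn (fun y => (α (f y)).comp (tangentMap E E' f y)) (V ∩ f ⁻¹' U) :=
    fun hα => (hα.pullback hf hU).mono Set.inter_subset_right
  let c' : Coframe (E := E) (s + 1) (V ∩ f ⁻¹' U) :=
    { θ := Fin.cons (ξ 0) fun k y => (c.θ k (f y)).comp (tangentMap E E' f y)
      σ := fun k y => (c.σ k (f y)).comp (tangentMap E E' f y)
      τ := fun k y => (c.τ k (f y)).comp (tangentMap E E' f y)
      smooth_θ := by
        refine Fin.cases ?_ fun k => ?_
        · exact (hξ 0).mono Set.inter_subset_left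
        · exact hpull (c.smooth_θ k)
      smooth_σ := fun k => hpull (c.smooth_σ k)
      smooth_τ := fun k => hpull (c.smooth_τ k)
      bijective := by
        rintro y ⟨hyV, hyU⟩
        have hb := c.bijective (f y) hyU
        have hdim' : Module.finrank ℝ E' = s + (2 + 2) := by
          have := (LinearEquiv.ofBijective (frameMap (fun k => c.θ k (f y)) (fun k => c.σ k (f y))
            (fun k => c.τ k (f y))).toLinearMap hb).finrank_eq
          simpa using this
        have hinj : Function.Injective (frameMap
            (fun k => (Fin.cons (ξ 0) fun k y => (c.θ k (f y)).comp (tangentMap E E' f y) :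
              Fin (s + 1) → M → E →L[ℝ] ℝ) k y)
            (fun k => (c.σ k (f y)).comp (tangentMap E E' f y))
            (fun k => (c.τ k (f y)).comp (tangentMap E E' f y))) := by
          rw [injective_iff_map_eq_zero]
          intro v hv
          have h1 := congrArg Prod.fst hv
          have h2 := congrArg (fun w => w.2.1) hv
          have h3 := congrArg (fun w => w.2.2) hv
          simp only [frameMap_apply, funext_iff] at h1 h2 h3
          have hk : tangentMap E E' f y v = 0 := by
            apply hb.1
            rw [map_zero]
            exact Prod.ext (funext fun k => h1 k.succ) (Prod.ext (funext h2) (funext h3))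
          refine Submodule.disjoint_def.1 (hcompl y).disjoint v ?_ hk
          intro α hα
          rw [hJspan y hyV, Submodule.mem_span_singleton] at hα
          obtain ⟨a, rfl⟩ := hα
          have h0 : ξ 0 y v = 0 := h1 0
          simp [h0]
        refine ⟨hinj, ?_⟩
        refine (LinearMap.injective_iff_surjective_of_finrank_eq_finrank
          (f := ContinuousLinearMap.toLinearMap _) ?_).1 hinj
        simp [hdim, hdim'] }
  refine ⟨V ∩ f ⁻¹' U, hV.inter (hU.preimage hf.continuous), ⟨hxV, hxU⟩, c', ?_⟩
  rintro y ⟨hyV, hyU⟩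
  rw [hgen y]
  apply FormIdeal.span_eq_of
  · rintro g (⟨α, hα, rfl⟩ | ⟨p, γ, hγ, rfl⟩)
    · rw [hJspan y hyV, Submodule.mem_span_singleton] at hα
      obtain ⟨a, rfl⟩ := hα
      exact Submodule.smul_mem _ a (FormIdeal.subset_span (G := c'.generators y)
        (g := ⟨1, oneForm (ξ 0 y)⟩) (Or.inl ⟨0, rfl⟩))
    · rw [hc (f y) hyU] at hγ
      refine FormIdeal.mem_span.1 hγ
        (FormIdeal.comap (tangentMap E E' f y) (FormIdeal.span (c'.generators y))) ?_
      rintro g (⟨k, rfl⟩ | rfl | rfl)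
      · exact FormIdeal.subset_span (G := c'.generators y) (Or.inl ⟨k.succ, rfl⟩)
      · change ContinuousAlternatingMap.compContinuousLinearMap
          (wedge₂ (c.σ 0 (f y)) (c.σ 1 (f y))) (tangentMap E E' f y) ∈
            (FormIdeal.span (c'.generators y)).carrier 2
        rw [wedge₂_comp]
        exact FormIdeal.subset_span (G := c'.generators y) (Or.inr (Or.inl rfl))
      · change ContinuousAlternatingMap.compContinuousLinearMap
          (wedge₂ (c.τ 0 (f y)) (c.τ 1 (f y))) (tangentMap E E' f y) ∈
            (FormIdeal.span (c'.generators y)).carrier 2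
        rw [wedge₂_comp]
        exact FormIdeal.subset_span (G := c'.generators y) (Or.inr (Or.inr rfl))
  · have hI : ∀ g ∈ c.generators (f y), g.2 ∈ (𝓘.ideal (f y)).carrier g.1 := fun g hg => by
      rw [hc (f y) hyU]; exact FormIdeal.subset_span hg
    rintro g (⟨k, rfl⟩ | rfl | rfl)
    · revert k
      refine Fin.cases ?_ fun k => ?_
      · exact FormIdeal.subset_span (Or.inl ⟨ξ 0 y, by
          rw [hJspan y hyV]; exact Submodule.mem_span_singleton_self _, rfl⟩)
      · exact FormIdeal.subset_span (Or.inr ⟨1, oneForm (c.θ k (f y)), hI _ (Or.inl ⟨k, rfl⟩), rfl⟩)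
    · exact FormIdeal.subset_span (Or.inr ⟨2, _, hI _ (Or.inr (Or.inl rfl)), by
        rw [wedge₂_comp]⟩)
    · exact FormIdeal.subset_span (Or.inr ⟨2, _, hI _ (Or.inr (Or.inr rfl)), by
        rw [wedge₂_comp]⟩)

/-- An integrable extension with 1-dimensional fibres of a class `s` hyperbolic system, as a class
`s + 1` hyperbolic system. -/
def IsIntegrableExtension.hyperbolic {f : M → M'} {𝓔 : ExtDiffSystem E M}
    {𝓘 : HyperbolicSystem E' M' s} (h : IsIntegrableExtension f 𝓔 𝓘.toExtDiffSystem)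
    (hdim : Module.finrank ℝ E = Module.finrank ℝ E' + 1) : HyperbolicSystem E M (s + 1) where
  toExtDiffSystem := 𝓔
  exists_coframe := exists_coframe_of_extension h hdim

/-- The prolonged map as a map `f^{[1]} : M^{[1]} → M'^{[1]}` of prolongation spaces. -/
def IsIntegrableExtension.prolongation {f : M → M'} {𝓔 : ExtDiffSystem E M}
    {𝓘 : HyperbolicSystem E' M' s} (h : IsIntegrableExtension f 𝓔 𝓘.toExtDiffSystem)
    (hdim : Module.finrank ℝ E = Module.finrank ℝ E' + 1) :
    Prolongation (h.hyperbolic hdim) → Prolongation 𝓘 :=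
  fun e => h.prolong e

/-- The set `Ñ` of the points of the prolongation space at which, for each of the two singular
Pfaffian systems `W₁`, `W₂` of the prolonged system, the part of the bundle of first integrals that
is semi-basic for `F` has rank 2. The unordered pair `{W₁, W₂}` is unique, so that it suffices to
take it near the point. -/
def semibasicRankTwo (H : HyperbolicSystem E M s) (F : Prolongation H → M') :
    Set (Prolongation H) :=
  {e | ∃ (U : Set (Prolongation H)) (W₁ W₂ : Prolongation H → Submodule ℝ (E × ℝ × ℝ →L[ℝ] ℝ)),
    IsOpen U ∧ e ∈ U ∧ IsSingularPair (s + 2) (prolongedIdeal H) U W₁ W₂ ∧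
      Module.finrank ℝ ↥(firstIntegrals W₁ e ⊓ semibasic (E' := E') F e) = 2 ∧
      Module.finrank ℝ ↥(firstIntegrals W₂ e ⊓ semibasic (E' := E') F e) = 2}

/-- The model space of 5-dimensional manifolds. -/
abbrev E5 : Type := EuclideanSpace ℝ (Fin 5)

/-- The model space of 6-dimensional manifolds. -/
abbrev E6 : Type := EuclideanSpace ℝ (Fin 6)

theorem finrank_E6 : Module.finrank ℝ E6 = Module.finrank ℝ E5 + 1 := by simp

end Extension

end EDS

end

set_option linter.unusedSectionVars false

noncomputable section

namespace EDS

/-! ### Exterior derivatives of covector fields and their behaviour under pullback. -/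

section Calculus

variable {E : Type*} [NormedAddCommGroup E] [NormedSpace ℝ E] [FiniteDimensional ℝ E]
  {E' : Type*} [NormedAddCommGroup E'] [NormedSpace ℝ E'] [FiniteDimensional ℝ E']
  {M : Type*} [TopologicalSpace M] [ChartedSpace E M] [IsManifold 𝓘(ℝ, E) ∞ M]
  {M' : Type*} [TopologicalSpace M'] [ChartedSpace E' M'] [IsManifold 𝓘(ℝ, E') ∞ M']

/-! The wave system supplies first integrals and the second system bounds their number. Near each
point of N the wave coordinates p, x, q, y, pulled back along `p₁`, complete to a coframe adapted to
B with σ = (dp, dx) and τ = (dq, dy) (`IsWaveSystem.exists_coframe`, `Coframe.exists_lift`). Hence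
each singular system of B has two independent first integrals.

There is no third one (`not_linearIndependent_of_isLift`, `Coframe.IsExact.isComplete`). Suppose
that three existed. If one of them varies along the fibre of `p₂`, the restriction of the other two
to its level set, which is locally a section of `p₂`, gives first integrals of a singular system of
I₂. There is only one of these up to dependence, so the three span at most two dimensions. If all
three differentials are semi-basic at the point, they span the pullback of the whole rank 3 singular
system there, and therefore the contact form θ. Combining the three identities d(dh) = 0 makes dθ
vanish on a characteristic plane, which contradicts the contact condition.

On the prolongation of B a 2-plane is described by its slopes, σ_{1-i} = a σ_i and τ_{1-j} = b τ_j.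
Since σ is exact, say σ_k = dg_k, the first singular system of the prolongation contains dg_i, da
and dg_{1-i}. These span all its first integrals (`firstIntegrals_prol`). Indeed a first integral F
is locally constant in b. For a fixed value of a it is then a function on N annihilated by e_j + b
e_{1-j} for two values of b, where the vectors e are dual to τ. So it is a first integral of the
singular system of B, and these depend on σ alone. The other singular system is treated by
interchanging σ and τ.

The fibres of the prolonged map of `p₂` are curves. The semi-basic part of a 3-dimensional space of
covectors is the kernel of evaluation on one fibre vector. It has dimension 2 exactly when some
invariant varies along the fibre (`finrank_inf_semibasic`), and that is an open condition. If it
failed on a nonempty open set, the three invariants would descend there to three independent first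
integrals of a singular system of the prolongation of I₂, which has only two
(`exists_mem_transverseSet`). So the condition for each singular system is open and dense, and the
required set is locally the intersection of the two. -/

/-- The exterior derivative of a covector field, evaluated on two vectors. -/
def extDeriv₁ (α : M → E →L[ℝ] ℝ) (x : M) (v w : E) : ℝ :=
  extDerivAt (fun y => oneForm (α y)) x ![v, w]

theorem extDeriv_oneForm_apply {A : E → E →L[ℝ] ℝ} {z : E} (hA : DifferentiableAt ℝ A z) (v w : E) :
    extDeriv (fun u => oneForm (A u)) z ![v, w] = fderiv ℝ A z v w - fderiv ℝ A z w v := by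
  let L := ContinuousAlternatingMap.ofSubsingletonLIE (𝕜 := ℝ) (E := E) (F := ℝ) (0 : Fin 1)
  have h1 : HasFDerivAt (fun u => oneForm (A u))
      ((L.toContinuousLinearEquiv : (E →L[ℝ] ℝ) →L[ℝ] Form E 1).comp (fderiv ℝ A z)) z :=
    (L.toContinuousLinearEquiv : (E →L[ℝ] ℝ) →L[ℝ] Form E 1).hasFDerivAt.comp z hA.hasFDerivAt
  have h2 : ∀ v w : E, fderiv ℝ (fun u => A u w) z v = fderiv ℝ A z v w := by
    intro v w
    rw [(hA.hasFDerivAt.clm_apply (hasFDerivAt_const w z)).fderiv]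
    simp
  rw [extDeriv_apply h1.differentiableAt]
  simp [Fin.sum_univ_two, h2, Fin.removeNth, sub_eq_add_neg]

theorem SmoothCovectorOn.contDiffAt {α : M → E →L[ℝ] ℝ} {U : Set M} (hU : IsOpen U)
    (h : SmoothCovectorOn α U) {x₀ : M} {z : E} (hz : z ∈ (extChartAt 𝓘(ℝ, E) x₀).target)
    (hzU : (extChartAt 𝓘(ℝ, E) x₀).symm z ∈ U) : ContDiffAt ℝ ∞ (covectorInChart α x₀) z :=
  (h.contDiffOn x₀).contDiffAt ((isOpen_target_inter x₀ hU).mem_nhds ⟨hz, hzU⟩)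

theorem SmoothCovectorOn.contDiffAt_self {α : M → E →L[ℝ] ℝ} {U : Set M} (hU : IsOpen U)
    (h : SmoothCovectorOn α U) {x : M} (hx : x ∈ U) :
    ContDiffAt ℝ ∞ (covectorInChart α x) (extChartAt 𝓘(ℝ, E) x x) :=
  h.contDiffAt hU (mem_extChartAt_target x) (by rwa [extChartAt_to_inv])

theorem extDeriv₁_eq {α : M → E →L[ℝ] ℝ} {U : Set M} (hU : IsOpen U)
    (h : SmoothCovectorOn α U) {x : M} (hx : x ∈ U) (v w : E) :
    extDeriv₁ α x v w =
      fderiv ℝ (covectorInChart α x) (extChartAt 𝓘(ℝ, E) x x)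
        (tangentMap E E (extChartAt 𝓘(ℝ, E) x) x v) (tangentMap E E (extChartAt 𝓘(ℝ, E) x) x w) -
      fderiv ℝ (covectorInChart α x) (extChartAt 𝓘(ℝ, E) x x)
        (tangentMap E E (extChartAt 𝓘(ℝ, E) x) x w)
        (tangentMap E E (extChartAt 𝓘(ℝ, E) x) x v) := by
  have := extDeriv_oneForm_apply ((h.contDiffAt_self hU hx).differentiableAt (by simp))
    (tangentMap E E (extChartAt 𝓘(ℝ, E) x) x v) (tangentMap E E (extChartAt 𝓘(ℝ, E) x) x w)
  rw [← this]
  simp only [extDeriv₁, extDerivAt, ContinuousAlternatingMap.compContinuousLinearMap_apply]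
  congr 1
  funext i
  fin_cases i <;> rfl

/-- The chart expression of a pullback. -/
theorem covectorInChart_pullback {f : M → M'} {S : Set M} (hS : IsOpen S)
    (hf : ContMDiffOn 𝓘(ℝ, E) 𝓘(ℝ, E') ∞ f S) (α : M' → E' →L[ℝ] ℝ) (x₀ : M) {z : E}
    (hz : z ∈ (extChartAt 𝓘(ℝ, E) x₀).target) (hzS : (extChartAt 𝓘(ℝ, E) x₀).symm z ∈ S)
    (m' : M') (hm' : f ((extChartAt 𝓘(ℝ, E) x₀).symm z) ∈ (extChartAt 𝓘(ℝ, E') m').source) :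
    ContDiffAt ℝ ∞ (fun u => extChartAt 𝓘(ℝ, E') m' (f ((extChartAt 𝓘(ℝ, E) x₀).symm u))) z ∧
    ∀ᶠ u in 𝓝 z, covectorInChart (fun y => (α (f y)).comp (tangentMap E E' f y)) x₀ u =
      (covectorInChart α m' (extChartAt 𝓘(ℝ, E') m' (f ((extChartAt 𝓘(ℝ, E) x₀).symm u)))).comp
        (fderiv ℝ (fun u => extChartAt 𝓘(ℝ, E') m' (f ((extChartAt 𝓘(ℝ, E) x₀).symm u))) u) := by
  set φ := extChartAt 𝓘(ℝ, E) x₀ with hφ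
  set ψ := extChartAt 𝓘(ℝ, E') m' with hψ
  set g : E → E' := fun u => ψ (f (φ.symm u)) with hg
  have hO' : IsOpen (S ∩ f ⁻¹' ψ.source) :=
    hf.continuousOn.isOpen_inter_preimage hS (isOpen_extChartAt_source m')
  have hO : IsOpen (φ.target ∩ φ.symm ⁻¹' (S ∩ f ⁻¹' ψ.source)) := isOpen_target_inter x₀ hO'
  have hmem : z ∈ φ.target ∩ φ.symm ⁻¹' (S ∩ f ⁻¹' ψ.source) := ⟨hz, hzS, hm'⟩
  have hgs : ContDiffOn ℝ ∞ g (φ.target ∩ φ.symm ⁻¹' (S ∩ f ⁻¹' ψ.source)) := by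
    rw [← contMDiffOn_iff_contDiffOn]
    refine (contMDiffOn_extChartAt (n := ∞) (x := m')).comp
      (hf.comp
        ((contMDiffOn_extChartAt_symm (n := ∞) x₀).mono Set.inter_subset_left)
          fun u hu => hu.2.1) ?_
    intro u hu
    have := hu.2.2
    rwa [Set.mem_preimage, hψ, extChartAt_source] at this
  refine ⟨hgs.contDiffAt (hO.mem_nhds hmem), ?_⟩
  filter_upwards [hO.mem_nhds hmem] with u hu
  have hu' : f (φ.symm u) ∈ ψ.source := hu.2.2
  have e1 : ψ.symm (g u) = f (φ.symm u) := ψ.left_inv hu'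
  have d1 : MDifferentiableAt 𝓘(ℝ, E) 𝓘(ℝ, E) φ.symm u := mdifferentiableAt_chart_symm x₀ hu.1
  have d2 : MDifferentiableAt 𝓘(ℝ, E) 𝓘(ℝ, E') f (φ.symm u) :=
    (hf.contMDiffAt (hS.mem_nhds hu.2.1)).mdifferentiableAt (by simp)
  have d3 : MDifferentiableAt 𝓘(ℝ, E') 𝓘(ℝ, E') ψ.symm (g u) :=
    mdifferentiableAt_chart_symm m' (ψ.map_source hu')
  have d4 : DifferentiableAt ℝ g u :=
    (hgs.contDiffAt (hO.mem_nhds hu)).differentiableAt (by simp)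
  have c1 := mfderiv_comp u d2 d1
  have c2 := mfderiv_comp u d3 d4.mdifferentiableAt
  have c3 : mfderiv 𝓘(ℝ, E) 𝓘(ℝ, E') (f ∘ φ.symm) u =
      mfderiv 𝓘(ℝ, E) 𝓘(ℝ, E') (ψ.symm ∘ g) u := by
    refine Filter.EventuallyEq.mfderiv_eq ?_
    filter_upwards [hO.mem_nhds hu] with t ht
    exact (ψ.left_inv ht.2.2).symm
  have key : (tangentMap E E' f (φ.symm u)).comp (tangentMap E E φ.symm u) =
      (tangentMap E' E' ψ.symm (g u)).comp (fderiv ℝ g u) := by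
    rw [mfderiv_eq_fderiv] at c2
    exact c1.symm.trans (c3.trans c2)
  change ((α (f (φ.symm u))).comp (tangentMap E E' f (φ.symm u))).comp
    (tangentMap E E φ.symm u) =
      ((α (ψ.symm (g u))).comp (tangentMap E' E' ψ.symm (g u))).comp (fderiv ℝ g u)
  rw [ContinuousLinearMap.comp_assoc, ContinuousLinearMap.comp_assoc, key, e1]

/-- The local form of the pullback lemma serves functions and maps that are smooth only on an open
set. -/
theorem SmoothCovectorOn.pullbackOn {f : M → M'} {S : Set M} (hS : IsOpen S)
    (hf : ContMDiffOn 𝓘(ℝ, E) 𝓘(ℝ, E') ∞ f S) {α : M' → E' →L[ℝ] ℝ} {U : Set M'} (hU : IsOpen U)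
    (h : SmoothCovectorOn α U) :
    SmoothCovectorOn (fun y => (α (f y)).comp (tangentMap E E' f y)) (S ∩ f ⁻¹' U) := by
  refine smoothCovectorOn_of fun x₀ z hz => ?_
  obtain ⟨hz, hzS, hzU⟩ := hz
  obtain ⟨hg, he⟩ := covectorInChart_pullback hS hf α x₀ hz hzS _ (mem_extChartAt_source _)
  refine ContDiffAt.contDiffWithinAt (ContDiffAt.congr_of_eventuallyEq ?_ he)
  refine ContDiffAt.clm_comp ?_ (hg.fderiv_right (m := ∞) (by simp))
  exact (h.contDiffAt hU (mem_extChartAt_target _) (by rwa [extChartAt_to_inv])).comp z hg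

/-- The exterior derivative commutes with pullback. -/
theorem extDeriv₁_pullback {f : M → M'} {S : Set M} (hS : IsOpen S)
    (hf : ContMDiffOn 𝓘(ℝ, E) 𝓘(ℝ, E') ∞ f S) {α : M' → E' →L[ℝ] ℝ} {U : Set M'} (hU : IsOpen U)
    (h : SmoothCovectorOn α U) {x : M} (hx : x ∈ S) (hxU : f x ∈ U) (v w : E) :
    extDeriv₁ (fun y => (α (f y)).comp (tangentMap E E' f y)) x v w =
      extDeriv₁ α (f x) (tangentMap E E' f x v) (tangentMap E E' f x w) := by
  set φ := extChartAt 𝓘(ℝ, E) x with hφ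
  set ψ := extChartAt 𝓘(ℝ, E') (f x) with hψ
  set g : E → E' := fun u => ψ (f (φ.symm u)) with hg
  have ex : φ.symm (φ x) = x := extChartAt_to_inv x
  obtain ⟨hgs, he⟩ := covectorInChart_pullback hS hf α x (mem_extChartAt_target x)
    (by rwa [extChartAt_to_inv]) (f x) (by rw [extChartAt_to_inv]; exact mem_extChartAt_source _)
  have egx : g (φ x) = ψ (f x) := by simp only [hg, ex]
  have hA := h.contDiffAt_self hU hxU
  have hω : DifferentiableAt ℝ (fun u => oneForm (covectorInChart α (f x) u)) (g (φ x)) := by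
    rw [egx]
    have := (ContinuousAlternatingMap.ofSubsingletonLIE (𝕜 := ℝ) (E := E') (F := ℝ)
      (0 : Fin 1)).contDiff (n := ∞) |>.contDiffAt.comp _ hA
    exact this.differentiableAt (by simp)
  have hpull := extDeriv_pullback (r := ∞) hω hgs (by simp [minSmoothness_of_isRCLikeNormedField]; exact WithTop.coe_le_coe.2 le_top)
  have hev : (fun u => inChart (fun y => oneForm ((α (f y)).comp (tangentMap E E' f y))) x u)
      =ᶠ[𝓝 (φ x)] fun u => (oneForm (covectorInChart α (f x) (g u))).compContinuousLinearMap
        (fderiv ℝ g u) := by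
    filter_upwards [he] with u hu
    exact congrArg oneForm hu
  -- Both sides are the derivative of `ψ ∘ f` at x. This turns the identity in charts into one
  -- between tangent vectors at x and at `f x`.
  have hd : (fderiv ℝ g (φ x)).comp (tangentMap E E φ x) =
      (tangentMap E' E' ψ (f x)).comp (tangentMap E E' f x) := by
    have d1 : MDifferentiableAt 𝓘(ℝ, E) 𝓘(ℝ, E) φ x := mdifferentiableAt_extChartAt (mem_chart_source _ x)
    have d2 : MDifferentiableAt 𝓘(ℝ, E) 𝓘(ℝ, E') f x :=
      (hf.contMDiffAt (hS.mem_nhds hx)).mdifferentiableAt (by simp)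
    have d3 : MDifferentiableAt 𝓘(ℝ, E') 𝓘(ℝ, E') ψ (f x) :=
      mdifferentiableAt_extChartAt (mem_chart_source _ _)
    have d4 : DifferentiableAt ℝ g (φ x) := hgs.differentiableAt (by simp)
    have c1 := mfderiv_comp x d3 d2
    have c2 := mfderiv_comp x d4.mdifferentiableAt d1
    rw [mfderiv_eq_fderiv] at c2
    refine c2.symm.trans (Eq.trans ?_ c1)
    refine Filter.EventuallyEq.mfderiv_eq ?_
    filter_upwards [extChartAt_source_mem_nhds (I := 𝓘(ℝ, E)) x] with t ht
    change ψ (f (φ.symm (φ t))) = ψ (f t)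
    rw [φ.left_inv ht]
  have hev' := Filter.EventuallyEq.extDeriv_eq hev
  have hdv : ∀ v, fderiv ℝ g (φ x) (tangentMap E E φ x v) =
      tangentMap E' E' ψ (f x) (tangentMap E E' f x v) := fun v => DFunLike.congr_fun hd v
  change extDeriv (inChart _ x) (φ x) _ = extDeriv (inChart _ (f x)) (ψ (f x)) _
  erw [hev', hpull]
  rw [ContinuousAlternatingMap.compContinuousLinearMap_apply, egx]
  congr 1
  funext i
  fin_cases i
  · exact hdv v
  · exact hdv w

end Calculus
end EDS

namespace EDS

/-! ### Differentials of functions, the Leibniz rule, smooth vector fields. -/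

section Calculus

variable {E : Type*} [NormedAddCommGroup E] [NormedSpace ℝ E] [FiniteDimensional ℝ E]
  {E' : Type*} [NormedAddCommGroup E'] [NormedSpace ℝ E'] [FiniteDimensional ℝ E']
  {M : Type*} [TopologicalSpace M] [ChartedSpace E M] [IsManifold 𝓘(ℝ, E) ∞ M]
  {M' : Type*} [TopologicalSpace M'] [ChartedSpace E' M'] [IsManifold 𝓘(ℝ, E') ∞ M']

theorem eventually_chart_symm {x₀ : M} {z : E} (hz : z ∈ (extChartAt 𝓘(ℝ, E) x₀).target)
    {p : M → Prop} (h : ∀ᶠ y in 𝓝 ((extChartAt 𝓘(ℝ, E) x₀).symm z), p y) :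
    ∀ᶠ u in 𝓝 z, p ((extChartAt 𝓘(ℝ, E) x₀).symm u) :=
  (((continuousOn_extChartAt_symm (I := 𝓘(ℝ, E)) x₀).continuousAt
    ((isOpen_extChartAt_target x₀).mem_nhds hz)).tendsto).eventually h

theorem extDerivAt_congr {p : ℕ} {α β : M → Form E p} {x : M} (h : α =ᶠ[𝓝 x] β) :
    extDerivAt α x = extDerivAt β x := by
  have : inChart α x =ᶠ[𝓝 (extChartAt 𝓘(ℝ, E) x x)] inChart β x := by
    refine (eventually_chart_symm (mem_extChartAt_target x) (p := fun y => α y = β y)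
      (by rwa [extChartAt_to_inv])).mono fun u hu => ?_
    simp only [inChart, hu]
  simp only [extDerivAt, this.extDeriv_eq]

theorem extDeriv₁_congr {α β : M → E →L[ℝ] ℝ} {x : M} (h : α =ᶠ[𝓝 x] β) (v w : E) :
    extDeriv₁ α x v w = extDeriv₁ β x v w := by
  rw [extDeriv₁, extDeriv₁, extDerivAt_congr (h.mono fun y hy => congrArg oneForm hy)]

theorem contMDiffOn_of_inChart {f : M → ℝ} {U : Set M}
    (h : ∀ x₀, ContDiffOn ℝ ∞ (fun z => f ((extChartAt 𝓘(ℝ, E) x₀).symm z))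
      ((extChartAt 𝓘(ℝ, E) x₀).target ∩ (extChartAt 𝓘(ℝ, E) x₀).symm ⁻¹' U)) :
    ContMDiffOn 𝓘(ℝ, E) 𝓘(ℝ, ℝ) ∞ f U := by
  intro x hx
  have h1 : ContMDiffOn 𝓘(ℝ, E) 𝓘(ℝ, ℝ) ∞ f (U ∩ (extChartAt 𝓘(ℝ, E) x).source) := by
    have h0 : ContMDiffOn 𝓘(ℝ, E) 𝓘(ℝ, E) ∞ (extChartAt 𝓘(ℝ, E) x)
        (U ∩ (extChartAt 𝓘(ℝ, E) x).source) :=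
      (contMDiffOn_extChartAt (I := 𝓘(ℝ, E)) (n := ∞) (x := x)).mono (by
        rw [extChartAt_source]; exact Set.inter_subset_right)
    have := (contMDiffOn_iff_contDiffOn.2 (h x)).comp h0 ?_
    · refine this.congr fun y hy => ?_
      simp only [Function.comp, (extChartAt 𝓘(ℝ, E) x).left_inv hy.2]
    · rintro y ⟨hy, hy'⟩
      refine ⟨(extChartAt 𝓘(ℝ, E) x).map_source hy', ?_⟩
      change (extChartAt 𝓘(ℝ, E) x).symm _ ∈ U
      rwa [(extChartAt 𝓘(ℝ, E) x).left_inv hy']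
  exact (h1 x ⟨hx, mem_extChartAt_source x⟩).mono_of_mem_nhdsWithin
    (Filter.inter_mem self_mem_nhdsWithin
      (mem_nhdsWithin_of_mem_nhds (extChartAt_source_mem_nhds x)))

theorem contDiffOn_inChart {f : M → ℝ} {U : Set M} (h : ContMDiffOn 𝓘(ℝ, E) 𝓘(ℝ, ℝ) ∞ f U)
    (x₀ : M) : ContDiffOn ℝ ∞ (fun z => f ((extChartAt 𝓘(ℝ, E) x₀).symm z))
      ((extChartAt 𝓘(ℝ, E) x₀).target ∩ (extChartAt 𝓘(ℝ, E) x₀).symm ⁻¹' U) := by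
  rw [← contMDiffOn_iff_contDiffOn]
  exact h.comp ((contMDiffOn_extChartAt_symm (n := ∞) x₀).mono Set.inter_subset_left)
    fun z hz => hz.2

theorem SmoothCovectorOn.add {α β : M → E →L[ℝ] ℝ} {U : Set M} (hα : SmoothCovectorOn α U)
    (hβ : SmoothCovectorOn β U) : SmoothCovectorOn (fun y => α y + β y) U :=
  smoothCovectorOn_of fun x₀ => ((hα.contDiffOn x₀).add (hβ.contDiffOn x₀)).congr fun z _ => by
    simp [covectorInChart, ContinuousLinearMap.add_comp]

theorem SmoothCovectorOn.smul {f : M → ℝ} {α : M → E →L[ℝ] ℝ} {U : Set M}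
    (hf : ContMDiffOn 𝓘(ℝ, E) 𝓘(ℝ, ℝ) ∞ f U) (hα : SmoothCovectorOn α U) :
    SmoothCovectorOn (fun y => f y • α y) U :=
  smoothCovectorOn_of fun x₀ => ((contDiffOn_inChart hf x₀).smul (hα.contDiffOn x₀)).congr
    fun z _ => by simp [covectorInChart, ContinuousLinearMap.smul_comp]

theorem SmoothCovectorOn.sub {α β : M → E →L[ℝ] ℝ} {U : Set M} (hα : SmoothCovectorOn α U)
    (hβ : SmoothCovectorOn β U) : SmoothCovectorOn (fun y => α y - β y) U :=
  smoothCovectorOn_of fun x₀ => ((hα.contDiffOn x₀).sub (hβ.contDiffOn x₀)).congr fun z _ => by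
    simp [covectorInChart, ContinuousLinearMap.sub_comp]

theorem tangentMap_id (x : M) : tangentMap E E (id : M → M) x = ContinuousLinearMap.id ℝ E :=
  mfderiv_id

theorem covectorInChart_model (α : E → E →L[ℝ] ℝ) (x₀ : E) : covectorInChart α x₀ = α := by
  funext z
  have h : ((extChartAt 𝓘(ℝ, E) x₀).symm : E → E) = id := by
    rw [extChartAt_model_space_eq_id]; rfl
  rw [covectorInChart, h, tangentMap_id]
  exact ContinuousLinearMap.comp_id _

theorem smoothCovectorOn_model {α : E → E →L[ℝ] ℝ} {U : Set E} (h : ContDiffOn ℝ ∞ α U) :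
    SmoothCovectorOn α U :=
  smoothCovectorOn_of fun x₀ => by
    rw [covectorInChart_model]
    refine h.mono fun z hz => ?_
    have := hz.2
    rwa [extChartAt_model_space_eq_id] at this

theorem extDeriv₁_model {α : E → E →L[ℝ] ℝ} {U : Set E} (hU : IsOpen U) (h : ContDiffOn ℝ ∞ α U)
    {z : E} (hz : z ∈ U) (v w : E) :
    extDeriv₁ α z v w = fderiv ℝ α z v w - fderiv ℝ α z w v := by
  rw [extDeriv₁_eq hU (smoothCovectorOn_model h) hz, covectorInChart_model]
  have h1 : (extChartAt 𝓘(ℝ, E) z : E → E) = id := by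
    rw [extChartAt_model_space_eq_id]; rfl
  rw [h1, tangentMap_id]
  rfl

/-- As a pullback of the constant covector dt on ℝ, the covector field df inherits its smoothness
and d(df) = 0 from the pullback lemmas. -/
theorem differential_eq_pullback (f : M → ℝ) :
    differential E f = fun y => (ContinuousLinearMap.id ℝ ℝ).comp (tangentMap E ℝ f y) := by
  funext y
  exact (ContinuousLinearMap.id_comp _).symm

theorem smoothCovectorOn_differential {f : M → ℝ} {U : Set M} (hU : IsOpen U)
    (hf : ContMDiffOn 𝓘(ℝ, E) 𝓘(ℝ, ℝ) ∞ f U) : SmoothCovectorOn (differential E f) U := by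
  rw [differential_eq_pullback]
  have h : SmoothCovectorOn (fun _ : ℝ => ContinuousLinearMap.id ℝ ℝ) Set.univ :=
    smoothCovectorOn_model contDiffOn_const
  exact (h.pullbackOn hU hf isOpen_univ).mono fun y hy => ⟨hy, trivial⟩

theorem extDeriv₁_differential {f : M → ℝ} {U : Set M} (hU : IsOpen U)
    (hf : ContMDiffOn 𝓘(ℝ, E) 𝓘(ℝ, ℝ) ∞ f U) {x : M} (hx : x ∈ U) (v w : E) :
    extDeriv₁ (differential E f) x v w = 0 := by
  rw [differential_eq_pullback]
  have h : ContDiffOn ℝ ∞ (fun _ : ℝ => ContinuousLinearMap.id ℝ ℝ) Set.univ := contDiffOn_const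
  rw [extDeriv₁_pullback hU hf isOpen_univ (smoothCovectorOn_model h) hx trivial,
    extDeriv₁_model isOpen_univ h trivial]
  simp

theorem differential_comp {f : M → M'} {g : M' → ℝ} {x : M}
    (hf : MDifferentiableAt 𝓘(ℝ, E) 𝓘(ℝ, E') f x)
    (hg : MDifferentiableAt 𝓘(ℝ, E') 𝓘(ℝ, ℝ) g (f x)) :
    differential E (g ∘ f) x = (differential E' g (f x)).comp (tangentMap E E' f x) :=
  mfderiv_comp x hg hf

theorem differential_congr {f g : M → ℝ} {x : M} (h : f =ᶠ[𝓝 x] g) :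
    differential E f x = differential E g x :=
  Filter.EventuallyEq.mfderiv_eq h

/-- Leibniz rule for combinations of covector fields. -/
theorem extDeriv₁_sum {ι : Type*} [Fintype ι] {θ : M → E →L[ℝ] ℝ} {η : ι → M → E →L[ℝ] ℝ}
    {h : ι → M → ℝ} {U : Set M} (hU : IsOpen U) (hη : ∀ i, SmoothCovectorOn (η i) U)
    (hh : ∀ i, ContMDiffOn 𝓘(ℝ, E) 𝓘(ℝ, ℝ) ∞ (h i) U)
    (hθ : ∀ y ∈ U, θ y = ∑ i, h i y • η i y) {x : M} (hx : x ∈ U) (v w : E) :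
    extDeriv₁ θ x v w = ∑ i, (h i x * extDeriv₁ (η i) x v w +
      (differential E (h i) x v * η i x w - differential E (h i) x w * η i x v)) := by
  set φ := extChartAt 𝓘(ℝ, E) x with hφ
  have ex : φ.symm (φ x) = x := extChartAt_to_inv x
  have hsm : SmoothCovectorOn θ U := by
    refine smoothCovectorOn_of fun x₀ => ?_
    refine (ContDiffOn.sum (s := Finset.univ) fun i _ =>
      (contDiffOn_inChart (hh i) x₀).smul ((hη i).contDiffOn x₀)).congr fun z hz => ?_
    rw [covectorInChart, hθ _ hz.2]
    ext u
    simp [covectorInChart]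
  have hev : covectorInChart θ x =ᶠ[𝓝 (φ x)]
      fun u => ∑ i, h i (φ.symm u) • covectorInChart (η i) x u := by
    refine (eventually_chart_symm (mem_extChartAt_target x) (p := fun y => y ∈ U)
      (by rw [extChartAt_to_inv]; exact hU.mem_nhds hx)).mono fun u hu => ?_
    rw [covectorInChart, hθ _ hu]
    ext t
    simp [covectorInChart, hφ]
  have hz : φ x ∈ φ.target ∩ φ.symm ⁻¹' U := ⟨mem_extChartAt_target x, by
    change φ.symm (φ x) ∈ U; rwa [ex]⟩
  have hd : ∀ i, HasFDerivAt (fun u => h i (φ.symm u) • covectorInChart (η i) x u) _ (φ x) :=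
    fun i => (((contDiffOn_inChart (hh i) x).contDiffAt
      ((isOpen_target_inter x hU).mem_nhds hz)).differentiableAt (by simp)).hasFDerivAt.smul
      (((hη i).contDiffAt_self hU hx).differentiableAt (by simp)).hasFDerivAt
  have hs := HasFDerivAt.fun_sum (u := Finset.univ) fun i _ => hd i
  have hφv : ∀ t : E, tangentMap E E φ.symm (φ x) (tangentMap E E φ x t) = t := by
    intro t
    have d1 : MDifferentiableAt 𝓘(ℝ, E) 𝓘(ℝ, E) φ x :=
      mdifferentiableAt_extChartAt (mem_chart_source _ x)
    have d2 : MDifferentiableAt 𝓘(ℝ, E) 𝓘(ℝ, E) φ.symm (φ x) :=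
      mdifferentiableAt_chart_symm x (mem_extChartAt_target x)
    have c1 := mfderiv_comp x d2 d1
    have c2 : mfderiv 𝓘(ℝ, E) 𝓘(ℝ, E) (φ.symm ∘ φ) x = mfderiv 𝓘(ℝ, E) 𝓘(ℝ, E) id x := by
      refine Filter.EventuallyEq.mfderiv_eq ?_
      filter_upwards [extChartAt_source_mem_nhds (I := 𝓘(ℝ, E)) x] with t ht
      exact φ.left_inv ht
    rw [mfderiv_id] at c2
    exact DFunLike.congr_fun (c1.symm.trans c2) t
  have hηφ : ∀ i t, covectorInChart (η i) x (φ x) (tangentMap E E φ x t) = η i x t := by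
    intro i t
    change η i (φ.symm (φ x)) (tangentMap E E φ.symm (φ x) (tangentMap E E φ x t)) = _
    rw [hφv, ex]
  have hdh : ∀ i t, fderiv ℝ (fun u => h i (φ.symm u)) (φ x) (tangentMap E E φ x t) =
      differential E (h i) x t := by
    intro i t
    have d2 : MDifferentiableAt 𝓘(ℝ, E) 𝓘(ℝ, E) φ.symm (φ x) :=
      mdifferentiableAt_chart_symm x (mem_extChartAt_target x)
    have d3 : MDifferentiableAt 𝓘(ℝ, E) 𝓘(ℝ, ℝ) (h i) (φ.symm (φ x)) := by
      rw [ex]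
      exact ((hh i).contMDiffAt (hU.mem_nhds hx)).mdifferentiableAt (by simp)
    have c1 : mfderiv 𝓘(ℝ, E) 𝓘(ℝ, ℝ) (fun u => h i (φ.symm u)) (φ x) = _ :=
      mfderiv_comp (φ x) d3 d2
    rw [mfderiv_eq_fderiv] at c1
    refine (DFunLike.congr_fun c1 _).trans ?_
    change differential E (h i) (φ.symm (φ x)) (tangentMap E E φ.symm (φ x)
      (tangentMap E E φ x t)) = _
    rw [hφv, ex]
  rw [extDeriv₁_eq hU hsm hx, hev.fderiv_eq, hs.fderiv]
  simp only [extDeriv₁_eq hU (hη _) hx]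
  simp only [sum_apply, add_apply,
    smul_apply, ContinuousLinearMap.smulRight_apply, smul_eq_mul]
  rw [← Finset.sum_sub_distrib]
  refine Finset.sum_congr rfl fun i _ => ?_
  rw [← hφ, hηφ, hηφ, hdh, hdh, ex]
  ring

/-- On the common kernel of the η the terms dh ∧ η of the Leibniz rule drop out. What remains is
linear over functions, so exterior derivatives of sections need only be known on generators. -/
theorem extDeriv₁_sum_of_vanish {ι : Type*} [Fintype ι] {θ : M → E →L[ℝ] ℝ}
    {η : ι → M → E →L[ℝ] ℝ} {h : ι → M → ℝ} {U : Set M} (hU : IsOpen U)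
    (hη : ∀ i, SmoothCovectorOn (η i) U) (hh : ∀ i, ContMDiffOn 𝓘(ℝ, E) 𝓘(ℝ, ℝ) ∞ (h i) U)
    (hθ : ∀ y ∈ U, θ y = ∑ i, h i y • η i y) {x : M} (hx : x ∈ U) {v w : E}
    (hv : ∀ i, η i x v = 0) (hw : ∀ i, η i x w = 0) :
    extDeriv₁ θ x v w = ∑ i, h i x * extDeriv₁ (η i) x v w := by
  rw [extDeriv₁_sum hU hη hh hθ hx]
  simp [hv, hw]

/-- The Leibniz rule with coefficients 1 and −f, in the shape of the contact form σ_{1-i} − a σ_i.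
-/
theorem extDeriv₁_sub_smul {α β : M → E →L[ℝ] ℝ} {f : M → ℝ} {U : Set M} (hU : IsOpen U)
    (hα : SmoothCovectorOn α U) (hβ : SmoothCovectorOn β U)
    (hf : ContMDiffOn 𝓘(ℝ, E) 𝓘(ℝ, ℝ) ∞ f U) {x : M} (hx : x ∈ U) (v w : E) :
    extDeriv₁ (fun y => α y - f y • β y) x v w =
      extDeriv₁ α x v w - f x * extDeriv₁ β x v w -
        (differential E f x v * β x w - differential E f x w * β x v) := by
  have hd : MDifferentiableAt 𝓘(ℝ, E) 𝓘(ℝ, ℝ) f x :=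
    (hf.contMDiffAt (hU.mem_nhds hx)).mdifferentiableAt (by simp)
  have hneg : differential E (fun y => -f y) x = -differential E f x :=
    (hd.hasMFDerivAt.neg).mfderiv
  have hone : differential E (fun _ : M => (1 : ℝ)) x = 0 := mfderiv_const
  rw [extDeriv₁_sum (η := ![α, β]) (h := ![fun _ => 1, fun y => -f y]) hU
    (Fin.forall_fin_two.2 ⟨hα, hβ⟩) (Fin.forall_fin_two.2 ⟨contMDiffOn_const, hf.neg⟩)
    (fun y _ => by ext; simp [sub_eq_add_neg]) hx, Fin.sum_univ_two]
  simp [hneg, hone]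
  ring


/-- The expression in the preferred chart around `x₀` of a vector field. -/
def vectorInChart (X : M → E) (x₀ : M) (z : E) : E :=
  (tangentMap E E (extChartAt 𝓘(ℝ, E) x₀).symm z).inverse (X ((extChartAt 𝓘(ℝ, E) x₀).symm z))

/-- The vector field `X` is smooth on the open set `U`. -/
def SmoothVectorOn (X : M → E) (U : Set M) : Prop :=
  ∀ x₀ : M, ContDiffOn ℝ ∞ (vectorInChart X x₀)
    ((extChartAt 𝓘(ℝ, E) x₀).target ∩ (extChartAt 𝓘(ℝ, E) x₀).symm ⁻¹' U)

theorem tangentMap_vectorInChart (X : M → E) (x₀ : M) {z : E}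
    (hz : z ∈ (extChartAt 𝓘(ℝ, E) x₀).target) :
    tangentMap E E (extChartAt 𝓘(ℝ, E) x₀).symm z (vectorInChart X x₀ z) =
      X ((extChartAt 𝓘(ℝ, E) x₀).symm z) :=
  (isInvertible_tangentMap_symm x₀ hz).self_apply_inverse _

theorem SmoothCovectorOn.apply {α : M → E →L[ℝ] ℝ} {X : M → E} {U : Set M}
    (hα : SmoothCovectorOn α U) (hX : SmoothVectorOn X U) :
    ContMDiffOn 𝓘(ℝ, E) 𝓘(ℝ, ℝ) ∞ (fun y => α y (X y)) U := by
  refine contMDiffOn_of_inChart fun x₀ => ?_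
  refine ((hα.contDiffOn x₀).clm_apply (hX x₀)).congr fun z hz => ?_
  rw [covectorInChart, ContinuousLinearMap.comp_apply, tangentMap_vectorInChart X x₀ hz.1]

/-- The exterior derivative is computed in a chart that changes with the point, so its smoothness is
not visible from the definition. Pulling back by the inverse of one fixed chart expresses it near a
point as an antisymmetrised derivative in that chart. -/
theorem contMDiffOn_extDeriv₁ {α : M → E →L[ℝ] ℝ} {X Y : M → E} {U : Set M} (hU : IsOpen U)
    (hα : SmoothCovectorOn α U) (hX : SmoothVectorOn X U) (hY : SmoothVectorOn Y U) :
    ContMDiffOn 𝓘(ℝ, E) 𝓘(ℝ, ℝ) ∞ (fun y => extDeriv₁ α y (X y) (Y y)) U := by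
  refine contMDiffOn_of_inChart fun x₀ => ?_
  have hO := isOpen_target_inter (E := E) x₀ hU
  have h1 := hα.contDiffOn x₀
  have h2 : ContDiffOn ℝ ∞ (fderiv ℝ (covectorInChart α x₀)) _ :=
    h1.fderiv_of_isOpen hO (m := ∞) (by simp)
  refine (((h2.clm_apply (hX x₀)).clm_apply (hY x₀)).sub
    ((h2.clm_apply (hY x₀)).clm_apply (hX x₀))).congr fun z hz => ?_
  have h3 := extDeriv₁_pullback (isOpen_extChartAt_target x₀)
    (contMDiffOn_extChartAt_symm (I := 𝓘(ℝ, E)) (n := ∞) x₀) hU hα hz.1 hz.2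
    (vectorInChart X x₀ z) (vectorInChart Y x₀ z)
  rw [tangentMap_vectorInChart X x₀ hz.1, tangentMap_vectorInChart Y x₀ hz.1] at h3
  rw [← h3]
  exact extDeriv₁_model hO h1 hz _ _

/-! ### Dual frame fields of a coframe. -/

namespace Coframe

variable {s : ℕ} {U : Set M}

/-- The coframe at a point as a linear map. -/
abbrev frame (c : Coframe (E := E) s U) (y : M) :
    E →L[ℝ] (Fin s → ℝ) × (Fin 2 → ℝ) × (Fin 2 → ℝ) :=
  frameMap (fun k => c.θ k y) (fun k => c.σ k y) (fun k => c.τ k y)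

/-- The vector field with prescribed values of the coframe. -/
def vec (c : Coframe (E := E) s U) (r : (Fin s → ℝ) × (Fin 2 → ℝ) × (Fin 2 → ℝ)) (y : M) : E :=
  (c.frame y).inverse r

theorem isInvertible_frame (c : Coframe (E := E) s U) {y : M} (hy : y ∈ U) :
    (c.frame y).IsInvertible :=
  ⟨(LinearEquiv.ofBijective (c.frame y).toLinearMap (c.bijective y hy)).toContinuousLinearEquiv,
    rfl⟩

theorem frame_vec (c : Coframe (E := E) s U) (r) {y : M} (hy : y ∈ U) :
    c.frame y (c.vec r y) = r := (c.isInvertible_frame hy).self_apply_inverse _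

theorem θ_vec (c : Coframe (E := E) s U) (r) {y : M} (hy : y ∈ U) (k) :
    c.θ k y (c.vec r y) = r.1 k := congrFun (congrArg Prod.fst (c.frame_vec r hy)) k

theorem σ_vec (c : Coframe (E := E) s U) (r) {y : M} (hy : y ∈ U) (k) :
    c.σ k y (c.vec r y) = r.2.1 k := congrFun (congrArg (fun t => t.2.1) (c.frame_vec r hy)) k

theorem τ_vec (c : Coframe (E := E) s U) (r) {y : M} (hy : y ∈ U) (k) :
    c.τ k y (c.vec r y) = r.2.2 k := congrFun (congrArg (fun t => t.2.2) (c.frame_vec r hy)) k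

theorem eq_of_frame (c : Coframe (E := E) s U) {y : M} (hy : y ∈ U) {v w : E}
    (h1 : ∀ k, c.θ k y v = c.θ k y w) (h2 : ∀ k, c.σ k y v = c.σ k y w)
    (h3 : ∀ k, c.τ k y v = c.τ k y w) : v = w :=
  (c.bijective y hy).1 (Prod.ext (funext h1) (Prod.ext (funext h2) (funext h3)))

/-- In a chart the coframe is a smooth family of invertible linear maps, and inversion is smooth at
such maps. -/
theorem smooth_vec (c : Coframe (E := E) s U) (r) : SmoothVectorOn (c.vec r) U := by
  intro x₀
  have h : ContDiffOn ℝ ∞ (fun z => (c.inChart x₀ z).inverse r)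
      ((extChartAt 𝓘(ℝ, E) x₀).target ∩ (extChartAt 𝓘(ℝ, E) x₀).symm ⁻¹' U) := by
    refine ContDiffOn.clm_apply (fun z hz => ?_) contDiffOn_const
    exact (ContinuousLinearMap.IsInvertible.contDiffAt_map_inverse
      (c.isInvertible_inChart x₀ hz.1 hz.2)).comp_contDiffWithinAt z (c.contDiffOn_inChart x₀ z hz)
  refine h.congr fun z hz => ?_
  apply (c.isInvertible_inChart x₀ hz.1 hz.2).bijective.1
  rw [(c.isInvertible_inChart x₀ hz.1 hz.2).self_apply_inverse]
  change c.frame _ (tangentMap E E (extChartAt 𝓘(ℝ, E) x₀).symm z _) = r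
  rw [tangentMap_vectorInChart _ _ hz.1, c.frame_vec r hz.2]

end Coframe

end Calculus
end EDS

namespace EDS

/-! ### Pointwise algebra of hyperbolic ideals, uniqueness of the singular systems, the contact
condition. -/

section Algebra

variable {E : Type*} [NormedAddCommGroup E] [NormedSpace ℝ E] [FiniteDimensional ℝ E]
  {M : Type*} [TopologicalSpace M] [ChartedSpace E M] [IsManifold 𝓘(ℝ, E) ∞ M]

theorem Form.neg_swap (γ : Form E 2) (v w : E) : γ ![v, w] = -γ ![w, v] := by
  have h := γ.map_swap ![w, v] (show (0 : Fin 2) ≠ 1 by decide)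
  refine Eq.trans ?_ h
  change γ _ = γ _
  congr 1
  funext i
  fin_cases i <;> simp

/-- A 2-form as a bilinear map. -/
def Form.bilin (γ : Form E 2) : E →ₗ[ℝ] E →ₗ[ℝ] ℝ :=
  LinearMap.mk₂ ℝ (fun v w => γ ![v, w])
    (fun v v' w => γ.map_vecCons_add ![w] v v')
    (fun c v w => γ.map_vecCons_smul ![w] c v)
    (fun v w w' => by
      rw [Form.neg_swap, Form.neg_swap γ v w, Form.neg_swap γ v w']
      have := γ.map_vecCons_add ![v] w w'
      change γ ![w + w', v] = γ ![w, v] + γ ![w', v] at this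
      rw [this]; ring)
    (fun c v w => by
      rw [Form.neg_swap, Form.neg_swap γ v w]
      have := γ.map_vecCons_smul ![v] c w
      change γ ![c • w, v] = c • γ ![w, v] at this
      rw [this]; simp)

theorem Form.bilin_apply (γ : Form E 2) (v w : E) : γ.bilin v w = γ ![v, w] := rfl

theorem Form.bilin_swap (γ : Form E 2) (v w : E) : γ.bilin v w = -γ.bilin w v := γ.neg_swap v w

theorem Form.ext_bilin {γ γ' : Form E 2} (h : ∀ v w, γ.bilin v w = γ'.bilin v w) : γ = γ' := by
  ext v
  have : v = ![v 0, v 1] := by funext i; fin_cases i <;> rfl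
  rw [this]
  exact h _ _

theorem wedge₂_bilin (α β : E →L[ℝ] ℝ) (v w : E) :
    (wedge₂ α β).bilin v w = α v * β w - α w * β v := by
  rw [Form.bilin_apply, wedge₂_apply]; rfl

theorem Form.eq_zero_of_basis {n : ℕ} {ι : Type*} (B : Module.Basis ι ℝ E) (γ : Form E n)
    (h : ∀ v : Fin n → ι, Function.Injective v → γ (fun i => B (v i)) = 0) : γ = 0 := by
  apply ContinuousAlternatingMap.toAlternatingMap_injective
  exact Module.Basis.ext_alternating B h

/-- A 2-form that vanishes on the common kernel of covectors lies in the ideal generated by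
these. -/
theorem FormIdeal.mem_of_vanish {n : ℕ} {θ : Fin n → E →L[ℝ] ℝ} {e : Fin n → E}
    (he : ∀ k l, θ k (e l) = if k = l then 1 else 0) (𝔞 : FormIdeal E)
    (hθ : ∀ k, oneForm (θ k) ∈ 𝔞.carrier 1) {γ : Form E 2}
    (h : ∀ v w, (∀ k, θ k v = 0) → (∀ k, θ k w = 0) → γ ![v, w] = 0) : γ ∈ 𝔞.carrier 2 := by
  -- The contraction of γ with e_k, corrected by half of its θ-components: without the factor 1/2
  -- each term γ(e_k, e_l) θ_k ∧ θ_l would be counted twice in ∑ θ_k ∧ β_k.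
  let β : Fin n → E →L[ℝ] ℝ := fun k => LinearMap.toContinuousLinearMap (γ.bilin (e k)) -
    (1 / 2 : ℝ) • ∑ l, γ.bilin (e k) (e l) • θ l
  have hβ : ∀ k w, β k w = γ.bilin (e k) w - (1 / 2) * ∑ l, γ.bilin (e k) (e l) * θ l w := by
    intro k w; simp [β]
  have key : γ = ∑ k, wedge₂ (θ k) (β k) := by
    apply Form.ext_bilin
    intro v w
    have hs : (∑ k, wedge₂ (θ k) (β k)).bilin v w = ∑ k, (θ k v * β k w - θ k w * β k v) := by
      rw [Form.bilin_apply, ContinuousAlternatingMap.sum_apply]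
      exact Finset.sum_congr rfl fun k _ => wedge₂_bilin _ _ v w
    -- Subtracting its θ-components moves any vector into the common kernel, where γ vanishes.
    -- Expanding that vanishing gives the claimed formula for γ.
    have hk : ∀ v, ∀ k, θ k (v - ∑ l, θ l v • e l) = 0 := by
      intro v k
      simp [he]
    have h0 := h _ _ (hk v) (hk w)
    rw [← Form.bilin_apply] at h0
    simp only [map_sub, map_sum, LinearMap.sub_apply, LinearMap.sum_apply, map_smul,
      LinearMap.smul_apply, smul_eq_mul, mul_sub, Finset.sum_sub_distrib] at h0
    have s1 : ∀ v w : E, ∑ k, θ k v * β k w = ∑ k, θ k v * γ.bilin (e k) w -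
        (1 / 2) * ∑ k, ∑ l, θ k v * (θ l w * γ.bilin (e k) (e l)) := by
      intro v w
      simp only [hβ, mul_sub, Finset.sum_sub_distrib, Finset.mul_sum]
      congr 1
      refine Finset.sum_congr rfl fun k _ => Finset.sum_congr rfl fun l _ => by ring
    have s2 : ∑ k, ∑ l, θ k w * (θ l v * γ.bilin (e k) (e l)) =
        -∑ k, ∑ l, θ k v * (θ l w * γ.bilin (e k) (e l)) := by
      rw [Finset.sum_comm, ← Finset.sum_neg_distrib]
      refine Finset.sum_congr rfl fun k _ => ?_
      rw [← Finset.sum_neg_distrib]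
      refine Finset.sum_congr rfl fun l _ => ?_
      rw [γ.bilin_swap (e l) (e k)]; ring
    have s3 : ∑ k, θ k w * γ.bilin v (e k) = -∑ k, θ k w * γ.bilin (e k) v := by
      rw [← Finset.sum_neg_distrib]
      refine Finset.sum_congr rfl fun k _ => ?_
      rw [γ.bilin_swap v (e k)]; ring
    have s4 : ∑ x, θ x w * ∑ i, θ i v * γ.bilin (e i) (e x) =
        ∑ k, ∑ l, θ k v * (θ l w * γ.bilin (e k) (e l)) := by
      simp only [Finset.mul_sum]
      rw [Finset.sum_comm]
      refine Finset.sum_congr rfl fun k _ => Finset.sum_congr rfl fun l _ => by ring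
    rw [hs, Finset.sum_sub_distrib, s1, s1, s2]
    rw [s3, s4] at h0
    linarith
  rw [key]
  exact Submodule.sum_mem _ fun k _ => 𝔞.wedge_right (oneForm (β k)) (hθ k)

namespace Coframe

variable {s : ℕ} {U U' : Set M}

/-- The dual frame vectors of `θ`. -/
def eθ (c : Coframe (E := E) s U) (k : Fin s) (y : M) : E := c.vec (Pi.single k 1, 0, 0) y

/-- The dual frame vectors of `σ`. -/
def eσ (c : Coframe (E := E) s U) (k : Fin 2) (y : M) : E := c.vec (0, Pi.single k 1, 0) y

/-- The dual frame vectors of `τ`. -/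
def eτ (c : Coframe (E := E) s U) (k : Fin 2) (y : M) : E := c.vec (0, 0, Pi.single k 1) y

/-- The coframe with the roles of `σ` and `τ` interchanged. -/
def swap (c : Coframe (E := E) s U) : Coframe (E := E) s U where
  θ := c.θ
  σ := c.τ
  τ := c.σ
  smooth_θ := c.smooth_θ
  smooth_σ := c.smooth_τ
  smooth_τ := c.smooth_σ
  bijective y hy :=
    (Function.Involutive.bijective (f := fun w : (Fin s → ℝ) × (Fin 2 → ℝ) × (Fin 2 → ℝ) =>
      ((w.1, w.2.2, w.2.1) : (Fin s → ℝ) × (Fin 2 → ℝ) × (Fin 2 → ℝ))) fun _ => rfl).comp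
        (c.bijective y hy)

theorem IsAdapted.swap {c : Coframe (E := E) s U} {I : M → FormIdeal E} (h : c.IsAdapted I) :
    c.swap.IsAdapted I := by
  intro y hy
  rw [h y hy, generators, generators, Set.pair_comm]
  rfl

theorem eq_sum (c : Coframe (E := E) s U) {y : M} (hy : y ∈ U) (v : E) :
    v = ∑ k, c.θ k y v • c.eθ k y + (∑ k, c.σ k y v • c.eσ k y + ∑ k, c.τ k y v • c.eτ k y) := by
  apply c.eq_of_frame hy <;> intro k <;>
    simp [eθ, eσ, eτ, c.θ_vec _ hy, c.σ_vec _ hy, c.τ_vec _ hy, Pi.single_apply,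
      -Fin.sum_univ_two]

/-- The vectors annihilated by `θ` and `σ`. -/
def ker (c : Coframe (E := E) s U) (y : M) : Submodule ℝ E where
  carrier := {v | (∀ k, c.θ k y v = 0) ∧ ∀ k, c.σ k y v = 0}
  add_mem' := fun h h' => ⟨fun k => by simp [h.1, h'.1], fun k => by simp [h.2, h'.2]⟩
  zero_mem' := by simp
  smul_mem' := fun a v h => ⟨fun k => by simp [h.1], fun k => by simp [h.2]⟩

theorem mem_ker {c : Coframe (E := E) s U} {y : M} {v : E} :
    v ∈ c.ker y ↔ (∀ k, c.θ k y v = 0) ∧ ∀ k, c.σ k y v = 0 := Iff.rfl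

theorem eτ_mem (c : Coframe (E := E) s U) {y : M} (hy : y ∈ U) (k : Fin 2) :
    c.eτ k y ∈ c.ker y :=
  ⟨fun l => by simp [eτ, c.θ_vec _ hy], fun l => by simp [eτ, c.σ_vec _ hy]⟩

theorem eσ_mem (c : Coframe (E := E) s U) {y : M} (hy : y ∈ U) (k : Fin 2) :
    c.eσ k y ∈ c.swap.ker y :=
  ⟨fun l => (c.θ_vec _ hy l).trans rfl, fun l => (c.τ_vec _ hy l).trans rfl⟩

/-- The singular Pfaffian system spanned by `θ` and `σ`. -/
def sing (c : Coframe (E := E) s U) (y : M) : Submodule ℝ (E →L[ℝ] ℝ) :=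
  Submodule.span ℝ (Set.range (fun k => c.θ k y) ∪ Set.range (fun k => c.σ k y))

theorem expand_of_ker (c : Coframe (E := E) s U) {y : M} (hy : y ∈ U) {α : E →L[ℝ] ℝ}
    (h : ∀ v ∈ c.ker y, α v = 0) :
    α = ∑ k, α (c.eθ k y) • c.θ k y + ∑ k, α (c.eσ k y) • c.σ k y := by
  ext v
  conv_lhs => rw [c.eq_sum hy v]
  simp [h _ (c.eτ_mem hy _), mul_comm]

/-- Duality between the singular system and its characteristic plane {θ = σ = 0}. It lets two
singular systems be compared through their planes. -/
theorem mem_sing (c : Coframe (E := E) s U) {y : M} (hy : y ∈ U) {α : E →L[ℝ] ℝ} :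
    α ∈ c.sing y ↔ ∀ v ∈ c.ker y, α v = 0 := by
  constructor
  · intro h v hv
    induction h using Submodule.span_induction with
    | mem α h =>
      rcases h with ⟨k, rfl⟩ | ⟨k, rfl⟩
      exacts [hv.1 k, hv.2 k]
    | zero => rfl
    | add α β _ _ h h' => simp [h, h']
    | smul a α _ h => simp [h]
  · intro h
    rw [c.expand_of_ker hy h]
    exact Submodule.add_mem _
      (Submodule.sum_mem _ fun k _ => Submodule.smul_mem _ _
        (Submodule.subset_span (Or.inl ⟨k, rfl⟩)))
      (Submodule.sum_mem _ fun k _ => Submodule.smul_mem _ _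
        (Submodule.subset_span (Or.inr ⟨k, rfl⟩)))

/-- With `eq_zero_of_mem`, this makes {θ = 0} the direct sum of the two characteristic planes. -/
theorem exists_decomp (c : Coframe (E := E) s U) {y : M} (hy : y ∈ U) {v : E}
    (h : ∀ k, c.θ k y v = 0) : ∃ a ∈ c.ker y, ∃ b ∈ c.swap.ker y, v = a + b := by
  refine ⟨∑ k, c.τ k y v • c.eτ k y, Submodule.sum_mem _ fun k _ =>
    Submodule.smul_mem _ _ (c.eτ_mem hy k), ∑ k, c.σ k y v • c.eσ k y,
    Submodule.sum_mem _ fun k _ => Submodule.smul_mem _ _ (c.eσ_mem hy k), ?_⟩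
  conv_lhs => rw [c.eq_sum hy v]
  simp [h, add_comm]

theorem eq_zero_of_mem (c : Coframe (E := E) s U) {y : M} (hy : y ∈ U) {v : E}
    (h : v ∈ c.ker y) (h' : v ∈ c.swap.ker y) : v = 0 :=
  c.eq_of_frame hy (by simpa using h.1) (by simpa using h.2)
    (by simpa using (show ∀ k, c.τ k y v = 0 from h'.2))

/-- Forms in the ideal vanish on the span of a vector in each of the two characteristic planes. -/
theorem vanish_of_mem (c : Coframe (E := E) s U) {y : M} {p : ℕ} {γ : Form E p}
    (hγ : γ ∈ (FormIdeal.span (c.generators y)).carrier p) {v w : E} (hv : v ∈ c.ker y)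
    (hw : w ∈ c.swap.ker y) (u : Fin p → E) (hu : ∀ i, ∃ a b : ℝ, u i = a • v + b • w) :
    γ u = 0 := by
  let P : Submodule ℝ E := Submodule.span ℝ {v, w}
  have hP : ∀ u, u ∈ P ↔ ∃ a b : ℝ, u = a • v + b • w := fun u => by
    simp only [P, Submodule.mem_span_pair, eq_comm]
  refine FormIdeal.mem_span.1 hγ (FormIdeal.vanishing P) ?_ u fun i => (hP _).2 (hu i)
  have hw' : (∀ k, c.θ k y w = 0) ∧ ∀ k, c.τ k y w = 0 := hw
  rintro g (⟨k, rfl⟩ | rfl | rfl) u hu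
  · obtain ⟨a, b, h⟩ := (hP _).1 (hu (0 : Fin 1))
    simp [h, hv.1, hw'.1]
  · obtain ⟨a, b, h⟩ := (hP _).1 (hu (0 : Fin 2))
    obtain ⟨a', b', h'⟩ := (hP _).1 (hu (1 : Fin 2))
    refine (wedge₂_apply _ _ u).trans ?_
    rw [h, h']
    simp [hv.2]
    ring
  · obtain ⟨a, b, h⟩ := (hP _).1 (hu (0 : Fin 2))
    obtain ⟨a', b', h'⟩ := (hP _).1 (hu (1 : Fin 2))
    refine (wedge₂_apply _ _ u).trans ?_
    rw [h, h']
    simp [hw'.2]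
    ring

/-- A vector annihilated by θ lies in the span of one vector from each characteristic plane, and
every form of the ideal vanishes on such a span. Hence {θ = 0} is determined by the ideal alone. -/
theorem eq_zero_of_oneForm_mem (c : Coframe (E := E) s U) {y : M} (hy : y ∈ U) {α : E →L[ℝ] ℝ}
    (h : oneForm α ∈ (FormIdeal.span (c.generators y)).carrier 1) {v : E}
    (hv : ∀ k, c.θ k y v = 0) : α v = 0 := by
  obtain ⟨a, ha, b, hb, rfl⟩ := c.exists_decomp hy hv
  exact c.vanish_of_mem h ha hb (fun _ => a + b) fun _ => ⟨1, 1, by simp⟩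

theorem two_form_vanish (c : Coframe (E := E) s U) {y : M} {γ : Form E 2}
    (hγ : γ ∈ (FormIdeal.span (c.generators y)).carrier 2) {v w : E} (hv : v ∈ c.ker y)
    (hw : w ∈ c.swap.ker y) : γ ![v, w] = 0 :=
  c.vanish_of_mem hγ hv hw _ (Fin.forall_fin_two.2 ⟨⟨1, 0, by simp⟩, ⟨0, 1, by simp⟩⟩)

/-- A 2-form that vanishes on pairs of vectors in the two characteristic planes is in the ideal. -/
theorem two_form_mem (c : Coframe (E := E) s U) {y : M} (hy : y ∈ U) {γ : Form E 2}
    (h : ∀ v ∈ c.ker y, ∀ w ∈ c.swap.ker y, γ ![v, w] = 0) :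
    γ ∈ (FormIdeal.span (c.generators y)).carrier 2 := by
  set a := γ.bilin (c.eσ 0 y) (c.eσ 1 y) with ha
  set b := γ.bilin (c.eτ 0 y) (c.eτ 1 y) with hb
  have hself : ∀ v, γ.bilin v v = 0 := fun v => by have := γ.bilin_swap v v; linarith
  have h1 : wedge₂ (c.σ 0 y) (c.σ 1 y) ∈ (FormIdeal.span (c.generators y)).carrier 2 :=
    FormIdeal.subset_span (g := ⟨2, wedge₂ (c.σ 0 y) (c.σ 1 y)⟩) (Or.inr (Or.inl rfl))
  have h2 : wedge₂ (c.τ 0 y) (c.τ 1 y) ∈ (FormIdeal.span (c.generators y)).carrier 2 :=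
    FormIdeal.subset_span (g := ⟨2, wedge₂ (c.τ 0 y) (c.τ 1 y)⟩) (Or.inr (Or.inr rfl))
  -- Once the σ-σ and τ-τ components are removed, only mixed values could survive on {θ = 0}, and
  -- these vanish by assumption. The remainder is therefore generated by the θ.
  have h3 : γ - a • wedge₂ (c.σ 0 y) (c.σ 1 y) - b • wedge₂ (c.τ 0 y) (c.τ 1 y) ∈
      (FormIdeal.span (c.generators y)).carrier 2 := by
    refine FormIdeal.mem_of_vanish (θ := fun k => c.θ k y) (e := fun k => c.eθ k y)
      (fun k l => by simp [eθ, c.θ_vec _ hy, Pi.single_apply]) _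
      (fun k => FormIdeal.subset_span (g := ⟨1, oneForm (c.θ k y)⟩) (Or.inl ⟨k, rfl⟩)) ?_
    intro v w hv hw
    have ev := c.eq_sum hy v
    have ew := c.eq_sum hy w
    simp only [hv, hw, zero_smul, Finset.sum_const_zero, zero_add, Fin.sum_univ_two] at ev ew
    have z1 : ∀ i j, γ.bilin (c.eτ i y) (c.eσ j y) = 0 := fun i j =>
      h _ (c.eτ_mem hy i) _ (c.eσ_mem hy j)
    have z2 : ∀ i j, γ.bilin (c.eσ i y) (c.eτ j y) = 0 := fun i j => by
      rw [γ.bilin_swap, z1, neg_zero]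
    have e1 : γ ![v, w] = γ.bilin v w := rfl
    have e2 : ∀ α β : E →L[ℝ] ℝ, wedge₂ α β ![v, w] = α v * β w - α w * β v :=
      fun α β => wedge₂_bilin α β v w
    simp only [ContinuousAlternatingMap.sub_apply, ContinuousAlternatingMap.smul_apply, e1, e2]
    conv_lhs => enter [1, 1]; rw [ev, ew]
    simp only [map_add, LinearMap.add_apply, map_smul, LinearMap.smul_apply, smul_eq_mul, z1, z2,
      hself, γ.bilin_swap (c.eσ 1 y) (c.eσ 0 y), γ.bilin_swap (c.eτ 1 y) (c.eτ 0 y), ← ha, ← hb]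
    ring
  have h4 := Submodule.add_mem _ (Submodule.add_mem _ h3 (Submodule.smul_mem _ b h2))
    (Submodule.smul_mem _ a h1)
  convert h4 using 1
  abel

theorem θ_eq_zero_of_eq (c : Coframe (E := E) s U) (c' : Coframe (E := E) s U') {y : M}
    (hy : y ∈ U) (h : FormIdeal.span (c.generators y) = FormIdeal.span (c'.generators y))
    {v : E} (hv : ∀ k, c.θ k y v = 0) (k : Fin s) : c'.θ k y v = 0 :=
  c.eq_zero_of_oneForm_mem hy (by
    rw [h]
    exact FormIdeal.subset_span (g := ⟨1, oneForm (c'.θ k y)⟩) (Or.inl ⟨k, rfl⟩)) hv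

/-- The 2-form σ'⁰ ∧ σ'¹ vanishes on pairs with one vector in each characteristic plane of `c`. If
σ' were nonzero on both planes, its values on {θ = 0} would all be parallel, although σ' maps that
space onto ℝ². -/
theorem σ_eq_zero_or (c : Coframe (E := E) s U) (c' : Coframe (E := E) s U') {y : M}
    (hy : y ∈ U) (hy' : y ∈ U')
    (h : FormIdeal.span (c.generators y) = FormIdeal.span (c'.generators y)) :
    (∀ v ∈ c.ker y, ∀ k, c'.σ k y v = 0) ∨ ∀ v ∈ c.swap.ker y, ∀ k, c'.σ k y v = 0 := by
  by_contra! hc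
  obtain ⟨⟨v, hv, i, hi⟩, ⟨w, hw, j, hj⟩⟩ := hc
  have key : ∀ a ∈ c.ker y, ∀ b ∈ c.swap.ker y,
      c'.σ 0 y a * c'.σ 1 y b = c'.σ 0 y b * c'.σ 1 y a := by
    intro a ha b hb
    have := c.two_form_vanish (γ := wedge₂ (c'.σ 0 y) (c'.σ 1 y)) (by
      rw [h]; exact FormIdeal.subset_span (g := ⟨2, wedge₂ (c'.σ 0 y) (c'.σ 1 y)⟩)
        (Or.inr (Or.inl rfl))) ha hb
    rw [← Form.bilin_apply, wedge₂_bilin] at this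
    linarith
  -- The values of σ' at w and at b are both parallel to its nonzero value at v, hence to each
  -- other.
  have hpar : ∀ b ∈ c.swap.ker y, c'.σ 0 y b * c'.σ 1 y w = c'.σ 0 y w * c'.σ 1 y b := by
    intro b hb
    have h1 := key v hv w hw
    have h2 := key v hv b hb
    have : ∀ k, c'.σ k y v * (c'.σ 0 y b * c'.σ 1 y w - c'.σ 0 y w * c'.σ 1 y b) = 0 := by
      refine Fin.forall_fin_two.2 ⟨?_, ?_⟩
      · linear_combination c'.σ 0 y b * h1 - c'.σ 0 y w * h2
      · linear_combination c'.σ 1 y b * h1 - c'.σ 1 y w * h2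
    rcases mul_eq_zero.1 (this i) with h | h
    exacts [absurd h hi, by linarith]
  have hall : ∀ u, (∀ k, c'.θ k y u = 0) →
      c'.σ 0 y u * c'.σ 1 y w = c'.σ 0 y w * c'.σ 1 y u := by
    intro u hu
    obtain ⟨a, ha, b, hb, rfl⟩ := c.exists_decomp hy (c'.θ_eq_zero_of_eq c hy' h.symm hu)
    have h1 := key a ha w hw
    have h2 := hpar b hb
    simp only [map_add]
    linarith
  -- On the dual vectors σ' takes the values (1, 0) and (0, 1). Only the zero vector is parallel to
  -- both, so σ' would vanish at w.
  have h0 := hall _ (c'.eσ_mem hy' 0).1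
  have h1 := hall _ (c'.eσ_mem hy' 1).1
  simp only [eσ, c'.σ_vec _ hy'] at h0 h1
  simp at h0 h1
  revert hj
  revert j
  refine Fin.forall_fin_two.2 ⟨fun h => h h1.symm, fun h => h h0⟩

/-- At a point, the two characteristic planes of a hyperbolic system are unique up to
interchange. -/
theorem ker_eq_or (c : Coframe (E := E) s U) (c' : Coframe (E := E) s U') {y : M}
    (hy : y ∈ U) (hy' : y ∈ U')
    (h : FormIdeal.span (c.generators y) = FormIdeal.span (c'.generators y)) :
    (c.ker y = c'.ker y ∧ c.swap.ker y = c'.swap.ker y) ∨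
      (c.ker y = c'.swap.ker y ∧ c.swap.ker y = c'.ker y) := by
  have hs : ∀ c : Coframe (E := E) s U', FormIdeal.span (c.generators y) =
      FormIdeal.span (c.swap.generators y) := fun c => by
    rw [generators, generators, Set.pair_comm]; rfl
  have hne : ∀ c : Coframe (E := E) s U, ¬ ∀ v ∈ c.ker y, v = 0 := fun c h0 => by
    have h1 := c.τ_vec (0, 0, Pi.single 0 1) hy 0
    have h2 : c.vec (0, 0, Pi.single 0 1) y = 0 := h0 _ (c.eτ_mem hy 0)
    rw [h2] at h1
    simp at h1
  have aux : ∀ (c' : Coframe (E := E) s U'),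
      FormIdeal.span (c.generators y) = FormIdeal.span (c'.generators y) →
      (∀ v ∈ c.ker y, ∀ k, c'.σ k y v = 0) →
      c.ker y = c'.ker y ∧ c.swap.ker y = c'.swap.ker y := by
    intro c' h hA
    have hA' : c.ker y ≤ c'.ker y := fun v hv => ⟨c.θ_eq_zero_of_eq c' hy h hv.1, hA v hv⟩
    have hC' : c.swap.ker y ≤ c'.swap.ker y := by
      -- If τ' also vanished on the plane where σ' and θ' vanish, that plane would be zero. So τ'
      -- must vanish on the other plane.
      rcases c.σ_eq_zero_or c'.swap hy hy' (h.trans (hs c')) with h1 | h1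
      · exact absurd (fun v hv => c'.eq_zero_of_mem hy' (hA' hv)
          ⟨(hA' hv).1, h1 v hv⟩) (hne c)
      · exact fun v hv => ⟨c.θ_eq_zero_of_eq c' hy h hv.1, h1 v hv⟩
    refine ⟨le_antisymm hA' fun v hv => ?_, le_antisymm hC' fun v hv => ?_⟩
    · obtain ⟨a, ha, b, hb, rfl⟩ := c.exists_decomp hy (c'.θ_eq_zero_of_eq c hy' h.symm hv.1)
      have hb' : b ∈ c'.ker y := by simpa using Submodule.sub_mem _ hv (hA' ha)
      rw [c'.eq_zero_of_mem hy' hb' (hC' hb), add_zero]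
      exact ha
    · obtain ⟨a, ha, b, hb, rfl⟩ := c.exists_decomp hy (c'.θ_eq_zero_of_eq c hy' h.symm hv.1)
      have ha' : a ∈ c'.swap.ker y := by simpa using Submodule.sub_mem _ hv (hC' hb)
      rw [c'.eq_zero_of_mem hy' (hA' ha) ha', zero_add]
      exact hb
  rcases c.σ_eq_zero_or c' hy hy' h with h1 | h1
  · exact Or.inl (aux c' h h1)
  · rcases c.σ_eq_zero_or c'.swap hy hy' (h.trans (hs c')) with h2 | h2
    · exact Or.inr (aux c'.swap (h.trans (hs c')) h2)
    · refine absurd (fun v hv => ?_) (hne c.swap)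
      have hθ := c.θ_eq_zero_of_eq c' hy h hv.1
      exact c'.eq_zero_of_mem hy' ⟨hθ, h1 v hv⟩ ⟨hθ, h2 v hv⟩

theorem sing_eq (c : Coframe (E := E) s U) (c' : Coframe (E := E) s U') {y : M}
    (hy : y ∈ U) (hy' : y ∈ U') (h : c.ker y = c'.ker y) : c.sing y = c'.sing y := by
  ext α
  rw [c.mem_sing hy, c'.mem_sing hy', h]

/-- Near a point, the two singular systems of a hyperbolic system are unique up to interchange. -/
theorem eventually_ker_eq_or (c : Coframe (E := E) s U) (c' : Coframe (E := E) s U')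
    {I : M → FormIdeal E} (hc : c.IsAdapted I) (hc' : c'.IsAdapted I) (hU : IsOpen U)
    (hU' : IsOpen U') {x : M} (hx : x ∈ U) (hx' : x ∈ U') :
    (∀ᶠ y in 𝓝 x, c.ker y = c'.ker y ∧ c.swap.ker y = c'.swap.ker y) ∨
      ∀ᶠ y in 𝓝 x, c.ker y = c'.swap.ker y ∧ c.swap.ker y = c'.ker y := by
  have aux : ∀ c' : Coframe (E := E) s U', c'.IsAdapted I → c.ker x = c'.ker x →
      ∀ᶠ y in 𝓝 x, c.ker y = c'.ker y ∧ c.swap.ker y = c'.swap.ker y := by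
    intro c' hc' h
    -- A value that is nonzero at x stays nonzero nearby and rules out the interchanged matching
    -- there. This upgrades the pointwise alternative to a neighbourhood.
    have hk : ∃ k, c'.τ k x (c.eτ 0 x) ≠ 0 := by
      by_contra! h0
      have h1 : c.eτ 0 x ∈ c'.ker x := h ▸ c.eτ_mem hx 0
      have h2 := c'.eq_zero_of_mem hx' h1 ⟨h1.1, h0⟩
      have h3 := c.τ_vec (0, 0, Pi.single 0 1) hx 0
      rw [show c.vec (0, 0, Pi.single 0 1) x = 0 from h2] at h3
      simp at h3
    obtain ⟨k, hk⟩ := hk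
    have hcont : ContinuousAt (fun y => c'.τ k y (c.eτ 0 y)) x := by
      have h1 := (((c'.smooth_τ k).mono (V := U ∩ U') Set.inter_subset_right).apply
        (X := c.eτ 0) (fun x₀ => ((c.smooth_vec _) x₀).mono fun z hz => ⟨hz.1, hz.2.1⟩))
      exact h1.continuousOn.continuousAt ((hU.inter hU').mem_nhds ⟨hx, hx'⟩)
    filter_upwards [hcont.eventually_ne hk, hU.mem_nhds hx, hU'.mem_nhds hx'] with y hy hyU hyU'
    rcases c.ker_eq_or c' hyU hyU' ((hc y hyU).symm.trans (hc' y hyU')) with h1 | h1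
    · exact h1
    · have h2 : c.eτ 0 y ∈ c'.swap.ker y := h1.1 ▸ c.eτ_mem hyU 0
      exact absurd (h2.2 k) hy
  rcases c.ker_eq_or c' hx hx' ((hc x hx).symm.trans (hc' x hx')) with h | h
  · exact Or.inl (aux c' hc' h.1)
  · exact Or.inr (aux c'.swap hc'.swap h.1)

theorem isSingularPair (c : Coframe (E := E) s U) {I : M → FormIdeal E} (hc : c.IsAdapted I)
    (hU : IsOpen U) : IsSingularPair s I U c.sing c.swap.sing :=
  fun _ hx => ⟨U, hU, hx, c, hc, fun _ _ => ⟨rfl, rfl⟩⟩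

end Coframe

theorem firstIntegrals_congr {W W' : M → Submodule ℝ (E →L[ℝ] ℝ)} {x : M} (h : W =ᶠ[𝓝 x] W') :
    firstIntegrals W x = firstIntegrals W' x := by
  have aux : ∀ {W W' : M → Submodule ℝ (E →L[ℝ] ℝ)}, W =ᶠ[𝓝 x] W' →
      firstIntegrals W x ≤ firstIntegrals W' x := by
    intro W W' h
    obtain ⟨V, hV, hVo, hxV⟩ := eventually_nhds_iff.1 h
    refine Submodule.span_mono ?_
    rintro α ⟨U, f, hU, hx, hf, hW, rfl⟩
    exact ⟨U ∩ V, f, hU.inter hVo, ⟨hx, hxV⟩, hf.mono Set.inter_subset_left,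
      fun y hy => hV y hy.2 ▸ hW y hy.1, rfl⟩
  exact le_antisymm (aux h) (aux h.symm)

/-- The contact condition: the exterior derivative of the 1-form of a Monge-Ampère system does not
vanish on the characteristic planes. -/
theorem IsMongeAmpere.exists_ne_zero {H : HyperbolicSystem E M 1} (hMA : IsMongeAmpere H)
    {U : Set M} (hU : IsOpen U) (c : Coframe (E := E) 1 U) (hc : c.IsAdapted H.ideal) {y : M}
    (hy : y ∈ U) : ∃ v ∈ c.ker y, ∃ w ∈ c.ker y, extDeriv₁ (c.θ 0) y v w ≠ 0 := by
  by_contra! h0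
  have hmem : ∀ y ∈ U, oneForm (c.θ 0 y) ∈ (H.ideal y).carrier 1 := fun y hy => by
    rw [hc y hy]
    exact FormIdeal.subset_span (g := ⟨1, oneForm (c.θ 0 y)⟩) (Or.inl ⟨0, rfl⟩)
  have hne : oneForm (c.θ 0 y) ≠ 0 := fun h => by
    have h1 := c.θ_vec (1, 0, 0) hy 0
    have h2 := congrArg (fun γ : Form E 1 => γ fun _ => c.vec (1, 0, 0) y) h
    simp [h1] at h2
  refine hMA U (fun y => oneForm (c.θ 0 y)) hU (c.smooth_θ 0) hmem y hy hne ?_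
  have hd := H.closed 1 U hU _ (c.smooth_θ 0) hmem y hy
  rw [hc y hy] at hd
  set δ : Form E (1 + 1) := extDerivAt (fun y => oneForm (c.θ 0 y)) y with hδ
  -- Under the contrary assumption the plane {θ = σ = 0} lies in the kernel of dθ restricted to {θ =
  -- 0}. Pairs inside the plane vanish by assumption, and mixed pairs vanish because dθ lies in the
  -- ideal.
  have hz : ∀ v ∈ c.ker y, ∀ w, c.θ 0 y w = 0 → Form.bilin (E := E) δ v w = 0 := by
    intro v hv w hw
    obtain ⟨a, ha, b, hb, rfl⟩ := c.exists_decomp hy (v := w) (fun k => by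
      rw [Subsingleton.elim k 0]; exact hw)
    rw [map_add]
    have h1 : Form.bilin (E := E) δ v a = 0 := h0 v hv a ha
    have h2 : Form.bilin (E := E) δ v b = 0 := c.two_form_vanish hd hv hb
    rw [h1, h2, add_zero]
  have hz2 : ∀ u : Fin (1 + 1) → E, (∀ i, c.θ 0 y (u i) = 0) → (∃ i, u i ∈ c.ker y) →
      δ u = 0 := by
    intro u hu hi
    have hu' : δ u = Form.bilin (E := E) δ (u 0) (u 1) := by
      rw [Form.bilin_apply]
      congr 1
      funext i
      fin_cases i <;> rfl
    rw [hu']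
    obtain ⟨i, hi⟩ := hi
    rcases fin2_cases 0 i with rfl | rfl
    · exact hz _ hi _ (hu 1)
    · rw [Form.bilin_swap, hz (u 1) hi _ (hu 0), neg_zero]
  let B : Module.Basis (Fin 1 ⊕ (Fin 2 ⊕ Fin 2)) ℝ E :=
    ((Pi.basisFun ℝ (Fin 1)).prod ((Pi.basisFun ℝ (Fin 2)).prod (Pi.basisFun ℝ (Fin 2)))).map
      (LinearEquiv.ofBijective (c.frame y).toLinearMap (c.bijective y hy)).symm
  have hB : ∀ i, c.frame y (B i) = (Pi.basisFun ℝ (Fin 1)).prod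
      ((Pi.basisFun ℝ (Fin 2)).prod (Pi.basisFun ℝ (Fin 2))) i := by
    intro i
    exact (LinearEquiv.ofBijective (c.frame y).toLinearMap (c.bijective y hy)).apply_symm_apply _
  have hBθ : ∀ i, i ≠ Sum.inl 0 → c.θ 0 y (B i) = 0 := by
    rintro (i | i | i) hi
    · exact absurd (by rw [Subsingleton.elim i 0]) hi
    · have := congrFun (congrArg Prod.fst (hB (Sum.inr (Sum.inl i)))) 0
      simpa using this
    · have := congrFun (congrArg Prod.fst (hB (Sum.inr (Sum.inr i)))) 0
      simpa using this
  have hBker : B (Sum.inr (Sum.inr 0)) ∈ c.ker y := by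
    have := hB (Sum.inr (Sum.inr 0))
    refine ⟨fun k => ?_, fun k => ?_⟩
    · have := congrFun (congrArg Prod.fst this) k
      simpa using this
    · have := congrFun (congrArg (fun t => t.2.1) this) k
      simpa using this
  -- θ ∧ dθ ∧ dθ has top degree, so each basis vector occurs exactly once. A term can survive only
  -- if the vector dual to θ fills the slot of θ. Then the vector dual to τ⁰ fills a slot of some
  -- dθ, whose other argument is annihilated by θ, and that factor is zero.
  refine Form.eq_zero_of_basis B _ fun v hv => ?_
  have hvs : Function.Bijective v := by
    rw [Fintype.bijective_iff_injective_and_card]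
    exact ⟨hv, by simp⟩
  rw [wedge_apply, Finset.sum_eq_zero, mul_zero]
  intro ρ _
  by_cases h1 : v (ρ (Fin.castAdd (1 + 1 + (1 + 1)) (0 : Fin 1))) = Sum.inl 0
  · have hθ : ∀ j, c.θ 0 y (B (v (ρ (Fin.natAdd 1 j)))) = 0 := fun j => hBθ _ fun h2 => by
      have := ρ.injective (hv (h1.trans h2.symm))
      simp [Fin.ext_iff] at this
      omega
    have hq : ∃ q, v (ρ (Fin.natAdd 1 q)) = Sum.inr (Sum.inr 0) := by
      obtain ⟨p, hp⟩ := hvs.2 (Sum.inr (Sum.inr 0))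
      obtain ⟨r, rfl⟩ := ρ.surjective p
      induction r using Fin.addCases with
      | left r =>
        rw [Subsingleton.elim r 0, h1] at hp
        simp at hp
      | right q => exact ⟨q, hp⟩
    have hw : wedge δ δ (fun j => B (v (ρ (Fin.natAdd 1 j)))) = 0 := by
      rw [wedge_apply, Finset.sum_eq_zero, mul_zero]
      intro μ _
      obtain ⟨q, hq⟩ := hq
      obtain ⟨r, rfl⟩ := μ.surjective q
      induction r using Fin.addCases with
      | left r =>
        rw [hz2 (fun i => B (v (ρ (Fin.natAdd 1 (μ (Fin.castAdd (1 + 1) i))))))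
          (fun i => hθ _) ⟨r, by rw [hq]; exact hBker⟩, zero_mul, smul_zero]
      | right r =>
        rw [hz2 (fun i => B (v (ρ (Fin.natAdd 1 (μ (Fin.natAdd (1 + 1) i))))))
          (fun i => hθ _) ⟨r, by rw [hq]; exact hBker⟩, mul_zero, smul_zero]
    rw [hw, mul_zero, smul_zero]
  · have h2 : oneForm (c.θ 0 y) (fun i => B (v (ρ (Fin.castAdd (1 + 1 + (1 + 1)) i)))) = 0 :=
      hBθ _ h1
    rw [h2, zero_mul, smul_zero]

end Algebra
end EDS

namespace EDS

/-! ### Local sections in level sets and descent of first integrals. -/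

section Descent

variable {E : Type*} [NormedAddCommGroup E] [NormedSpace ℝ E] [FiniteDimensional ℝ E]
  {E' : Type*} [NormedAddCommGroup E'] [NormedSpace ℝ E'] [FiniteDimensional ℝ E']
  {M : Type*} [TopologicalSpace M] [ChartedSpace E M] [IsManifold 𝓘(ℝ, E) ∞ M]
  {M' : Type*} [TopologicalSpace M'] [ChartedSpace E' M'] [IsManifold 𝓘(ℝ, E') ∞ M']

theorem ContMDiffOn.mdifferentiableAt' {f : M → M'} {S : Set M} (hS : IsOpen S)
    (hf : ContMDiffOn 𝓘(ℝ, E) 𝓘(ℝ, E') ∞ f S) {x : M} (hx : x ∈ S) :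
    MDifferentiableAt 𝓘(ℝ, E) 𝓘(ℝ, E') f x :=
  (hf.contMDiffAt (hS.mem_nhds hx)).mdifferentiableAt (by simp)

/-- A submersion with 1-dimensional fibres has local sections in the level sets of a function that
is not constant along the fibres. -/
theorem exists_section {P : M → M'} {g : M → ℝ} {S : Set M} (hS : IsOpen S)
    (hP : ContMDiffOn 𝓘(ℝ, E) 𝓘(ℝ, E') ∞ P S) (hg : ContMDiffOn 𝓘(ℝ, E) 𝓘(ℝ, ℝ) ∞ g S) {e : M}
    (he : e ∈ S)
    (hinj : ∀ v, tangentMap E E' P e v = 0 → differential E g e v = 0 → v = 0)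
    (hdim : Module.finrank ℝ E = Module.finrank ℝ E' + 1) :
    ∃ (O : Set M') (t : M' → M), IsOpen O ∧ P e ∈ O ∧ ContMDiffOn 𝓘(ℝ, E') 𝓘(ℝ, E) ∞ t O ∧
      t (P e) = e ∧ ∀ m ∈ O, t m ∈ S ∧ P (t m) = m ∧ g (t m) = g e := by
  set φ := extChartAt 𝓘(ℝ, E) e with hφ
  set ψ := extChartAt 𝓘(ℝ, E') (P e) with hψ
  have ex : φ.symm (φ e) = e := extChartAt_to_inv e
  -- By the transversality and dimension hypotheses (P, g) is a local diffeomorphism in charts. Its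
  -- inverse with the second coordinate frozen at g(e) is the required section.
  let G : E → E' × ℝ := fun u => (ψ (P (φ.symm u)), g (φ.symm u))
  have hS' : IsOpen (S ∩ P ⁻¹' ψ.source) :=
    hP.continuousOn.isOpen_inter_preimage hS (isOpen_extChartAt_source (P e))
  have hD : IsOpen (φ.target ∩ φ.symm ⁻¹' (S ∩ P ⁻¹' ψ.source)) := isOpen_target_inter e hS'
  set D := φ.target ∩ φ.symm ⁻¹' (S ∩ P ⁻¹' ψ.source) with hDdef
  have heD : φ e ∈ D := by
    refine ⟨mem_extChartAt_target e, ?_⟩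
    rw [Set.mem_preimage, ex]
    exact ⟨he, mem_extChartAt_source _⟩
  have hG1 : ContDiffOn ℝ ∞ (fun u => ψ (P (φ.symm u))) D := by
    rw [← contMDiffOn_iff_contDiffOn]
    refine (contMDiffOn_extChartAt (n := ∞) (x := P e)).comp
      (hP.comp ((contMDiffOn_extChartAt_symm (n := ∞) e).mono Set.inter_subset_left)
        fun u hu => hu.2.1) ?_
    intro u hu
    have := hu.2.2
    rwa [Set.mem_preimage, hψ, extChartAt_source] at this
  have hG : ContDiffOn ℝ ∞ G D :=
    hG1.prodMk ((contDiffOn_inChart hg e).mono fun u hu => ⟨hu.1, hu.2.1⟩)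
  have hGe : ContDiffAt ℝ ∞ G (φ e) := hG.contDiffAt (hD.mem_nhds heD)
  have hG' : Function.Injective (fderiv ℝ G (φ e)) := by
    rw [injective_iff_map_eq_zero]
    intro u hu
    have d0 : MDifferentiableAt 𝓘(ℝ, E) 𝓘(ℝ, E) φ.symm (φ e) :=
      mdifferentiableAt_chart_symm e (mem_extChartAt_target e)
    have d1 : MDifferentiableAt 𝓘(ℝ, E) 𝓘(ℝ, E') P (φ.symm (φ e)) := by
      rw [ex]; exact ContMDiffOn.mdifferentiableAt' hS hP he
    have d2 : MDifferentiableAt 𝓘(ℝ, E') 𝓘(ℝ, E') ψ (P (φ.symm (φ e))) := by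
      rw [ex]; exact mdifferentiableAt_extChartAt (mem_chart_source _ _)
    have d3 : MDifferentiableAt 𝓘(ℝ, E) 𝓘(ℝ, ℝ) g (φ.symm (φ e)) := by
      rw [ex]; exact ContMDiffOn.mdifferentiableAt' hS hg he
    have c1 : mfderiv 𝓘(ℝ, E) 𝓘(ℝ, E') (fun u => ψ (P (φ.symm u))) (φ e) = _ :=
      mfderiv_comp (φ e) d2 (d1.comp (φ e) d0)
    have c2 := mfderiv_comp (φ e) d1 d0
    have c3 : mfderiv 𝓘(ℝ, E) 𝓘(ℝ, ℝ) (fun u => g (φ.symm u)) (φ e) = _ :=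
      mfderiv_comp (φ e) d3 d0
    rw [mfderiv_eq_fderiv] at c1 c3
    have hpd : fderiv ℝ G (φ e) = (fderiv ℝ (fun u => ψ (P (φ.symm u))) (φ e)).prod
        (fderiv ℝ (fun u => g (φ.symm u)) (φ e)) :=
      ((hGe.fst.differentiableAt (by simp)).fderiv_prodMk (hGe.snd.differentiableAt (by simp)))
    rw [hpd] at hu
    have hu1 : fderiv ℝ (fun u => ψ (P (φ.symm u))) (φ e) u = 0 := congrArg Prod.fst hu
    have hu2 : fderiv ℝ (fun u => g (φ.symm u)) (φ e) u = 0 := congrArg Prod.snd hu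
    have f1 : tangentMap E' E' ψ (P (φ.symm (φ e))) (tangentMap E E' P (φ.symm (φ e))
        (tangentMap E E φ.symm (φ e) u)) = 0 := by
      refine Eq.trans ?_ hu1
      refine Eq.trans ?_ (DFunLike.congr_fun c1 u).symm
      exact (congrArg (fun t => tangentMap E' E' ψ (P (φ.symm (φ e))) t)
        (DFunLike.congr_fun c2 u)).symm
    have f2 : differential E g (φ.symm (φ e)) (tangentMap E E φ.symm (φ e) u) = 0 :=
      ((DFunLike.congr_fun c3 u).symm.trans hu2 :)
    rw [ex] at f1 f2
    have i1 : (tangentMap E' E' ψ (P e)).IsInvertible :=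
      isInvertible_mfderiv_extChartAt (mem_extChartAt_source _)
    have f3 : tangentMap E E' P e (tangentMap E E φ.symm (φ e) u) = 0 :=
      i1.bijective.1 (f1.trans (map_zero _).symm)
    have f4 := hinj _ f3 f2
    exact (isInvertible_tangentMap_symm e (mem_extChartAt_target e)).bijective.1
      (f4.trans (map_zero _).symm)
  have hbij : Function.Bijective (fderiv ℝ G (φ e)).toLinearMap := by
    refine ⟨hG', ?_⟩
    exact (LinearMap.injective_iff_surjective_of_finrank_eq_finrank
      (f := (fderiv ℝ G (φ e)).toLinearMap) (by simp [hdim])).1 hG'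
  let L : E ≃L[ℝ] E' × ℝ := (LinearEquiv.ofBijective _ hbij).toContinuousLinearEquiv
  have hL : HasFDerivAt G (L : E →L[ℝ] E' × ℝ) (φ e) :=
    (hGe.differentiableAt (by simp)).hasFDerivAt
  let R := hGe.toOpenPartialHomeomorph G hL (by simp)
  have hRG : ∀ u, R u = G u := fun u => rfl
  have hRe : φ e ∈ R.source := hGe.mem_toOpenPartialHomeomorph_source hL (by simp)
  -- The section has to be smooth on a whole neighbourhood, so the differential of G must be
  -- invertible at all nearby points. This is an open condition.
  have hinv : ∀ᶠ u in 𝓝 (φ e), ∃ L' : E ≃L[ℝ] E' × ℝ, (L' : E →L[ℝ] E' × ℝ) = fderiv ℝ G u := by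
    have hc : ContinuousAt (fderiv ℝ G) (φ e) :=
      (hGe.fderiv_right (m := 0) (by simp)).continuousAt
    exact hc.eventually (ContinuousLinearEquiv.nhds (𝕜 := ℝ) L)
  have hsymm : ContinuousAt R.symm (G (φ e)) := R.continuousAt_symm (R.map_source hRe)
  have hse : R.symm (G (φ e)) = φ e := R.left_inv hRe
  have hev : ∀ᶠ w in 𝓝 (G (φ e)), ContDiffAt ℝ ∞ R.symm w ∧ G (R.symm w) = w ∧ R.symm w ∈ D := by
    have h1 : ∀ᶠ w in 𝓝 (G (φ e)), (∃ L' : E ≃L[ℝ] E' × ℝ,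
        (L' : E →L[ℝ] E' × ℝ) = fderiv ℝ G (R.symm w)) ∧ R.symm w ∈ D :=
      hsymm.tendsto.eventually (by rw [hse]; exact hinv.and (hD.mem_nhds heD))
    filter_upwards [h1, R.open_target.mem_nhds (R.map_source hRe)] with w hw hwt
    obtain ⟨⟨L', hL'⟩, hwD⟩ := hw
    have hGw : ContDiffAt ℝ ∞ G (R.symm w) := hG.contDiffAt (hD.mem_nhds hwD)
    refine ⟨R.contDiffAt_symm (f₀' := L') hwt ?_ hGw, R.right_inv hwt, hwD⟩
    rw [hL']
    exact (hGw.differentiableAt (by simp)).hasFDerivAt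
  have hGe' : G (φ e) = (ψ (P e), g e) := by simp only [G, ex]
  rw [hGe'] at hev
  have hψc : ContinuousAt (fun m => (ψ m, g e)) (P e) :=
    (continuousAt_extChartAt (P e)).prodMk continuousAt_const
  have hev' := (hψc.tendsto.eventually hev).and
    (extChartAt_source_mem_nhds (I := 𝓘(ℝ, E')) (P e))
  obtain ⟨O, hO, hOo, hPO⟩ := eventually_nhds_iff.1 hev'
  refine ⟨O, fun m => φ.symm (R.symm (ψ m, g e)), hOo, hPO, ?_, ?_, ?_⟩
  · intro m hm
    obtain ⟨⟨h1, -, h3⟩, h4⟩ := hO m hm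
    refine ContMDiffAt.contMDiffWithinAt ?_
    have k1 : ContMDiffAt 𝓘(ℝ, E) 𝓘(ℝ, E) ∞ φ.symm (R.symm (ψ m, g e)) :=
      (contMDiffOn_extChartAt_symm (n := ∞) e).contMDiffAt
        ((isOpen_extChartAt_target e).mem_nhds h3.1)
    have k2 : ContMDiffAt 𝓘(ℝ, E') 𝓘(ℝ, E') ∞ ψ m :=
      contMDiffAt_extChartAt' (by rwa [← extChartAt_source 𝓘(ℝ, E')])
    have k3 : ContMDiffAt 𝓘(ℝ, E') 𝓘(ℝ, E) ∞ (fun u => R.symm (u, g e)) (ψ m) :=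
      (h1.comp (ψ m) (contDiffAt_id.prodMk contDiffAt_const)).contMDiffAt
    have k4 : ContMDiffAt 𝓘(ℝ, E') 𝓘(ℝ, E) ∞ (fun u => R.symm (ψ u, g e)) m :=
      ContMDiffAt.comp (g := fun u => R.symm (u, g e)) m k3 k2
    exact ContMDiffAt.comp m k1 k4
  · simp only
    rw [← hGe', hse, ex]
  · intro m hm
    obtain ⟨⟨-, h2, h3⟩, h4⟩ := hO m hm
    have h5 := congrArg Prod.fst h2
    have h6 := congrArg Prod.snd h2
    exact ⟨h3.2.1, ψ.injOn h3.2.2 h4 h5, h6⟩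

/-- A function whose differential is a multiple of `dg` plus the pullback of a section of `V`
gives rise to a first integral of `V`. -/
theorem exists_firstIntegral {P : M → M'} {g h : M → ℝ} {S : Set M} (hS : IsOpen S)
    (hP : ContMDiffOn 𝓘(ℝ, E) 𝓘(ℝ, E') ∞ P S) (hg : ContMDiffOn 𝓘(ℝ, E) 𝓘(ℝ, ℝ) ∞ g S)
    (hh : ContMDiffOn 𝓘(ℝ, E) 𝓘(ℝ, ℝ) ∞ h S) {e : M} (he : e ∈ S)
    (hinj : ∀ v, tangentMap E E' P e v = 0 → differential E g e v = 0 → v = 0)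
    (hdim : Module.finrank ℝ E = Module.finrank ℝ E' + 1)
    {V : M' → Submodule ℝ (E' →L[ℝ] ℝ)}
    (hV : ∀ y ∈ S, ∃ a : ℝ, ∃ β ∈ V (P y),
      differential E h y = a • differential E g y + β.comp (tangentMap E E' P y)) :
    ∃ β ∈ firstIntegrals V (P e), ∃ a : ℝ,
      differential E h e = a • differential E g e + β.comp (tangentMap E E' P e) := by
  obtain ⟨O, t, hO, heO, ht, hte, htO⟩ := exists_section hS hP hg he hinj hdim
  have hht : ContMDiffOn 𝓘(ℝ, E') 𝓘(ℝ, ℝ) ∞ (h ∘ t) O := hh.comp ht fun m hm => (htO m hm).1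
  -- Along the section t the pullback of dg is zero and P ∘ t is the identity. Pulling back dh = a
  -- dg + P^*β thus leaves exactly β, and the coefficient a plays no role.
  have key : ∀ m ∈ O, ∀ (a : ℝ) (β : E' →L[ℝ] ℝ),
      differential E h (t m) = a • differential E g (t m) + β.comp (tangentMap E E' P (t m)) →
      differential E' (h ∘ t) m = β := by
    intro m hm a β hβ
    have d1 := ContMDiffOn.mdifferentiableAt' hO ht hm
    have htm := (htO m hm).1
    rw [differential_comp d1 (ContMDiffOn.mdifferentiableAt' hS hh htm), hβ]
    have e1 : (differential E g (t m)).comp (tangentMap E' E t m) = 0 := by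
      rw [← differential_comp d1 (ContMDiffOn.mdifferentiableAt' hS hg htm)]
      rw [differential_congr (g := fun _ => g e) (by
        filter_upwards [hO.mem_nhds hm] with m' hm'
        exact (htO m' hm').2.2)]
      exact mfderiv_const
    have e2 : (tangentMap E E' P (t m)).comp (tangentMap E' E t m) =
        ContinuousLinearMap.id ℝ E' := by
      have c1 := mfderiv_comp m (ContMDiffOn.mdifferentiableAt' hS hP htm) d1
      have c2 : mfderiv 𝓘(ℝ, E') 𝓘(ℝ, E') (P ∘ t) m = mfderiv 𝓘(ℝ, E') 𝓘(ℝ, E') id m := by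
        refine Filter.EventuallyEq.mfderiv_eq ?_
        filter_upwards [hO.mem_nhds hm] with m' hm'
        exact (htO m' hm').2.1
      rw [mfderiv_id] at c2
      exact c1.symm.trans c2
    rw [ContinuousLinearMap.add_comp, ContinuousLinearMap.smul_comp, e1, smul_zero, zero_add,
      ContinuousLinearMap.comp_assoc, e2, ContinuousLinearMap.comp_id]
  obtain ⟨a, β, hβ, hd⟩ := hV e he
  have hβe : differential E' (h ∘ t) (P e) = β := key _ heO a β (by rw [hte]; exact hd)
  refine ⟨β, Submodule.subset_span ⟨O, h ∘ t, hO, heO, hht, fun m hm => ?_, hβe.symm⟩, a, hd⟩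
  obtain ⟨a', β', hβ', hd'⟩ := hV (t m) (htO m hm).1
  rw [key m hm a' β' hd']
  rwa [(htO m hm).2.1] at hβ'

/-! ### Lifts of coframes along submersions with 1-dimensional fibres. -/

namespace Coframe

variable {s : ℕ} {U : Set M} {U' : Set M'}

/-- The coframe `c` consists of the pullback of `c'` together with the additional form `θ⁰`. -/
structure IsLift (P : M → M') (c : Coframe (E := E) (s + 1) U) (c' : Coframe (E := E') s U') :
    Prop where
  maps : ∀ y ∈ U, P y ∈ U'
  θ : ∀ y ∈ U, ∀ k, (c'.θ k (P y)).comp (tangentMap E E' P y) = c.θ k.succ y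
  σ : ∀ y ∈ U, ∀ k, (c'.σ k (P y)).comp (tangentMap E E' P y) = c.σ k y
  τ : ∀ y ∈ U, ∀ k, (c'.τ k (P y)).comp (tangentMap E E' P y) = c.τ k y

namespace IsLift

variable {P : M → M'} {c : Coframe (E := E) (s + 1) U} {c' : Coframe (E := E') s U'}

theorem swap (h : IsLift P c c') : IsLift P c.swap c'.swap := ⟨h.maps, h.θ, h.τ, h.σ⟩

theorem θ_apply (h : IsLift P c c') {y : M} (hy : y ∈ U) (k) (v : E) :
    c'.θ k (P y) (tangentMap E E' P y v) = c.θ k.succ y v := DFunLike.congr_fun (h.θ y hy k) v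

theorem σ_apply (h : IsLift P c c') {y : M} (hy : y ∈ U) (k) (v : E) :
    c'.σ k (P y) (tangentMap E E' P y v) = c.σ k y v := DFunLike.congr_fun (h.σ y hy k) v

theorem τ_apply (h : IsLift P c c') {y : M} (hy : y ∈ U) (k) (v : E) :
    c'.τ k (P y) (tangentMap E E' P y v) = c.τ k y v := DFunLike.congr_fun (h.τ y hy k) v

/-- All the pulled-back forms vanish on the vector dual to θ⁰. With `eq_smul`, this makes `c.eθ 0` a
generator of the fibre direction. -/
theorem tangentMap_eθ (h : IsLift P c c') {y : M} (hy : y ∈ U) :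
    tangentMap E E' P y (c.eθ 0 y) = 0 := by
  apply c'.eq_of_frame (h.maps y hy) <;> intro k
  · rw [h.θ_apply hy]; simp [eθ, c.θ_vec _ hy]
  · rw [h.σ_apply hy]; simp [eθ, c.σ_vec _ hy]
  · rw [h.τ_apply hy]; simp [eθ, c.τ_vec _ hy]

theorem eq_smul (h : IsLift P c c') {y : M} (hy : y ∈ U) {v : E}
    (hv : tangentMap E E' P y v = 0) : v = c.θ 0 y v • c.eθ 0 y := by
  have h1 : ∀ k : Fin s, c.θ k.succ y v = 0 := fun k => by rw [← h.θ_apply hy, hv, map_zero]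
  have h2 : ∀ k, c.σ k y v = 0 := fun k => by rw [← h.σ_apply hy, hv, map_zero]
  have h3 : ∀ k, c.τ k y v = 0 := fun k => by rw [← h.τ_apply hy, hv, map_zero]
  conv_lhs => rw [c.eq_sum hy v]
  simp [Fin.sum_univ_succ, h1, h2, h3]

/-- The fibre direction is the line of `c.eθ 0`, so being semi-basic is a single scalar equation,
whose left side depends smoothly on the point when the covector does. -/
theorem mem_semibasic (h : IsLift P c c') {y : M} (hy : y ∈ U) {α : E →L[ℝ] ℝ} :
    α ∈ semibasic (E' := E') P y ↔ α (c.eθ 0 y) = 0 := by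
  refine ⟨fun hα => hα _ (h.tangentMap_eθ hy), fun hα v hv => ?_⟩
  rw [h.eq_smul hy hv, map_smul, hα, smul_zero]

/-- The τ-values of the given vector are copied to the total space, all other components being zero.
Thus characteristic planes map onto characteristic planes. -/
theorem exists_ker (h : IsLift P c c') {y : M} (hy : y ∈ U) {v : E'} (hv : v ∈ c'.ker (P y)) :
    ∃ w ∈ c.ker y, tangentMap E E' P y w = v := by
  refine ⟨c.vec (0, 0, fun k => c'.τ k (P y) v) y, ⟨fun k => ?_, fun k => ?_⟩, ?_⟩
  · simp [c.θ_vec _ hy]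
  · simp [c.σ_vec _ hy]
  · apply c'.eq_of_frame (h.maps y hy) <;> intro k
    · rw [h.θ_apply hy, c.θ_vec _ hy, hv.1]; rfl
    · rw [h.σ_apply hy, c.σ_vec _ hy, hv.2]; rfl
    · rw [h.τ_apply hy, c.τ_vec _ hy]

theorem surjective (h : IsLift P c c') {y : M} (hy : y ∈ U) :
    Function.Surjective (tangentMap E E' P y) := by
  intro v
  refine ⟨c.vec (Fin.cons 0 fun k => c'.θ k (P y) v, fun k => c'.σ k (P y) v,
    fun k => c'.τ k (P y) v) y, ?_⟩
  apply c'.eq_of_frame (h.maps y hy) <;> intro k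
  · rw [h.θ_apply hy, c.θ_vec _ hy]; rfl
  · rw [h.σ_apply hy, c.σ_vec _ hy]
  · rw [h.τ_apply hy, c.τ_vec _ hy]

theorem mem_sing_of_comp (h : IsLift P c c') {y : M} (hy : y ∈ U) {β : E' →L[ℝ] ℝ}
    (hβ : β.comp (tangentMap E E' P y) ∈ c.sing y) : β ∈ c'.sing (P y) := by
  rw [c'.mem_sing (h.maps y hy)]
  intro v hv
  obtain ⟨w, hw, rfl⟩ := h.exists_ker hy hv
  exact (c.mem_sing hy).1 hβ w hw

/-- A covector that kills the fibre direction factors through the surjective tangent map. Composing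
it with a linear right inverse gives the factor. -/
theorem exists_comp (h : IsLift P c c') {y : M} (hy : y ∈ U) {α : E →L[ℝ] ℝ}
    (hα : α (c.eθ 0 y) = 0) : ∃ β : E' →L[ℝ] ℝ, α = β.comp (tangentMap E E' P y) := by
  obtain ⟨r, hr⟩ := (tangentMap E E' P y).toLinearMap.exists_rightInverse_of_surjective
    (LinearMap.range_eq_top.2 (h.surjective hy))
  refine ⟨LinearMap.toContinuousLinearMap (α.toLinearMap ∘ₗ r), ?_⟩
  ext v
  have h1 : tangentMap E E' P y (r (tangentMap E E' P y v)) = tangentMap E E' P y v :=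
    LinearMap.congr_fun hr _
  have h2 := (h.mem_semibasic hy).2 hα (v - r (tangentMap E E' P y v)) (by
    rw [map_sub, h1, sub_self])
  rw [map_sub, sub_eq_zero] at h2
  exact h2

end IsLift

/-- A coframe adapted to a system lifts to a coframe adapted to an integrable extension with
1-dimensional fibres. -/
theorem exists_lift {f : M → M'} {𝓔 : ExtDiffSystem E M}
    {𝓘 : ExtDiffSystem E' M'} (h : IsIntegrableExtension f 𝓔 𝓘)
    (hdim : Module.finrank ℝ E = Module.finrank ℝ E' + 1) {U : Set M'} (hU : IsOpen U)
    (c : Coframe (E := E') s U) (hc : c.IsAdapted 𝓘.ideal) {x : M} (hxU : f x ∈ U) :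
    ∃ V : Set M, IsOpen V ∧ x ∈ V ∧
      ∃ c' : Coframe (E := E) (s + 1) V, c'.IsAdapted 𝓔.ideal ∧ IsLift f c' c := by
  obtain ⟨hf, hsurj, J, hJ, hcompl, hgen⟩ := h
  obtain ⟨V, hV, hxV, r, ξ, hξ, hξJ⟩ := hJ x
  have hker : ∀ y, Module.finrank ℝ (LinearMap.ker (tangentMap E E' f y).toLinearMap) = 1 := by
    intro y
    have h1 := LinearMap.finrank_range_add_finrank_ker (tangentMap E E' f y).toLinearMap
    rw [LinearMap.range_eq_top.2 (hsurj y), finrank_top] at h1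
    omega
  -- The annihilator of J is a complement of the 1-dimensional fibre direction, so J is a line
  -- bundle. Its local generator ξ⁰ becomes the additional form of the coframe.
  have hr : r = 1 := by
    obtain ⟨h1, h2⟩ := hξJ x hxV
    have h3 := finrank_span_eq_card h1
    rw [h2, finrank_eq_one (hker x) (hcompl x), Fintype.card_fin] at h3
    exact h3.symm
  subst hr
  have hJspan : ∀ y ∈ V, J y = Submodule.span ℝ {ξ 0 y} := by
    intro y hy
    rw [← (hξJ y hy).2]
    congr 1
    ext α
    simp [Fin.exists_fin_one, eq_comm]
  have hpull : ∀ {α : M' → E' →L[ℝ] ℝ}, SmoothCovectorOn α U →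
      SmoothCovectorOn (fun y => (α (f y)).comp (tangentMap E E' f y)) (V ∩ f ⁻¹' U) :=
    fun hα => (hα.pullback hf hU).mono Set.inter_subset_right
  let c' : Coframe (E := E) (s + 1) (V ∩ f ⁻¹' U) :=
    { θ := Fin.cons (ξ 0) fun k y => (c.θ k (f y)).comp (tangentMap E E' f y)
      σ := fun k y => (c.σ k (f y)).comp (tangentMap E E' f y)
      τ := fun k y => (c.τ k (f y)).comp (tangentMap E E' f y)
      smooth_θ := by
        refine Fin.cases ?_ fun k => ?_
        · exact (hξ 0).mono Set.inter_subset_left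
        · exact hpull (c.smooth_θ k)
      smooth_σ := fun k => hpull (c.smooth_σ k)
      smooth_τ := fun k => hpull (c.smooth_τ k)
      bijective := by
        rintro y ⟨hyV, hyU⟩
        have hb := c.bijective (f y) hyU
        have hdim' : Module.finrank ℝ E' = s + (2 + 2) := by
          have := (LinearEquiv.ofBijective (c.frame (f y)).toLinearMap hb).finrank_eq
          simpa using this
        have hinj : Function.Injective (frameMap
            (fun k => (Fin.cons (ξ 0) fun k y => (c.θ k (f y)).comp (tangentMap E E' f y) :
              Fin (s + 1) → M → E →L[ℝ] ℝ) k y)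
            (fun k => (c.σ k (f y)).comp (tangentMap E E' f y))
            (fun k => (c.τ k (f y)).comp (tangentMap E E' f y))) := by
          rw [injective_iff_map_eq_zero]
          intro v hv
          have h1 := congrArg Prod.fst hv
          have h2 := congrArg (fun w => w.2.1) hv
          have h3 := congrArg (fun w => w.2.2) hv
          simp only [frameMap_apply, funext_iff] at h1 h2 h3
          -- A vector killed by all pulled-back forms is tangent to the fibre. If ξ⁰ kills it as
          -- well, it lies in ann J, which meets the fibre direction only in zero.
          have hk : tangentMap E E' f y v = 0 := by
            apply hb.1
            rw [map_zero]
            exact Prod.ext (funext fun k => h1 k.succ) (Prod.ext (funext h2) (funext h3))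
          refine Submodule.disjoint_def.1 (hcompl y).disjoint v ?_ hk
          intro α hα
          rw [hJspan y hyV, Submodule.mem_span_singleton] at hα
          obtain ⟨a, rfl⟩ := hα
          have h0 : ξ 0 y v = 0 := h1 0
          simp [h0]
        refine ⟨hinj, ?_⟩
        refine (LinearMap.injective_iff_surjective_of_finrank_eq_finrank
          (f := ContinuousLinearMap.toLinearMap _) ?_).1 hinj
        simp [hdim, hdim'] }
  refine ⟨V ∩ f ⁻¹' U, hV.inter (hU.preimage hf.continuous), ⟨hxV, hxU⟩, c', ?_,
    fun y hy => hy.2, fun _ _ _ => rfl, fun _ _ _ => rfl, fun _ _ _ => rfl⟩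
  rintro y ⟨hyV, hyU⟩
  rw [hgen y]
  apply FormIdeal.span_eq_of
  · rintro g (⟨α, hα, rfl⟩ | ⟨p, γ, hγ, rfl⟩)
    · rw [hJspan y hyV, Submodule.mem_span_singleton] at hα
      obtain ⟨a, rfl⟩ := hα
      exact Submodule.smul_mem _ a (FormIdeal.subset_span (G := c'.generators y)
        (g := ⟨1, oneForm (ξ 0 y)⟩) (Or.inl ⟨0, rfl⟩))
    · rw [hc (f y) hyU] at hγ
      -- The forms whose pullback lies in a given ideal form an ideal themselves, so only the
      -- generators need checking.
      refine FormIdeal.mem_span.1 hγ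
        (FormIdeal.comap (tangentMap E E' f y) (FormIdeal.span (c'.generators y))) ?_
      rintro g (⟨k, rfl⟩ | rfl | rfl)
      · exact FormIdeal.subset_span (G := c'.generators y) (Or.inl ⟨k.succ, rfl⟩)
      · change ContinuousAlternatingMap.compContinuousLinearMap
          (wedge₂ (c.σ 0 (f y)) (c.σ 1 (f y))) (tangentMap E E' f y) ∈
            (FormIdeal.span (c'.generators y)).carrier 2
        rw [wedge₂_comp]
        exact FormIdeal.subset_span (G := c'.generators y) (Or.inr (Or.inl rfl))
      · change ContinuousAlternatingMap.compContinuousLinearMap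
          (wedge₂ (c.τ 0 (f y)) (c.τ 1 (f y))) (tangentMap E E' f y) ∈
            (FormIdeal.span (c'.generators y)).carrier 2
        rw [wedge₂_comp]
        exact FormIdeal.subset_span (G := c'.generators y) (Or.inr (Or.inr rfl))
  · have hI : ∀ g ∈ c.generators (f y), g.2 ∈ (𝓘.ideal (f y)).carrier g.1 := fun g hg => by
      rw [hc (f y) hyU]; exact FormIdeal.subset_span hg
    rintro g (⟨k, rfl⟩ | rfl | rfl)
    · revert k
      refine Fin.cases ?_ fun k => ?_
      · exact FormIdeal.subset_span (Or.inl ⟨ξ 0 y, by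
          rw [hJspan y hyV]; exact Submodule.mem_span_singleton_self _, rfl⟩)
      · exact FormIdeal.subset_span (Or.inr ⟨1, oneForm (c.θ k (f y)), hI _ (Or.inl ⟨k, rfl⟩), rfl⟩)
    · exact FormIdeal.subset_span (Or.inr ⟨2, _, hI _ (Or.inr (Or.inl rfl)), by
        rw [wedge₂_comp]⟩)
    · exact FormIdeal.subset_span (Or.inr ⟨2, _, hI _ (Or.inr (Or.inr rfl)), by
        rw [wedge₂_comp]⟩)

end Coframe

end Descent
end EDS

namespace EDS

/-! ### The adapted coframe of the prolongation and its structure equations. -/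

section ProlongedCoframe

variable {E : Type*} [NormedAddCommGroup E] [NormedSpace ℝ E] [FiniteDimensional ℝ E]
  {M : Type*} [TopologicalSpace M] [ChartedSpace E M] [IsManifold 𝓘(ℝ, E) ∞ M] {s : ℕ}
  {H : HyperbolicSystem E M s}

/-- The bilinear map underlying the exterior derivative of a covector field. -/
theorem extDeriv₁_eq_bilin (α : M → E →L[ℝ] ℝ) (x : M) (v w : E) :
    extDeriv₁ α x v w = Form.bilin (E := E) (extDerivAt (fun y => oneForm (α y)) x) v w := rfl

namespace ProlongationChart

variable (d : ProlongationChart H)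

/-- The chart as an open partial homeomorphism. -/
def openChart : OpenPartialHomeomorph (Prolongation H) (E × ℝ × ℝ) :=
  (prolongationCore H).openPartialHomeomorph d.chart ⟨d, rfl⟩

theorem openChart_mem : d.openChart ∈ IsManifold.maximalAtlas 𝓘(ℝ, E × ℝ × ℝ) ∞ (Prolongation H) := by
  refine IsManifold.subset_maximalAtlas ?_
  simp only [atlas, ChartedSpace.atlas, Set.mem_iUnion,
    Set.mem_singleton_iff]
  exact ⟨d.chart, ⟨d, rfl⟩, rfl⟩

theorem isOpen_source : IsOpen d.chart.source := d.openChart.open_source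

theorem isOpen_target : IsOpen d.chart.target := d.openChart.open_target

theorem center_mem : d.center ∈ d.chart.source :=
  ⟨mem_extChartAt_source _, d.mem, d.ne_i, d.ne_j⟩

theorem contMDiffOn_chart :
    ContMDiffOn 𝓘(ℝ, E × ℝ × ℝ) 𝓘(ℝ, E × ℝ × ℝ) ∞ d.chart d.chart.source :=
  contMDiffOn_of_mem_maximalAtlas d.openChart_mem

theorem contMDiffOn_chart_symm :
    ContMDiffOn 𝓘(ℝ, E × ℝ × ℝ) 𝓘(ℝ, E × ℝ × ℝ) ∞ d.chart.symm d.chart.target :=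
  contMDiffOn_symm_of_mem_maximalAtlas d.openChart_mem

/-- The first slope, as a function on the prolongation space. -/
def slopeFun (e : Prolongation H) : ℝ := (d.slopes e).1

/-- The data with the roles of `σ` and `τ` interchanged. -/
def swap : ProlongationChart H where
  center := d.center
  U := d.U
  isOpen := d.isOpen
  mem := d.mem
  coframe := d.coframe.swap
  adapted := d.adapted.swap
  i := d.j
  j := d.i
  ne_i := d.ne_j
  ne_j := d.ne_i

theorem swap_source : d.swap.chart.source = d.chart.source := by
  ext e
  exact ⟨fun h => ⟨h.1, h.2.1, h.2.2.2, h.2.2.1⟩, fun h => ⟨h.1, h.2.1, h.2.2.2, h.2.2.1⟩⟩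

theorem contMDiffOn_slopeFun :
    ContMDiffOn 𝓘(ℝ, E × ℝ × ℝ) 𝓘(ℝ, ℝ) ∞ d.slopeFun d.chart.source :=
  ((contDiff_fst.comp contDiff_snd).contMDiff (n := ∞)).comp_contMDiffOn d.contMDiffOn_chart

theorem contMDiffOn_swap_slopeFun :
    ContMDiffOn 𝓘(ℝ, E × ℝ × ℝ) 𝓘(ℝ, ℝ) ∞ d.swap.slopeFun d.chart.source := by
  rw [← swap_source]
  exact d.swap.contMDiffOn_slopeFun

theorem contMDiffOn_proj :
    ContMDiffOn 𝓘(ℝ, E × ℝ × ℝ) 𝓘(ℝ, E) ∞ (Prolongation.proj (H := H)) d.chart.source := by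
  have h1 : ContMDiffOn 𝓘(ℝ, E × ℝ × ℝ) 𝓘(ℝ, E) ∞ (fun e => (d.chart e).1) d.chart.source :=
    (contDiff_fst.contMDiff (n := ∞)).comp_contMDiffOn d.contMDiffOn_chart
  refine ((contMDiffOn_extChartAt_symm (n := ∞) d.center.base).comp h1 fun e he =>
    d.φ.map_source he.1).congr fun e he => ?_
  exact (d.φ.left_inv he.1).symm

end ProlongationChart

theorem Prolongation.contMDiff_proj :
    ContMDiff 𝓘(ℝ, E × ℝ × ℝ) 𝓘(ℝ, E) ∞ (Prolongation.proj (H := H)) := by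
  intro e
  obtain ⟨d, rfl⟩ := ProlongationChart.exists_center e
  exact d.contMDiffOn_proj.contMDiffAt (d.isOpen_source.mem_nhds d.center_mem)

theorem tangentMap_clm_comp {E' F : Type*} [NormedAddCommGroup E'] [NormedSpace ℝ E']
    [NormedAddCommGroup F] [NormedSpace ℝ F] {f : M → E'} {x : M}
    (hf : MDifferentiableAt 𝓘(ℝ, E) 𝓘(ℝ, E') f x) (L : E' →L[ℝ] F) :
    tangentMap E F (L ∘ f) x = L.comp (tangentMap E E' f x) := by
  have := mfderiv_comp x (L.differentiableAt.mdifferentiableAt) hf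
  rw [ContinuousLinearMap.mfderiv_eq] at this
  exact this

/-- The tangent map of the projection. -/
abbrev Prolongation.dproj (e : Prolongation H) : E × ℝ × ℝ →L[ℝ] E :=
  tangentMap (E × ℝ × ℝ) E Prolongation.proj e

namespace ProlongationChart

variable (d : ProlongationChart H)

open Prolongation

/-- The base point and the two slopes are the coordinates of the chart. The second slope is the
first slope of the interchanged data. -/
theorem eq_zero_of_tangent {e : Prolongation H} (he : e ∈ d.chart.source) {v : E × ℝ × ℝ}
    (h1 : dproj e v = 0) (h2 : differential (E × ℝ × ℝ) d.slopeFun e v = 0)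
    (h3 : differential (E × ℝ × ℝ) d.swap.slopeFun e v = 0) : v = 0 := by
  have dc : MDifferentiableAt 𝓘(ℝ, E × ℝ × ℝ) 𝓘(ℝ, E × ℝ × ℝ) d.chart e :=
    ContMDiffOn.mdifferentiableAt' d.isOpen_source d.contMDiffOn_chart he
  have dcs : MDifferentiableAt 𝓘(ℝ, E × ℝ × ℝ) 𝓘(ℝ, E × ℝ × ℝ) d.chart.symm (d.chart e) :=
    ContMDiffOn.mdifferentiableAt' d.isOpen_target d.contMDiffOn_chart_symm
      (d.chart.map_source he)
  have hv : tangentMap (E × ℝ × ℝ) (E × ℝ × ℝ) d.chart e v = 0 := by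
    refine Prod.ext ?_ (Prod.ext ?_ ?_)
    · have c1 := tangentMap_clm_comp dc (ContinuousLinearMap.fst ℝ E (ℝ × ℝ))
      have dφ : MDifferentiableAt 𝓘(ℝ, E) 𝓘(ℝ, E) d.φ (proj e) :=
        ContMDiffOn.mdifferentiableAt' (isOpen_extChartAt_source _)
          (by rw [extChartAt_source]; exact contMDiffOn_extChartAt) he.1
      have c2 := mfderiv_comp e dφ (contMDiff_proj.mdifferentiableAt (by simp))
      refine (DFunLike.congr_fun c1 v).symm.trans ((DFunLike.congr_fun c2 v).trans ?_)
      exact (congrArg (tangentMap E E d.φ (proj e)) h1).trans (map_zero _)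
    · exact (DFunLike.congr_fun (tangentMap_clm_comp dc ((ContinuousLinearMap.fst ℝ ℝ ℝ).comp
        (ContinuousLinearMap.snd ℝ E (ℝ × ℝ)))) v).symm.trans h2
    · exact (DFunLike.congr_fun (tangentMap_clm_comp dc ((ContinuousLinearMap.snd ℝ ℝ ℝ).comp
        (ContinuousLinearMap.snd ℝ E (ℝ × ℝ)))) v).symm.trans h3
  have c1 := mfderiv_comp e dcs dc
  have c2 : mfderiv 𝓘(ℝ, E × ℝ × ℝ) 𝓘(ℝ, E × ℝ × ℝ) (d.chart.symm ∘ d.chart) e =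
      mfderiv 𝓘(ℝ, E × ℝ × ℝ) 𝓘(ℝ, E × ℝ × ℝ) id e := by
    refine Filter.EventuallyEq.mfderiv_eq ?_
    filter_upwards [d.isOpen_source.mem_nhds he] with t ht
    exact d.chart.left_inv ht
  rw [mfderiv_id] at c2
  have c3 := DFunLike.congr_fun (c1.symm.trans c2) v
  refine c3.symm.trans ?_
  exact (congrArg (tangentMap (E × ℝ × ℝ) (E × ℝ × ℝ) d.chart.symm (d.chart e)) hv).trans
    (map_zero _)

/-- The pullback of a covector field to the prolongation space. -/
def pb (α : M → E →L[ℝ] ℝ) (e : Prolongation H) : E × ℝ × ℝ →L[ℝ] ℝ := (α (proj e)).comp (dproj e)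

theorem smooth_pb {α : M → E →L[ℝ] ℝ} (hα : SmoothCovectorOn α d.U) :
    SmoothCovectorOn (pb (H := H) α) d.chart.source :=
  (hα.pullback contMDiff_proj d.isOpen).mono fun _ he => he.2.1

theorem extDeriv₁_pb {α : M → E →L[ℝ] ℝ} (hα : SmoothCovectorOn α d.U) {e : Prolongation H}
    (he : e ∈ d.chart.source) (v w : E × ℝ × ℝ) :
    extDeriv₁ (pb (H := H) α) e v w = extDeriv₁ α e.base (dproj e v) (dproj e w) :=
  extDeriv₁_pullback isOpen_univ contMDiff_proj.contMDiffOn d.isOpen hα trivial he.2.1 v w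

/-- The contact form `σ_{1-i} - a σ_i`. -/
def contactForm (e : Prolongation H) : E × ℝ × ℝ →L[ℝ] ℝ :=
  pb (d.coframe.σ (1 - d.i)) e - d.slopeFun e • pb (d.coframe.σ d.i) e

theorem smooth_contactForm : SmoothCovectorOn d.contactForm d.chart.source :=
  (d.smooth_pb (d.coframe.smooth_σ _)).sub
    (SmoothCovectorOn.smul d.contMDiffOn_slopeFun (d.smooth_pb (d.coframe.smooth_σ _)))

/-- The curvature of the contact forms on an integral element. -/
def curv (e : Prolongation H) : ℝ :=
  extDeriv₁ (d.coframe.σ (1 - d.i)) e.base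
      (d.coframe.eσ d.i e.base + d.slopeFun e • d.coframe.eσ (1 - d.i) e.base)
      (d.coframe.eτ d.j e.base + d.swap.slopeFun e • d.coframe.eτ (1 - d.j) e.base) -
    d.slopeFun e * extDeriv₁ (d.coframe.σ d.i) e.base
      (d.coframe.eσ d.i e.base + d.slopeFun e • d.coframe.eσ (1 - d.i) e.base)
      (d.coframe.eτ d.j e.base + d.swap.slopeFun e • d.coframe.eτ (1 - d.j) e.base)

theorem smooth_curv : ContMDiffOn 𝓘(ℝ, E × ℝ × ℝ) 𝓘(ℝ, ℝ) ∞ d.curv d.chart.source := by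
  have h0 : ∀ k i j, ContMDiffOn 𝓘(ℝ, E × ℝ × ℝ) 𝓘(ℝ, ℝ) ∞ (fun e : Prolongation H =>
      extDeriv₁ (d.coframe.σ k) e.base (d.coframe.eσ i e.base) (d.coframe.eτ j e.base))
      d.chart.source := fun k i j =>
    (contMDiffOn_extDeriv₁ d.isOpen (d.coframe.smooth_σ k) (d.coframe.smooth_vec _)
      (d.coframe.smooth_vec _)).comp contMDiff_proj.contMDiffOn fun e he => he.2.1
  have ha := d.contMDiffOn_slopeFun
  have hb := d.contMDiffOn_swap_slopeFun
  have h1 : ∀ k, ContMDiffOn 𝓘(ℝ, E × ℝ × ℝ) 𝓘(ℝ, ℝ) ∞ (fun e : Prolongation H =>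
      extDeriv₁ (d.coframe.σ k) e.base
        (d.coframe.eσ d.i e.base + d.slopeFun e • d.coframe.eσ (1 - d.i) e.base)
        (d.coframe.eτ d.j e.base + d.swap.slopeFun e • d.coframe.eτ (1 - d.j) e.base))
      d.chart.source := by
    intro k
    refine (((h0 k d.i d.j).add (ha.mul (h0 k (1 - d.i) d.j))).add
      (hb.mul ((h0 k d.i (1 - d.j)).add (ha.mul (h0 k (1 - d.i) (1 - d.j)))))).congr fun e _ => ?_
    simp only [extDeriv₁_eq_bilin, map_add, LinearMap.add_apply, map_smul, LinearMap.smul_apply,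
      smul_eq_mul, Pi.add_apply, Pi.mul_apply]
  exact (h1 _).sub (ha.mul (h1 _))

/-- The form `da + κ τ_j`. -/
def slopeForm (e : Prolongation H) : E × ℝ × ℝ →L[ℝ] ℝ :=
  differential (E × ℝ × ℝ) d.slopeFun e + d.curv e • pb (d.coframe.τ d.j) e

theorem smooth_slopeForm : SmoothCovectorOn d.slopeForm d.chart.source :=
  (smoothCovectorOn_differential d.isOpen_source d.contMDiffOn_slopeFun).add
    (SmoothCovectorOn.smul d.smooth_curv (d.smooth_pb (d.coframe.smooth_τ _)))

theorem mem_plane_iff {e : Prolongation H} (he : e ∈ d.chart.source) {v : E × ℝ × ℝ} :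
    dproj e v ∈ e.plane ↔ (∀ k, pb (d.coframe.θ k) e v = 0) ∧ d.contactForm e v = 0 ∧
      d.swap.contactForm e v = 0 := by
  rw [← d.plane_eq he.2.1 he.2.2.1 he.2.2.2, planeAt, mem_slopePlane, ← sub_eq_zero,
    ← sub_eq_zero (a := (d.coframe.τ (1 - d.j) e.base) _)]
  rfl

/-- The structure equation dπ ≡ σ_i ∧ (da + κ τ_j) modulo the contact forms, where π = σ_{1-i} − a
σ_i. The term −da ∧ σ_i comes from the Leibniz rule. The rest, dσ_{1-i} − a dσ_i, restricts to the
2-plane as a multiple κ of σ_i ∧ τ_j. -/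
theorem extDeriv₁_contactForm {e : Prolongation H} (he : e ∈ d.chart.source) {v w : E × ℝ × ℝ}
    (hv : dproj e v ∈ e.plane) (hw : dproj e w ∈ e.plane) :
    extDeriv₁ d.contactForm e v w =
      pb (d.coframe.σ d.i) e v * d.slopeForm e w - pb (d.coframe.σ d.i) e w * d.slopeForm e v := by
  -- The 2-plane has the basis X_σ, X_τ dual to σ_i, τ_j, whose other components are dictated by the
  -- slopes.
  have key : ∀ v, dproj e v ∈ e.plane → dproj e v =
      pb (d.coframe.σ d.i) e v •
        (d.coframe.eσ d.i e.base + d.slopeFun e • d.coframe.eσ (1 - d.i) e.base) +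
      pb (d.coframe.τ d.j) e v •
        (d.coframe.eτ d.j e.base + d.swap.slopeFun e • d.coframe.eτ (1 - d.j) e.base) := by
    intro v hv
    rw [← d.plane_eq he.2.1 he.2.2.1 he.2.2.2] at hv
    obtain ⟨h1, h2, h3⟩ := mem_slopePlane.1 hv
    have hU : e.base ∈ d.U := he.2.1
    have hsum : ∀ (i : Fin 2) (f : Fin 2 → E), ∑ k, f k = f i + f (1 - i) := by
      intro i f
      rw [Fin.sum_univ_two]
      fin_cases i
      · rfl
      · exact add_comm _ _
    have hq := d.coframe.eq_sum hU (dproj e v)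
    rw [hsum d.i, hsum d.j] at hq
    simp only [h1, h2, h3, zero_smul, Finset.sum_const_zero, zero_add] at hq
    have e1 : d.slopeFun e = (d.slopes e).1 := rfl
    have e2 : d.swap.slopeFun e = (d.slopes e).2 := rfl
    rw [hq, e1, e2]
    simp only [pb, ContinuousLinearMap.comp_apply, smul_add, smul_smul, mul_comm, proj]
  unfold contactForm
  rw [extDeriv₁_sub_smul d.isOpen_source (d.smooth_pb (d.coframe.smooth_σ _))
    (d.smooth_pb (d.coframe.smooth_σ _)) d.contMDiffOn_slopeFun he,
    d.extDeriv₁_pb (d.coframe.smooth_σ _) he, d.extDeriv₁_pb (d.coframe.smooth_σ _) he]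
  have hself : ∀ (α : M → E →L[ℝ] ℝ) x v, extDeriv₁ α x v v = 0 := fun α x v => by
    have := Form.bilin_swap (E := E) (extDerivAt (fun y => oneForm (α y)) x) v v
    rw [extDeriv₁_eq_bilin]; linarith
  have hswap : ∀ (α : M → E →L[ℝ] ℝ) x v w, extDeriv₁ α x v w = -extDeriv₁ α x w v :=
    fun α x v w => Form.bilin_swap (E := E) (extDerivAt (fun y => oneForm (α y)) x) v w
  set Xσ := d.coframe.eσ d.i e.base + d.slopeFun e • d.coframe.eσ (1 - d.i) e.base with hXσ
  set Xτ := d.coframe.eτ d.j e.base + d.swap.slopeFun e • d.coframe.eτ (1 - d.j) e.base with hXτ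
  have hexp : ∀ α : M → E →L[ℝ] ℝ, extDeriv₁ α e.base (dproj e v) (dproj e w) =
      (pb (d.coframe.σ d.i) e v * pb (d.coframe.τ d.j) e w -
        pb (d.coframe.σ d.i) e w * pb (d.coframe.τ d.j) e v) * extDeriv₁ α e.base Xσ Xτ := by
    intro α
    have z1 := hself α e.base Xσ
    have z2 := hself α e.base Xτ
    have z3 := hswap α e.base Xτ Xσ
    rw [key v hv, key w hw]
    simp only [extDeriv₁_eq_bilin] at z1 z2 z3 ⊢
    simp only [map_add, LinearMap.add_apply, map_smul, LinearMap.smul_apply, smul_eq_mul,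
      z1, z2, z3]
    ring
  have hκ : d.curv e = extDeriv₁ (d.coframe.σ (1 - d.i)) e.base Xσ Xτ -
    d.slopeFun e * extDeriv₁ (d.coframe.σ d.i) e.base Xσ Xτ := rfl
  rw [hexp, hexp]
  simp only [slopeForm, add_apply, smul_apply, smul_eq_mul, hκ]
  ring

/-- The coframe of the prolongation space defined by an adapted coframe. -/
def prol : Coframe (E := E × ℝ × ℝ) (s + 2) d.chart.source where
  θ := Fin.append (fun k => pb (d.coframe.θ k)) ![d.contactForm, d.swap.contactForm]
  σ := ![pb (d.coframe.σ d.i), d.slopeForm]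
  τ := ![pb (d.coframe.τ d.j), d.swap.slopeForm]
  smooth_θ := by
    refine Fin.addCases (fun k => ?_) (fun k => ?_)
    · rw [Fin.append_left]; exact d.smooth_pb (d.coframe.smooth_θ k)
    · rw [Fin.append_right]
      revert k
      refine Fin.forall_fin_two.2 ⟨d.smooth_contactForm, ?_⟩
      rw [← d.swap_source]
      exact d.swap.smooth_contactForm
  smooth_σ := Fin.forall_fin_two.2 ⟨d.smooth_pb (d.coframe.smooth_σ _), d.smooth_slopeForm⟩
  smooth_τ := Fin.forall_fin_two.2 ⟨d.smooth_pb (d.coframe.smooth_τ _), by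
    rw [← d.swap_source]
    exact d.swap.smooth_slopeForm⟩
  bijective := by
    intro e he
    have hdim : Module.finrank ℝ E = s + (2 + 2) := by
      have := (LinearEquiv.ofBijective (d.coframe.frame e.base).toLinearMap
        (d.coframe.bijective _ he.2.1)).finrank_eq
      simpa using this
    have hinj : Function.Injective (frameMap (fun k => (Fin.append (fun k => pb (d.coframe.θ k))
        ![d.contactForm, d.swap.contactForm] : Fin (s + 2) → Prolongation H → _) k e)
        (fun k => (![pb (d.coframe.σ d.i), d.slopeForm] : Fin 2 → Prolongation H → _) k e)
        (fun k => (![pb (d.coframe.τ d.j), d.swap.slopeForm] : Fin 2 → Prolongation H → _) k e)) := by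
      rw [injective_iff_map_eq_zero]
      intro v hv
      have h1 := congrArg Prod.fst hv
      have h2 := congrArg (fun w => w.2.1) hv
      have h3 := congrArg (fun w => w.2.2) hv
      simp only [frameMap_apply, funext_iff] at h1 h2 h3
      have hθ : ∀ k, d.coframe.θ k e.base (dproj e v) = 0 := fun k => by
        have := h1 (Fin.castAdd 2 k)
        rw [Fin.append_left] at this
        exact this
      have hπ : d.contactForm e v = 0 := by
        have := h1 (Fin.natAdd s 0)
        rw [Fin.append_right] at this
        exact this
      have hπ' : d.swap.contactForm e v = 0 := by
        have := h1 (Fin.natAdd s 1)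
        rw [Fin.append_right] at this
        exact this
      have hσ : d.coframe.σ d.i e.base (dproj e v) = 0 := h2 0
      have hτ : d.coframe.τ d.j e.base (dproj e v) = 0 := h3 0
      have hp : e.plane = d.planeAt e.base (d.slopes e).1 (d.slopes e).2 :=
        (d.plane_eq he.2.1 he.2.2.1 he.2.2.2).symm
      have hmem := (d.mem_plane_iff he).2 ⟨hθ, hπ, hπ'⟩
      rw [hp] at hmem
      obtain ⟨-, k2, k3⟩ := mem_slopePlane.1 hmem
      rw [hσ, mul_zero] at k2
      rw [hτ, mul_zero] at k3
      have hz : dproj e v = 0 := by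
        apply (d.coframe.bijective _ he.2.1).1
        rw [map_zero]
        exact Prod.ext (funext hθ) (Prod.ext (fin2_fun_ext d.i hσ k2) (fin2_fun_ext d.j hτ k3))
      have h2' : d.slopeForm e v = 0 := h2 1
      have h3' : d.swap.slopeForm e v = 0 := h3 1
      -- On vertical vectors the κ-terms vanish and the two slope forms reduce to da and db.
      refine d.eq_zero_of_tangent he hz ?_ ?_
      · simpa [slopeForm, pb, hz] using h2'
      · simpa [slopeForm, pb, hz] using h3'
    refine ⟨hinj, ?_⟩
    refine (LinearMap.injective_iff_surjective_of_finrank_eq_finrank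
      (f := ContinuousLinearMap.toLinearMap _) ?_).1 hinj
    simp [hdim]

theorem prol_θ_left (k : Fin s) : d.prol.θ (Fin.castAdd 2 k) = pb (d.coframe.θ k) :=
  Fin.append_left (fun k => pb (d.coframe.θ k)) ![d.contactForm, d.swap.contactForm] k

theorem prol_θ_right (k : Fin 2) :
    d.prol.θ (Fin.natAdd s k) = ![d.contactForm, d.swap.contactForm] k :=
  Fin.append_right (fun k => pb (d.coframe.θ k)) ![d.contactForm, d.swap.contactForm] k

theorem prol_θ_forall {e : Prolongation H} {p : (E × ℝ × ℝ →L[ℝ] ℝ) → Prop} :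
    (∀ k, p (d.prol.θ k e)) ↔ (∀ k, p (pb (d.coframe.θ k) e)) ∧ p (d.contactForm e) ∧
      p (d.swap.contactForm e) := by
  have hl := d.prol_θ_left
  have hr := d.prol_θ_right
  constructor
  · intro h
    refine ⟨fun k => ?_, ?_, ?_⟩
    · rw [← hl]; exact h _
    · have := h (Fin.natAdd s 0)
      rwa [hr] at this
    · have := h (Fin.natAdd s 1)
      rwa [hr] at this
  · rintro ⟨h1, h2, h3⟩
    refine Fin.addCases (fun k => ?_) (fun k => ?_)
    · rw [hl]; exact h1 k
    · rw [hr]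
      revert k
      exact Fin.forall_fin_two.2 ⟨h2, h3⟩

theorem prol_θ_iff {e : Prolongation H} (he : e ∈ d.chart.source) {v : E × ℝ × ℝ} :
    (∀ k, d.prol.θ k e v = 0) ↔ dproj e v ∈ e.plane := by
  rw [d.mem_plane_iff he]
  exact d.prol_θ_forall (p := fun α => α v = 0)

theorem prol_θ_mem {e : Prolongation H} (he : e ∈ d.chart.source) (k) :
    d.prol.θ k e ∈ contactSystem H e := by
  have hp := d.plane_eq he.2.1 he.2.2.1 he.2.2.2
  have hmem : ∀ v ∈ e.plane, _ := fun v hv => mem_slopePlane.1 (hp.symm ▸ hv :)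
  revert k
  refine d.prol_θ_forall.2 ⟨fun k => ?_, ?_, ?_⟩
  · exact Submodule.subset_span ⟨_, fun v hv => (hmem v hv).1 k, rfl⟩
  · refine Submodule.subset_span ⟨d.coframe.σ (1 - d.i) e.base -
      d.slopeFun e • d.coframe.σ d.i e.base, fun v hv => ?_, rfl⟩
    exact sub_eq_zero.2 (hmem v hv).2.1
  · refine Submodule.subset_span ⟨d.coframe.τ (1 - d.j) e.base -
      d.swap.slopeFun e • d.coframe.τ d.j e.base, fun v hv => ?_, rfl⟩
    exact sub_eq_zero.2 (hmem v hv).2.2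

theorem contactSystem_apply {e : Prolongation H} {α : E × ℝ × ℝ →L[ℝ] ℝ}
    (hα : α ∈ contactSystem H e) {v : E × ℝ × ℝ} (hv : dproj e v ∈ e.plane) : α v = 0 := by
  induction hα using Submodule.span_induction with
  | mem α h =>
    obtain ⟨β, hβ, rfl⟩ := h
    exact hβ _ hv
  | zero => rfl
  | add α β _ _ h h' => simp [h, h']
  | smul a α _ h => simp [h]

/-- The 1-forms agree because both spaces consist of the covectors pulled back from the annihilator
of the plane. In degree 2 the generators σ_i ∧ (da + κ τ_j), and the same with σ and τ interchanged,
are the exterior derivatives of the two new contact forms modulo θ. The derivatives of the old θ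
contribute nothing modulo θ. -/
theorem prol_adapted : d.prol.IsAdapted (prolongedIdeal H) := by
  intro e he
  have hexp : ∀ e ∈ d.chart.source, ∀ α ∈ contactSystem H e,
      α = ∑ k, α (d.prol.eθ k e) • d.prol.θ k e := by
    intro e he α hα
    have h1 := d.prol.expand_of_ker he (α := α) fun v hv =>
      contactSystem_apply hα ((d.prol_θ_iff he).1 hv.1)
    have h2 : ∀ k, α (d.prol.eσ k e) = 0 := fun k =>
      contactSystem_apply hα ((d.prol_θ_iff he).1 (d.prol.eσ_mem he k).1)
    simpa [h2] using h1
  have hθmem : ∀ k, oneForm (d.prol.θ k e) ∈ (FormIdeal.span (d.prol.generators e)).carrier 1 :=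
    fun k => FormIdeal.subset_span (g := ⟨1, oneForm (d.prol.θ k e)⟩) (Or.inl ⟨k, rfl⟩)
  have hpfθ : ∀ k, oneForm (d.prol.θ k e) ∈ (prolongedIdeal H e).carrier 1 := fun k =>
    FormIdeal.subset_span (g := ⟨1, oneForm (d.prol.θ k e)⟩) (Or.inl ⟨_, d.prol_θ_mem he k, rfl⟩)
  -- The original system is differentially closed, so dθ is one of its forms and vanishes on the
  -- integral element.
  have hcl : ∀ k v w, dproj e v ∈ e.plane → dproj e w ∈ e.plane →
      extDeriv₁ (pb (d.coframe.θ k)) e v w = 0 := by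
    intro k v w hv hw
    rw [d.extDeriv₁_pb (d.coframe.smooth_θ k) he]
    refine e.vanish 2 _ (H.closed 1 d.U d.isOpen _ (d.coframe.smooth_θ k) (fun y hy => ?_) _
      he.2.1) _ (Fin.forall_fin_two.2 ⟨hv, hw⟩)
    rw [d.adapted y hy]
    exact FormIdeal.subset_span (g := ⟨1, oneForm (d.coframe.θ k y)⟩) (Or.inl ⟨k, rfl⟩)
  have he' : e ∈ d.swap.chart.source := by rw [d.swap_source]; exact he
  change FormIdeal.span _ = _
  apply FormIdeal.span_eq_of
  · rintro g (⟨α, hα, rfl⟩ | ⟨V, ϑ, hV, heV, hϑ, hϑC, rfl⟩)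
    · have h1 : oneForm α = ∑ k, α (d.prol.eθ k e) • oneForm (d.prol.θ k e) := by
        ext v
        rw [oneForm_apply]
        conv_lhs => rw [hexp e he α hα]
        simp [ContinuousAlternatingMap.sum_apply]
      change oneForm α ∈ _
      rw [h1]
      exact Submodule.sum_mem _ fun k _ => Submodule.smul_mem _ _ (hθmem k)
    -- It suffices to test pairs with one vector in each characteristic plane. A section of the
    -- contact system is a combination of the frame forms with smooth coefficients, so only the
    -- derivatives of the frame forms enter.
    · refine d.prol.two_form_mem he fun v hv w hw => ?_
      have hpv := (d.prol_θ_iff he).1 hv.1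
      have hpw := (d.prol_θ_iff he).1 hw.1
      have hO := hV.inter d.isOpen_source
      change extDeriv₁ ϑ e v w = 0
      rw [extDeriv₁_sum_of_vanish hO
        (fun k => (d.prol.smooth_θ k).mono Set.inter_subset_right)
        (h := fun k y => ϑ y (d.prol.eθ k y)) (fun k =>
          (hϑ.mono Set.inter_subset_left).apply fun x₀ =>
            ((d.prol.smooth_vec _) x₀).mono fun z hz => ⟨hz.1, hz.2.2⟩)
        (fun y hy => hexp y hy.2 _ (hϑC y hy.1)) ⟨heV, he⟩ hv.1 hw.1]
      suffices hz : ∀ k, extDeriv₁ (d.prol.θ k) e v w = 0 from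
        Finset.sum_eq_zero fun k _ => mul_eq_zero_of_right _ (hz k)
      have z1 : pb (d.coframe.σ d.i) e v = 0 := hv.2 0
      have z2 : d.slopeForm e v = 0 := hv.2 1
      have z3 : pb (d.coframe.τ d.j) e w = 0 := hw.2 0
      have z4 : d.swap.slopeForm e w = 0 := hw.2 1
      refine Fin.addCases (fun k => ?_) (fun k => ?_)
      · rw [d.prol_θ_left]; exact hcl k v w hpv hpw
      · rw [d.prol_θ_right]
        revert k
        refine Fin.forall_fin_two.2 ⟨?_, ?_⟩
        · change extDeriv₁ d.contactForm e v w = 0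
          rw [d.extDeriv₁_contactForm he hpv hpw, z1, z2]
          ring
        · change extDeriv₁ d.swap.contactForm e v w = 0
          rw [d.swap.extDeriv₁_contactForm he' hpv hpw, z4,
            show pb (d.swap.coframe.σ d.swap.i) e w = 0 from z3]
          ring
  · have two : ∀ (d' : ProlongationChart H), e ∈ d'.chart.source →
        (∀ k, oneForm (d'.prol.θ k e) ∈ (prolongedIdeal H e).carrier 1) →
        wedge₂ (d'.prol.σ 0 e) (d'.prol.σ 1 e) ∈ (prolongedIdeal H e).carrier 2 := by
      intro d' he hpf
      have h1 : extDerivAt (fun y => oneForm (d'.contactForm y)) e ∈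
          (prolongedIdeal H e).carrier 2 :=
        FormIdeal.subset_span
          (g := ⟨2, extDerivAt (fun y => oneForm (d'.contactForm y)) e⟩)
          (Or.inr ⟨d'.chart.source, d'.contactForm, d'.isOpen_source, he, d'.smooth_contactForm,
            fun y hy => (d'.prol_θ_forall.1 (d'.prol_θ_mem hy)).2.1, rfl⟩)
      -- By the structure equation this difference vanishes on {θ = 0}, so it is generated by the θ.
      have h2 : wedge₂ (d'.prol.σ 0 e) (d'.prol.σ 1 e) -
          (extDerivAt (fun y => oneForm (d'.contactForm y)) e : Form (E × ℝ × ℝ) 2) ∈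
            (prolongedIdeal H e).carrier 2 := by
        refine FormIdeal.mem_of_vanish (θ := fun k => d'.prol.θ k e)
          (e := fun k => d'.prol.eθ k e)
          (fun k l => by simp [Coframe.eθ, d'.prol.θ_vec _ he, Pi.single_apply]) _ hpf ?_
        intro v w hv hw
        have h3 := d'.extDeriv₁_contactForm he ((d'.prol_θ_iff he).1 hv)
          ((d'.prol_θ_iff he).1 hw)
        have h4 := wedge₂_bilin (d'.prol.σ 0 e) (d'.prol.σ 1 e) v w
        change wedge₂ (d'.prol.σ 0 e) (d'.prol.σ 1 e) ![v, w] - extDeriv₁ d'.contactForm e v w = 0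
        rw [← Form.bilin_apply, h4, h3]
        exact sub_self _
      simpa using Submodule.add_mem _ h2 h1
    rintro g (⟨k, rfl⟩ | rfl | rfl)
    · exact hpfθ k
    · exact two d he hpfθ
    · refine two d.swap he' fun k => ?_
      exact FormIdeal.subset_span (g := ⟨1, oneForm (d.swap.prol.θ k e)⟩)
        (Or.inl ⟨_, d.swap.prol_θ_mem he' k, rfl⟩)

/-- The second singular system of the prolonged coframe is the first one of the prolongation of the
interchanged coframe. -/
theorem prol_swap_ker {e : Prolongation H} (he : e ∈ d.chart.source) :
    d.prol.swap.ker e = d.swap.prol.ker e := by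
  have he' : e ∈ d.swap.chart.source := by rw [d.swap_source]; exact he
  ext v
  have h1 : (∀ k, d.prol.swap.θ k e v = 0) ↔ dproj e v ∈ e.plane := d.prol_θ_iff he
  have h2 := d.swap.prol_θ_iff he' (v := v)
  have h3 : ∀ k, d.prol.swap.σ k e = d.swap.prol.σ k e := fun k => rfl
  rw [Coframe.mem_ker, Coframe.mem_ker, h1, h2]
  simp only [h3]

end ProlongationChart

end ProlongedCoframe
end EDS

namespace EDS

namespace Coframe

variable {E : Type*} [NormedAddCommGroup E] [NormedSpace ℝ E]
  {M : Type*} [TopologicalSpace M] [ChartedSpace E M] {s : ℕ} {U V : Set M}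

/-- The restriction of a coframe to a smaller set. -/
def restrict (c : Coframe (E := E) s U) (h : V ⊆ U) : Coframe (E := E) s V where
  θ := c.θ
  σ := c.σ
  τ := c.τ
  smooth_θ k x₀ := (c.smooth_θ k x₀).mono fun _ hz => ⟨hz.1, h hz.2⟩
  smooth_σ k x₀ := (c.smooth_σ k x₀).mono fun _ hz => ⟨hz.1, h hz.2⟩
  smooth_τ k x₀ := (c.smooth_τ k x₀).mono fun _ hz => ⟨hz.1, h hz.2⟩
  bijective y hy := c.bijective y (h hy)

theorem IsAdapted.restrict {c : Coframe (E := E) s U} {I : M → FormIdeal E} (hc : c.IsAdapted I)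
    (h : V ⊆ U) : (c.restrict h).IsAdapted I := fun y hy => hc y (h hy)

end Coframe

/-! ### The prolonged map of an integrable extension in compatible charts. -/

section ProlongedMap

variable {E : Type*} [NormedAddCommGroup E] [NormedSpace ℝ E] [FiniteDimensional ℝ E]
  {E' : Type*} [NormedAddCommGroup E'] [NormedSpace ℝ E'] [FiniteDimensional ℝ E']
  {M : Type*} [TopologicalSpace M] [ChartedSpace E M] [IsManifold 𝓘(ℝ, E) ∞ M]
  {M' : Type*} [TopologicalSpace M'] [ChartedSpace E' M'] [IsManifold 𝓘(ℝ, E') ∞ M'] {s : ℕ}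

theorem Coframe.IsLift.restrict {f : M → M'} {U V : Set M} {U' : Set M'}
    {c : Coframe (E := E) (s + 1) U} {c' : Coframe (E := E') s U'} (hl : c.IsLift f c')
    (h : V ⊆ U) : (c.restrict h).IsLift f c' :=
  ⟨fun y hy => hl.maps y (h hy), fun y hy => hl.θ y (h hy), fun y hy => hl.σ y (h hy),
    fun y hy => hl.τ y (h hy)⟩

theorem Coframe.IsLift.map_eσ {f : M → M'} {U : Set M} {U' : Set M'}
    {c : Coframe (E := E) (s + 1) U} {c' : Coframe (E := E') s U'} (hl : c.IsLift f c')
    {y : M} (hy : y ∈ U) (k : Fin 2) : tangentMap E E' f y (c.eσ k y) = c'.eσ k (f y) := by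
  have hy' := hl.maps y hy
  apply c'.eq_of_frame hy' <;> intro l
  · rw [hl.θ_apply hy]; simp [Coframe.eσ, c.θ_vec _ hy, c'.θ_vec _ hy']
  · rw [hl.σ_apply hy]; simp [Coframe.eσ, c.σ_vec _ hy, c'.σ_vec _ hy']
  · rw [hl.τ_apply hy]; simp [Coframe.eσ, c.τ_vec _ hy, c'.τ_vec _ hy']

theorem Coframe.IsLift.map_eτ {f : M → M'} {U : Set M} {U' : Set M'}
    {c : Coframe (E := E) (s + 1) U} {c' : Coframe (E := E') s U'} (hl : c.IsLift f c')
    {y : M} (hy : y ∈ U) (k : Fin 2) : tangentMap E E' f y (c.eτ k y) = c'.eτ k (f y) := by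
  have hy' := hl.maps y hy
  apply c'.eq_of_frame hy' <;> intro l
  · rw [hl.θ_apply hy]; simp [Coframe.eτ, c.θ_vec _ hy, c'.θ_vec _ hy']
  · rw [hl.σ_apply hy]; simp [Coframe.eτ, c.σ_vec _ hy, c'.σ_vec _ hy']
  · rw [hl.τ_apply hy]; simp [Coframe.eτ, c.τ_vec _ hy, c'.τ_vec _ hy']

theorem exists_indices {H : HyperbolicSystem E M s} {U : Set M} (c : Coframe (E := E) s U)
    (hc : c.IsAdapted H.ideal) (e : Prolongation H) (he : e.base ∈ U) :
    ∃ i j, (∃ v ∈ e.plane, c.σ i e.base v ≠ 0) ∧ ∃ v ∈ e.plane, c.τ j e.base v ≠ 0 := by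
  obtain ⟨h1, h2, h3⟩ := hc.vanish e he
  obtain ⟨i, hi⟩ := exists_ne_zero (c.bijective _ he) e.finrank_plane h1 h3
  obtain ⟨j, hj⟩ := exists_ne_zero (c.swap.bijective _ he) e.finrank_plane h1 h2
  exact ⟨i, j, hi, hj⟩

open Prolongation ProlongationChart

variable {f : M → M'} {𝓔 : ExtDiffSystem E M} {I : HyperbolicSystem E' M' s}
  (h : IsIntegrableExtension f 𝓔 I.toExtDiffSystem)
  (hdim : Module.finrank ℝ E = Module.finrank ℝ E' + 1)

/-- Charts of the prolongation spaces of an integrable extension and of the underlying system,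
which are compatible with the prolonged map. -/
structure CompatibleCharts (d : ProlongationChart (h.hyperbolic hdim)) (d' : ProlongationChart I) :
    Prop where
  lift : d.coframe.IsLift f d'.coframe
  i : d'.i = d.i
  j : d'.j = d.j
  maps : ∀ y ∈ d.U, f y ∈ d'.φ.source

namespace CompatibleCharts

variable {h hdim} {d : ProlongationChart (h.hyperbolic hdim)} {d' : ProlongationChart I}

theorem swap (hd : CompatibleCharts h hdim d d') : CompatibleCharts h hdim d.swap d'.swap :=
  ⟨hd.lift.swap, hd.j, hd.i, hd.maps⟩

theorem prolongation_mem (hd : CompatibleCharts h hdim d d') {e : Prolongation (h.hyperbolic hdim)}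
    (he : e ∈ d.chart.source) : h.prolongation hdim e ∈ d'.chart.source := by
  obtain ⟨-, h2, ⟨v, hv, hv'⟩, ⟨w, hw, hw'⟩⟩ := he
  refine ⟨hd.maps _ h2, hd.lift.maps _ h2, ⟨tangentMap E E' f e.base v, ⟨v, hv, rfl⟩, ?_⟩,
    ⟨tangentMap E E' f e.base w, ⟨w, hw, rfl⟩, ?_⟩⟩
  · rw [hd.i]
    exact (hd.lift.σ_apply h2 _ v).trans_ne hv'
  · rw [hd.j]
    exact (hd.lift.τ_apply h2 _ w).trans_ne hw'

/-- A slope is a ratio of values of coframe forms on a vector of the plane. The upper forms are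
pullbacks and the lower plane is the image, so the ratios are the same. -/
theorem slopes_prolongation (hd : CompatibleCharts h hdim d d')
    {e : Prolongation (h.hyperbolic hdim)} (he : e ∈ d.chart.source) :
    d'.slopes (h.prolongation hdim e) = d.slopes e := by
  obtain ⟨-, h2, ⟨v, hv, hv'⟩, ⟨w, hw, hw'⟩⟩ := he
  rw [d.slopes_eq h2 hv hv' hw hw']
  have e1 : ∀ k v, d'.coframe.σ k (f e.base) (tangentMap E E' f e.base v) =
    d.coframe.σ k e.base v := hd.lift.σ_apply h2
  have e2 : ∀ k v, d'.coframe.τ k (f e.base) (tangentMap E E' f e.base v) =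
    d.coframe.τ k e.base v := hd.lift.τ_apply h2
  have := d'.slopes_eq (e := h.prolongation hdim e) (hd.lift.maps _ h2)
    (v := tangentMap E E' f e.base v) (w := tangentMap E E' f e.base w) ⟨v, hv, rfl⟩
    (by rw [hd.i]; exact (e1 _ v).trans_ne hv') ⟨w, hw, rfl⟩
    (by rw [hd.j]; exact (e2 _ w).trans_ne hw')
  rw [this, hd.i, hd.j]
  change (d'.coframe.σ _ (f e.base) _ / d'.coframe.σ _ (f e.base) _,
    d'.coframe.τ _ (f e.base) _ / d'.coframe.τ _ (f e.base) _) = _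
  rw [e1, e1, e2, e2]

theorem slopeFun_prolongation (hd : CompatibleCharts h hdim d d')
    {e : Prolongation (h.hyperbolic hdim)} (he : e ∈ d.chart.source) :
    d'.slopeFun (h.prolongation hdim e) = d.slopeFun e :=
  congrArg Prod.fst (hd.slopes_prolongation he)

/-- In compatible charts the prolonged map is f on base points and the identity on slopes. -/
theorem contMDiffOn (hd : CompatibleCharts h hdim d d') :
    ContMDiffOn 𝓘(ℝ, E × ℝ × ℝ) 𝓘(ℝ, E' × ℝ × ℝ) ∞ (h.prolongation hdim) d.chart.source := by
  have h1 : ContMDiffOn 𝓘(ℝ, E × ℝ × ℝ) 𝓘(ℝ, E') ∞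
      (fun e : Prolongation (h.hyperbolic hdim) => d'.φ (f e.base)) d.chart.source := by
    refine (contMDiffOn_extChartAt (n := ∞) (x := d'.center.base)).comp
      (h.1.comp_contMDiffOn d.contMDiffOn_proj) fun e he => ?_
    have := hd.maps _ he.2.1
    rwa [φ, extChartAt_source] at this
  have h2 : ContMDiffOn 𝓘(ℝ, E × ℝ × ℝ) 𝓘(ℝ, ℝ × ℝ) ∞ d.slopes d.chart.source :=
    (contDiff_snd.contMDiff (n := ∞)).comp_contMDiffOn d.contMDiffOn_chart
  refine (d'.contMDiffOn_chart_symm.comp (h1.prodMk_space h2) fun e he => ?_).congr fun e he => ?_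
  · have := d'.chart.map_source (hd.prolongation_mem he)
    change (d'.φ (f e.base), d'.slopes (h.prolongation hdim e)) ∈ _ at this
    rwa [hd.slopes_prolongation he] at this
  · have := d'.chart.left_inv (hd.prolongation_mem he)
    change d'.chart.symm (d'.φ (f e.base), d'.slopes (h.prolongation hdim e)) = _ at this
    rw [hd.slopes_prolongation he] at this
    exact this.symm

theorem dproj_tangentMap (hd : CompatibleCharts h hdim d d')
    {e : Prolongation (h.hyperbolic hdim)} (he : e ∈ d.chart.source) (v : E × ℝ × ℝ) :
    dproj (h.prolongation hdim e)
      (tangentMap (E × ℝ × ℝ) (E' × ℝ × ℝ) (h.prolongation hdim) e v) =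
      tangentMap E E' f e.base (dproj e v) := by
  have d1 := ContMDiffOn.mdifferentiableAt' d.isOpen_source hd.contMDiffOn he
  have c1 := mfderiv_comp e
    ((contMDiff_proj (H := I)).mdifferentiableAt (x := h.prolongation hdim e) (by simp)) d1
  have c2 := mfderiv_comp e (h.1.mdifferentiableAt (x := e.base) (by simp))
    ((contMDiff_proj (H := h.hyperbolic hdim)).mdifferentiableAt (x := e) (by simp))
  exact (DFunLike.congr_fun c1 v).symm.trans (DFunLike.congr_fun c2 v)

theorem differential_slopeFun (hd : CompatibleCharts h hdim d d')
    {e : Prolongation (h.hyperbolic hdim)} (he : e ∈ d.chart.source) :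
    (differential (E' × ℝ × ℝ) d'.slopeFun (h.prolongation hdim e)).comp
      (tangentMap (E × ℝ × ℝ) (E' × ℝ × ℝ) (h.prolongation hdim) e) =
      differential (E × ℝ × ℝ) d.slopeFun e := by
  have d1 := ContMDiffOn.mdifferentiableAt' d.isOpen_source hd.contMDiffOn he
  have d2 := ContMDiffOn.mdifferentiableAt' d'.isOpen_source d'.contMDiffOn_slopeFun
    (hd.prolongation_mem he)
  rw [← differential_comp d1 d2]
  apply differential_congr
  filter_upwards [d.isOpen_source.mem_nhds he] with e' he'
  exact hd.slopeFun_prolongation he'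

theorem pb_comp (hd : CompatibleCharts h hdim d d') {e : Prolongation (h.hyperbolic hdim)}
    (he : e ∈ d.chart.source) {α' : M' → E' →L[ℝ] ℝ} {α : M → E →L[ℝ] ℝ}
    (hα : (α' (f e.base)).comp (tangentMap E E' f e.base) = α e.base) :
    (pb α' (h.prolongation hdim e)).comp
      (tangentMap (E × ℝ × ℝ) (E' × ℝ × ℝ) (h.prolongation hdim) e) = pb α e := by
  refine ContinuousLinearMap.ext fun v => ?_
  change α' (f e.base) (dproj (h.prolongation hdim e)
      (tangentMap (E × ℝ × ℝ) (E' × ℝ × ℝ) (h.prolongation hdim) e v)) = α e.base (dproj e v)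
  rw [hd.dproj_tangentMap he, ← hα]
  rfl

theorem contactForm_comp (hd : CompatibleCharts h hdim d d')
    {e : Prolongation (h.hyperbolic hdim)} (he : e ∈ d.chart.source) :
    (d'.contactForm (h.prolongation hdim e)).comp
      (tangentMap (E × ℝ × ℝ) (E' × ℝ × ℝ) (h.prolongation hdim) e) = d.contactForm e := by
  rw [contactForm, ContinuousLinearMap.sub_comp, ContinuousLinearMap.smul_comp,
    hd.slopeFun_prolongation he, hd.i, hd.pb_comp he (hd.lift.σ e.base he.2.1 _),
    hd.pb_comp he (hd.lift.σ e.base he.2.1 _)]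
  rfl

/-- Exterior derivatives commute with pullback and the dual vectors of σ and τ project to each
other. Hence the form da + κ τ_j downstairs pulls back to its counterpart upstairs. -/
theorem curv_prolongation (hd : CompatibleCharts h hdim d d')
    {e : Prolongation (h.hyperbolic hdim)} (he : e ∈ d.chart.source) :
    d'.curv (h.prolongation hdim e) = d.curv e := by
  have hU : e.base ∈ d.U := he.2.1
  have key : ∀ k v w, extDeriv₁ (d'.coframe.σ k) (f e.base) (tangentMap E E' f e.base v)
      (tangentMap E E' f e.base w) = extDeriv₁ (d.coframe.σ k) e.base v w := by
    intro k v w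
    rw [← extDeriv₁_pullback isOpen_univ h.1.contMDiffOn d'.isOpen (d'.coframe.smooth_σ k) trivial
      (hd.lift.maps _ hU)]
    refine extDeriv₁_congr ?_ v w
    filter_upwards [d.isOpen.mem_nhds hU] with y hy
    exact hd.lift.σ y hy k
  have hb : d'.swap.slopeFun (h.prolongation hdim e) = d.swap.slopeFun e :=
    hd.swap.slopeFun_prolongation (by rw [d.swap_source]; exact he)
  have e1 : d'.coframe.eσ d.i (f e.base) + d.slopeFun e • d'.coframe.eσ (1 - d.i) (f e.base) =
      tangentMap E E' f e.base
        (d.coframe.eσ d.i e.base + d.slopeFun e • d.coframe.eσ (1 - d.i) e.base) := by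
    rw [map_add, map_smul, hd.lift.map_eσ hU, hd.lift.map_eσ hU]
  have e2 : d'.coframe.eτ d.j (f e.base) + d.swap.slopeFun e • d'.coframe.eτ (1 - d.j) (f e.base) =
      tangentMap E E' f e.base
        (d.coframe.eτ d.j e.base + d.swap.slopeFun e • d.coframe.eτ (1 - d.j) e.base) := by
    rw [map_add, map_smul, hd.lift.map_eτ hU, hd.lift.map_eτ hU]
  rw [curv, hd.slopeFun_prolongation he, hb, hd.i, hd.j]
  change extDeriv₁ _ (f e.base) (d'.coframe.eσ d.i (f e.base) + _ • d'.coframe.eσ _ (f e.base))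
    (d'.coframe.eτ d.j (f e.base) + _ • d'.coframe.eτ _ (f e.base)) -
    _ * extDeriv₁ _ (f e.base) (d'.coframe.eσ d.i (f e.base) + _ • d'.coframe.eσ _ (f e.base))
    (d'.coframe.eτ d.j (f e.base) + _ • d'.coframe.eτ _ (f e.base)) = _
  rw [e1, e2, key, key]
  rfl

theorem slopeForm_comp (hd : CompatibleCharts h hdim d d')
    {e : Prolongation (h.hyperbolic hdim)} (he : e ∈ d.chart.source) :
    (d'.slopeForm (h.prolongation hdim e)).comp
      (tangentMap (E × ℝ × ℝ) (E' × ℝ × ℝ) (h.prolongation hdim) e) = d.slopeForm e := by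
  rw [slopeForm, ContinuousLinearMap.add_comp, ContinuousLinearMap.smul_comp,
    hd.differential_slopeFun he, hd.curv_prolongation he, hd.j,
    hd.pb_comp he (hd.lift.τ e.base he.2.1 _)]
  rfl

/-- The prolonged coframe of an integrable extension is a lift of the prolonged coframe. -/
theorem isLift (hd : CompatibleCharts h hdim d d') :
    Coframe.IsLift (s := s + 2) (h.prolongation hdim) d.prol d'.prol where
  maps e he := hd.prolongation_mem he
  θ e he := by
    have he' : e ∈ d.swap.chart.source := by rw [d.swap_source]; exact he
    refine Fin.addCases (fun k => ?_) (fun k => ?_)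
    · have hk : (Fin.castAdd 2 k).succ = (Fin.castAdd 2 k.succ : Fin (s + 1 + 2)) := rfl
      refine Eq.trans ?_ (congrFun (d.prol_θ_left k.succ) e).symm
      rw [d'.prol_θ_left]
      exact hd.pb_comp he (hd.lift.θ e.base he.2.1 k)
    -- The additional form θ⁰ of the base system stays at index 0. The two new contact forms start
    -- at s below and at s + 1 above, which matches the shift by one in `Coframe.IsLift`.
    · have hk : (Fin.natAdd s k).succ = (Fin.natAdd (s + 1) k : Fin (s + 1 + 2)) := by
        ext; simp; omega
      refine Eq.trans ?_ (congrArg (fun l => d.prol.θ l e) hk).symm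
      refine Eq.trans ?_ (congrFun (d.prol_θ_right k) e).symm
      rw [d'.prol_θ_right]
      revert k
      exact Fin.forall_fin_two.2
        ⟨fun _ => hd.contactForm_comp he, fun _ => hd.swap.contactForm_comp he'⟩
  σ e he := Fin.forall_fin_two.2 ⟨by
    change (pb (d'.coframe.σ d'.i) _).comp _ = pb (d.coframe.σ d.i) e
    rw [hd.i]
    exact hd.pb_comp he (hd.lift.σ e.base he.2.1 _), hd.slopeForm_comp he⟩
  τ e he := by
    have he' : e ∈ d.swap.chart.source := by rw [d.swap_source]; exact he
    refine Fin.forall_fin_two.2 ⟨?_, hd.swap.slopeForm_comp he'⟩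
    change (pb (d'.coframe.τ d'.j) _).comp _ = pb (d.coframe.τ d.j) e
    rw [hd.j]
    exact hd.pb_comp he (hd.lift.τ e.base he.2.1 _)

end CompatibleCharts

/-- A coframe from below and its lift are used with the same indices i and j. The domain above is
shrunk until its image lies in a single chart of the base manifold. -/
theorem exists_compatibleCharts (e : Prolongation (h.hyperbolic hdim)) :
    ∃ (d : ProlongationChart (h.hyperbolic hdim)) (d' : ProlongationChart I),
      d.center = e ∧ CompatibleCharts h hdim d d' := by
  obtain ⟨U', hU', hxU', c', hc'⟩ := I.exists_coframe (f e.base)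
  obtain ⟨V, hV, hxV, c, hc, hl⟩ := Coframe.exists_lift h hdim hU' c' hc' (x := e.base) hxU'
  have hO : IsOpen (V ∩ f ⁻¹' (extChartAt 𝓘(ℝ, E') (f e.base)).source) :=
    hV.inter ((isOpen_extChartAt_source _).preimage h.1.continuous)
  have hsub : V ∩ f ⁻¹' (extChartAt 𝓘(ℝ, E') (f e.base)).source ⊆ V := Set.inter_subset_left
  obtain ⟨i, j, hi, hj⟩ := exists_indices (H := h.hyperbolic hdim) c hc e hxV
  refine ⟨⟨e, _, hO, ⟨hxV, mem_extChartAt_source _⟩, c.restrict hsub, hc.restrict hsub, i, j, hi,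
    hj⟩, ⟨h.prolongation hdim e, U', hU', hxU', c', hc', i, j, ?_, ?_⟩, rfl,
    ⟨hl.restrict hsub, rfl, rfl, fun y hy => hy.2⟩⟩
  · obtain ⟨v, hv, hv'⟩ := hi
    exact ⟨tangentMap E E' f e.base v, ⟨v, hv, rfl⟩, (hl.σ_apply hxV _ v).trans_ne hv'⟩
  · obtain ⟨v, hv, hv'⟩ := hj
    exact ⟨tangentMap E E' f e.base v, ⟨v, hv, rfl⟩, (hl.τ_apply hxV _ v).trans_ne hv'⟩

end ProlongedMap
end EDS

namespace EDS

/-! ### The upper bound two for first integrals of the extension. -/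

section FirstIntegralRank

variable {E : Type*} [NormedAddCommGroup E] [NormedSpace ℝ E] [FiniteDimensional ℝ E]
  {E' : Type*} [NormedAddCommGroup E'] [NormedSpace ℝ E'] [FiniteDimensional ℝ E']
  {M : Type*} [TopologicalSpace M] [ChartedSpace E M] [IsManifold 𝓘(ℝ, E) ∞ M]
  {M' : Type*} [TopologicalSpace M'] [ChartedSpace E' M'] [IsManifold 𝓘(ℝ, E') ∞ M']
  {s : ℕ} {U : Set M} {U' : Set M'} {f : M → M'}

theorem Coframe.finrank_sing_le (c : Coframe (E := E) s U) (y : M) :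
    Module.finrank ℝ (c.sing y) ≤ s + 2 := by
  have h := finrank_range_le_card (R := ℝ) (Sum.elim (fun k => c.θ k y) (fun k => c.σ k y))
  rw [Set.Sum.elim_range] at h
  exact h.trans (by simp)

theorem differential_mem_firstIntegrals {W : M → Submodule ℝ (E →L[ℝ] ℝ)} {h : M → ℝ} {O : Set M}
    (hO : IsOpen O) (hh : ContMDiffOn 𝓘(ℝ, E) 𝓘(ℝ, ℝ) ∞ h O)
    (hW : ∀ y ∈ O, differential E h y ∈ W y) {x : M} (hx : x ∈ O) :
    differential E h x ∈ firstIntegrals W x :=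
  Submodule.subset_span ⟨O, h, hO, hx, hh, hW, rfl⟩

namespace Coframe.IsLift

variable {c : Coframe (E := E) (s + 1) U} {c' : Coframe (E := E') s U'}

/-- A function `h` on the total space of a lift such that `dh - a dg` is semi-basic and in the
singular system, for a function `g` that is not constant along the fibres, descends to a first
integral of the singular system. -/
theorem exists_firstIntegral (hl : c.IsLift f c') {S : Set M} (hS : IsOpen S) (hSU : S ⊆ U)
    (hdim : Module.finrank ℝ E = Module.finrank ℝ E' + 1)
    (hf : ContMDiffOn 𝓘(ℝ, E) 𝓘(ℝ, E') ∞ f S) {g h : M → ℝ}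
    (hg : ContMDiffOn 𝓘(ℝ, E) 𝓘(ℝ, ℝ) ∞ g S) (hh : ContMDiffOn 𝓘(ℝ, E) 𝓘(ℝ, ℝ) ∞ h S)
    {x : M} (hx : x ∈ S) (hgx : differential E g x (c.eθ 0 x) ≠ 0)
    (hV : ∀ y ∈ S, ∃ a : ℝ, differential E h y - a • differential E g y ∈ c.sing y ∧
      (differential E h y - a • differential E g y) (c.eθ 0 y) = 0) :
    ∃ β ∈ firstIntegrals c'.sing (f x), ∃ a : ℝ,
      differential E h x = a • differential E g x + β.comp (tangentMap E E' f x) := by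
  refine EDS.exists_firstIntegral hS hf hg hh hx (fun v hv hv' => ?_) hdim fun y hy => ?_
  · rw [hl.eq_smul (hSU hx) hv, map_smul, smul_eq_mul, mul_eq_zero] at hv'
    rw [hl.eq_smul (hSU hx) hv, hv'.resolve_right hgx, zero_smul]
  · obtain ⟨a, h1, h2⟩ := hV y hy
    obtain ⟨β, hβ⟩ := hl.exists_comp (hSU hy) h2
    refine ⟨a, β, hl.mem_sing_of_comp (hSU hy) (hβ ▸ h1), ?_⟩
    rw [← hβ]
    abel

end Coframe.IsLift

/-- The singular systems of a 1-dimensional integrable extension of a Monge-Ampère system with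
exactly one first integral have at most two independent first integrals. -/
theorem not_linearIndependent_of_isLift {c : Coframe (E := E) 2 U} {c' : Coframe (E := E') 1 U'}
    (hl : c.IsLift f c') (hU : IsOpen U) (hU' : IsOpen U')
    (hdim : Module.finrank ℝ E = Module.finrank ℝ E' + 1)
    (hf : ContMDiff 𝓘(ℝ, E) 𝓘(ℝ, E') ∞ f) {H : HyperbolicSystem E' M' 1}
    (hMA : IsMongeAmpere H) (hc' : c'.IsAdapted H.ideal)
    (hrank : ∀ y ∈ U', Module.finrank ℝ (firstIntegrals c'.sing y) = 1) {O : Set M}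
    (hO : IsOpen O) (hOU : O ⊆ U) {h : Fin 3 → M → ℝ}
    (hh : ∀ i, ContMDiffOn 𝓘(ℝ, E) 𝓘(ℝ, ℝ) ∞ (h i) O)
    (hd : ∀ i, ∀ y ∈ O, differential E (h i) y ∈ c.sing y) {x : M} (hx : x ∈ O) :
    ¬LinearIndependent ℝ (fun i => differential E (h i) x) := by
  intro hli
  have hcard := finrank_span_eq_card hli
  rw [Fintype.card_fin] at hcard
  by_cases hc : ∃ i, differential E (h i) x (c.eθ 0 x) ≠ 0
  · obtain ⟨i, hi⟩ := hc
    -- On S the function h_i is transverse to the fibres. The other functions descend modulo it, so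
    -- all three differentials lie in a space of dimension at most 1 + 1.
    set S := O ∩ (fun y => differential E (h i) y (c.eθ 0 y)) ⁻¹' {0}ᶜ with hSdef
    have hsm : ContMDiffOn 𝓘(ℝ, E) 𝓘(ℝ, ℝ) ∞ (fun y => differential E (h i) y (c.eθ 0 y)) O :=
      (smoothCovectorOn_differential hO (hh i)).apply fun x₀ =>
        ((c.smooth_vec _) x₀).mono fun z hz => ⟨hz.1, hOU hz.2⟩
    have hS : IsOpen S := hsm.continuousOn.isOpen_inter_preimage hO isOpen_compl_singleton
    have hSO : S ⊆ O := Set.inter_subset_left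
    let L : (E' →L[ℝ] ℝ) →ₗ[ℝ] (E →L[ℝ] ℝ) :=
      { toFun := fun β => β.comp (tangentMap E E' f x)
        map_add' := fun _ _ => rfl
        map_smul' := fun _ _ => rfl }
    have hle : Submodule.span ℝ (Set.range fun j => differential E (h j) x) ≤
        Submodule.span ℝ {differential E (h i) x} ⊔ (firstIntegrals c'.sing (f x)).map L := by
      rw [Submodule.span_le]
      rintro _ ⟨j, rfl⟩
      obtain ⟨β, hβ, a, he⟩ := hl.exists_firstIntegral hS (hSO.trans hOU) hdim hf.contMDiffOn
        ((hh i).mono hSO) ((hh j).mono hSO) ⟨hx, hi⟩ hi fun y hy => by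
          -- The quotient of the two fibre derivatives: subtracting this multiple of dh_i makes dh_j
          -- semi-basic.
          refine ⟨differential E (h j) y (c.eθ 0 y) / differential E (h i) y (c.eθ 0 y), ?_, ?_⟩
          · exact Submodule.sub_mem _ (hd j y hy.1) (Submodule.smul_mem _ _ (hd i y hy.1))
          · have : differential E (h i) y (c.eθ 0 y) ≠ 0 := hy.2
            simp [div_mul_cancel₀ _ this]
      change differential E (h j) x ∈ _
      rw [he]
      exact Submodule.add_mem_sup (Submodule.smul_mem _ _ (Submodule.mem_span_singleton_self _))
        ⟨β, hβ, rfl⟩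
    have h1 := Submodule.finrank_mono hle
    have h2 := Submodule.finrank_add_le_finrank_add_finrank
      (Submodule.span ℝ {differential E (h i) x}) ((firstIntegrals c'.sing (f x)).map L)
    have h3 := Submodule.finrank_map_le L (firstIntegrals c'.sing (f x))
    have h4 : Module.finrank ℝ (Submodule.span ℝ {differential E (h i) x}) ≤ 1 := by
      simpa using finrank_span_le_card (R := ℝ) ({differential E (h i) x} : Set (E →L[ℝ] ℝ))
    rw [hrank _ (hl.maps x (hOU hx))] at h3
    omega
  -- All three differentials are semi-basic at x. This is known only at the one point, so the
  -- functions need not descend, and the argument uses the differentials at x together with d(dh) =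
  -- 0.
  · push Not at hc
    have hxU := hOU hx
    choose β hβ using fun i => hl.exists_comp hxU (hc i)
    have hβs : ∀ i, β i ∈ c'.sing (f x) := fun i =>
      hl.mem_sing_of_comp hxU (by rw [← hβ i]; exact hd i x hx)
    have hβli : LinearIndependent ℝ β := by
      let L : (E' →L[ℝ] ℝ) →ₗ[ℝ] (E →L[ℝ] ℝ) :=
        { toFun := fun β => β.comp (tangentMap E E' f x)
          map_add' := fun _ _ => rfl
          map_smul' := fun _ _ => rfl }
      refine LinearIndependent.of_comp L ?_
      convert hli using 1
      funext i
      exact (hβ i).symm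
    have hβcard := finrank_span_eq_card hβli
    -- Three independent covectors exhaust a singular system of rank at most 1 + 2, so the contact
    -- form is a combination of them.
    have hspan : Submodule.span ℝ (Set.range β) = c'.sing (f x) := by
      refine Submodule.eq_of_le_of_finrank_le (Submodule.span_le.2 ?_) ?_
      · rintro _ ⟨i, rfl⟩
        exact hβs i
      · rw [hβcard]
        exact c'.finrank_sing_le _
    have hθ : c'.θ 0 (f x) ∈ Submodule.span ℝ (Set.range β) := by
      rw [hspan]
      exact Submodule.subset_span (Or.inl ⟨0, rfl⟩)
    obtain ⟨k, hk⟩ := (Submodule.mem_span_range_iff_exists_fun ℝ).1 hθ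
    have hk' : ∀ v, c.θ 1 x v = ∑ i, k i * differential E (h i) x v := fun v => by
      have := hl.θ_apply hxU 0 v
      rw [← hk] at this
      refine this.symm.trans ?_
      rw [sum_apply]
      refine Finset.sum_congr rfl fun i _ => ?_
      rw [hβ i]
      rfl
    obtain ⟨v', hv', w', hw', hne⟩ := hMA.exists_ne_zero hU' c' hc' (hl.maps x hxU)
    obtain ⟨v, hv, rfl⟩ := hl.exists_ker hxU hv'
    obtain ⟨w, hw, rfl⟩ := hl.exists_ker hxU hw'
    rw [← extDeriv₁_pullback isOpen_univ hf.contMDiffOn hU' (c'.smooth_θ 0) trivial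
      (hl.maps x hxU), extDeriv₁_congr (β := c.θ 1)
        (by filter_upwards [hU.mem_nhds hxU] with y hy using hl.θ y hy 0)] at hne
    let η : Fin 2 ⊕ Fin 2 → M → E →L[ℝ] ℝ := Sum.elim c.θ c.σ
    let e : Fin 2 ⊕ Fin 2 → M → E := Sum.elim c.eθ c.eσ
    -- Expanding dh_i in the coframe and using d(dh_i) = 0 gives a linear relation among the values
    -- of dθ and dσ on the characteristic pair v, w.
    have hz : ∀ i, ∑ l, differential E (h i) x (e l x) * extDeriv₁ (η l) x v w = 0 := fun i => by
      rw [← extDeriv₁_differential hO (hh i) hx v w]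
      refine (extDeriv₁_sum_of_vanish (h := fun l y => differential E (h i) y (e l y)) hO ?_ ?_ ?_
        hx ?_ ?_).symm
      · rintro (l | l)
        exacts [(c.smooth_θ l).mono hOU, (c.smooth_σ l).mono hOU]
      · rintro (l | l) <;>
        exact (smoothCovectorOn_differential hO (hh i)).apply fun x₀ =>
          ((c.smooth_vec _) x₀).mono fun z hz => ⟨hz.1, hOU hz.2⟩
      · intro y hy
        rw [Fintype.sum_sum_type]
        exact c.expand_of_ker (hOU hy) ((c.mem_sing (hOU hy)).1 (hd i y hy))
      · rintro (l | l)
        exacts [hv.1 l, hv.2 l]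
      · rintro (l | l)
        exacts [hw.1 l, hw.2 l]
    apply hne
    -- Summing these relations with the coefficients that express θ¹ at x leaves only dθ¹(v, w),
    -- because θ¹ takes the value 1 on its own dual vector and 0 on the others.
    have h0 : ∑ l, c.θ 1 x (e l x) * extDeriv₁ (η l) x v w = 0 := by
      simp only [hk', Finset.sum_mul]
      rw [Finset.sum_comm]
      refine Finset.sum_eq_zero fun i _ => ?_
      rw [← mul_zero (k i), ← hz i, Finset.mul_sum]
      exact Finset.sum_congr rfl fun l _ => by ring
    rw [Fintype.sum_sum_type] at h0
    simpa [e, η, Coframe.eθ, Coframe.eσ, c.θ_vec _ hxU] using h0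

end FirstIntegralRank
end EDS

namespace EDS

/-! ### Exact coframes coming from the wave equation, and their completeness. -/

section FirstIntegralFrame

variable {E : Type*} [NormedAddCommGroup E] [NormedSpace ℝ E] [FiniteDimensional ℝ E]
  {E' : Type*} [NormedAddCommGroup E'] [NormedSpace ℝ E'] [FiniteDimensional ℝ E']
  {M : Type*} [TopologicalSpace M] [ChartedSpace E M] [IsManifold 𝓘(ℝ, E) ∞ M]
  {M' : Type*} [TopologicalSpace M'] [ChartedSpace E' M'] [IsManifold 𝓘(ℝ, E') ∞ M']
  {s : ℕ} {U : Set M}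

/-- The forms `σ` are the differentials of the functions `g`. -/
structure Coframe.IsExact (c : Coframe (E := E) s U) (g : Fin 2 → M → ℝ) : Prop where
  smooth : ∀ k, ContMDiffOn 𝓘(ℝ, E) 𝓘(ℝ, ℝ) ∞ (g k) U
  eq : ∀ y ∈ U, ∀ k, c.σ k y = differential E (g k) y

/-- All first integrals of the singular system `θ, σ` are dependent on `σ`. -/
def Coframe.IsComplete (c : Coframe (E := E) s U) : Prop :=
  ∀ x ∈ U, ∀ (O : Set M) (F : M → ℝ), IsOpen O → O ⊆ U → x ∈ O →
    ContMDiffOn 𝓘(ℝ, E) 𝓘(ℝ, ℝ) ∞ F O → (∀ y ∈ O, differential E F y ∈ c.sing y) →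
      ∀ v, (∀ k, c.σ k x v = 0) → differential E F x v = 0

theorem Coframe.IsExact.mem_sing {c : Coframe (E := E) s U} {g : Fin 2 → M → ℝ}
    (hc : c.IsExact g) {y : M} (hy : y ∈ U) (k : Fin 2) : differential E (g k) y ∈ c.sing y :=
  Submodule.subset_span (Or.inr ⟨k, hc.eq y hy k⟩)

/-- If the two forms `σ` of a coframe adapted to a 1-dimensional integrable extension of a
Monge-Ampère system with exactly one first integral for each singular system are exact, then they
span the first integrals. -/
theorem Coframe.IsExact.isComplete {f : M → M'} {𝓔 : ExtDiffSystem E M}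
    {H : HyperbolicSystem E' M' 1} (h : IsIntegrableExtension f 𝓔 H.toExtDiffSystem)
    (hdim : Module.finrank ℝ E = Module.finrank ℝ E' + 1) (hMA : IsMongeAmpere H)
    (hrank : FirstIntegralsHaveRank 1 H.ideal 1) (hU : IsOpen U) {c : Coframe (E := E) 2 U}
    (hc : c.IsAdapted 𝓔.ideal) {g : Fin 2 → M → ℝ} (hg : c.IsExact g) : c.IsComplete := by
  intro x hxU O F hO hOU hxO hF hFd v hv
  by_contra hne
  -- A vector with σ(v) = 0 and dF(v) ≠ 0 separates dF from the two independent forms σ = dg.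
  have hli : LinearIndependent ℝ (fun i => differential E ((![g 0, g 1, F] : Fin 3 → M → ℝ) i) x) := by
    rw [Fintype.linearIndependent_iff]
    intro a ha
    have key : ∀ w, a 0 * c.σ 0 x w + a 1 * c.σ 1 x w + a 2 * differential E F x w = 0 := fun w => by
      have := DFunLike.congr_fun ha w
      simpa [Fin.sum_univ_three, hg.eq x hxU] using this
    have h2 : a 2 = 0 := by
      have := key v
      rw [hv, hv, mul_zero, mul_zero, zero_add, zero_add] at this
      exact (mul_eq_zero.1 this).resolve_right hne
    have h0 := key (c.eσ 0 x)
    have h1 := key (c.eσ 1 x)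
    simp [h2, Coframe.eσ, c.σ_vec _ hxU] at h0 h1
    intro i
    fin_cases i
    exacts [h0, h1, h2]
  obtain ⟨U', hU', hxU', c', hc'⟩ := H.exists_coframe (f x)
  obtain ⟨V, hV, hxV, cl, hcl, hl⟩ := Coframe.exists_lift h hdim hU' c' hc' hxU'
  have hr := hrank U' c'.sing c'.swap.sing hU' (c'.isSingularPair hc' hU')
  -- The given coframe and the one lifted from H share their singular systems near x only up to
  -- interchange. The argument is therefore stated for either matching.
  have main : ∀ (c' : Coframe (E := E') 1 U') (cl : Coframe (E := E) 2 V), c'.IsAdapted H.ideal →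
      cl.IsLift f c' → (∀ y ∈ U', Module.finrank ℝ (firstIntegrals c'.sing y) = 1) →
      (∀ᶠ y in 𝓝 x, c.ker y = cl.ker y) → False := by
    intro c' cl hc' hl hr hev
    obtain ⟨S, hS, hSo, hxS⟩ := eventually_nhds_iff.1 hev
    refine not_linearIndependent_of_isLift hl hV hU' hdim h.1 hMA hc' hr
      (O := O ∩ (V ∩ S)) (hO.inter (hV.inter hSo)) (fun y hy => hy.2.1) (h := ![g 0, g 1, F])
      ?_ ?_ ⟨hxO, hxV, hxS⟩ hli
    · refine fun i => ContMDiffOn.mono (s := O) ?_ Set.inter_subset_left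
      fin_cases i
      exacts [(hg.smooth 0).mono hOU, (hg.smooth 1).mono hOU, hF]
    · rintro i y ⟨hyO, hyV, hyS⟩
      rw [← c.sing_eq cl (hOU hyO) hyV (hS y hyS)]
      fin_cases i
      exacts [hg.mem_sing (hOU hyO) 0, hg.mem_sing (hOU hyO) 1, hFd y hyO]
  rcases c.eventually_ker_eq_or cl hc hcl hU hV hxU hxV with hev | hev
  · exact main c' cl hc' hl (fun y hy => (hr y hy).1) (hev.mono fun y hy => hy.1)
  · exact main c'.swap cl.swap hc'.swap hl.swap (fun y hy => (hr y hy).2)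
      (hev.mono fun y hy => hy.1)

/-- The Monge-Ampère system of the wave equation has local coframes with exact forms
`σ = (dp, dx)`, `τ = (dq, dy)`. -/
theorem IsWaveSystem.exists_coframe {I : ExtDiffSystem E M} (hI : IsWaveSystem I) (m : M) :
    ∃ U : Set M, IsOpen U ∧ m ∈ U ∧ ∃ c : Coframe (E := E) 1 U, c.IsAdapted I.ideal ∧
      (∃ g, c.IsExact g) ∧ ∃ g, c.swap.IsExact g := by
  obtain ⟨U, x, y, u, p, q, hU, hm, hsm, hz⟩ := hI m
  simp only [List.mem_cons, List.not_mem_nil, or_false, forall_eq_or_imp, forall_eq] at hsm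
  obtain ⟨sx, sy, su, sp, sq⟩ := hsm
  have D : ∀ {f : M → ℝ}, ContMDiffOn 𝓘(ℝ, E) 𝓘(ℝ, ℝ) ∞ f U →
      SmoothCovectorOn (differential E f) U := fun hf => smoothCovectorOn_differential hU hf
  let c : Coframe (E := E) 1 U :=
    { θ := ![fun z => differential E u z - p z • differential E x z - q z • differential E y z]
      σ := ![differential E p, differential E x]
      τ := ![differential E q, differential E y]
      smooth_θ := fun k => by
        rw [Subsingleton.elim k 0]
        exact ((D su).sub ((D sx).smul sp)).sub ((D sy).smul sq)
      smooth_σ := Fin.forall_fin_two.2 ⟨D sp, D sx⟩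
      smooth_τ := Fin.forall_fin_two.2 ⟨D sq, D sy⟩
      bijective := by
        intro z hzU
        obtain ⟨hb, -⟩ := hz z hzU
        constructor
        · rw [injective_iff_map_eq_zero]
          intro v hv
          have h1 := congrFun (congrArg Prod.fst hv) 0
          have h2 := congrFun (congrArg (fun w => w.2.1) hv)
          have h3 := congrFun (congrArg (fun w => w.2.2) hv)
          have hp : differential E p z v = 0 := h2 0
          have hx : differential E x z v = 0 := h2 1
          have hq : differential E q z v = 0 := h3 0
          have hy : differential E y z v = 0 := h3 1
          have hu : differential E u z v - p z * differential E x z v -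
            q z * differential E y z v = 0 := h1
          rw [hx, hy, mul_zero, mul_zero, sub_zero, sub_zero] at hu
          apply hb.1
          funext i
          simp only [map_zero]
          fin_cases i
          exacts [hx, hy, hu, hp, hq]
        · rintro ⟨a, b, d⟩
          -- The du-component solves du − p dx − q dy = a₀ for the prescribed dx and dy.
          obtain ⟨v, hv⟩ := hb.2 ![b 1, d 1, a 0 + p z * b 1 + q z * d 1, b 0, d 0]
          have hv := congrFun hv
          have hx : differential E x z v = b 1 := hv 0
          have hy : differential E y z v = d 1 := hv 1
          have hu : differential E u z v = a 0 + p z * b 1 + q z * d 1 := hv 2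
          have hp : differential E p z v = b 0 := hv 3
          have hq : differential E q z v = d 0 := hv 4
          refine ⟨v, Prod.ext (funext fun k => ?_) (Prod.ext (funext ?_) (funext ?_))⟩
          · rw [Subsingleton.elim k 0]
            change differential E u z v - p z * differential E x z v -
              q z * differential E y z v = a 0
            rw [hx, hy, hu]
            ring
          · exact Fin.forall_fin_two.2 ⟨hp, hx⟩
          · exact Fin.forall_fin_two.2 ⟨hq, hy⟩ }
  refine ⟨U, hU, hm, c, fun z hzU => ?_, ⟨![p, x], Fin.forall_fin_two.2 ⟨sp, sx⟩,
    fun z _ => Fin.forall_fin_two.2 ⟨rfl, rfl⟩⟩, ![q, y], Fin.forall_fin_two.2 ⟨sq, sy⟩,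
    fun z _ => Fin.forall_fin_two.2 ⟨rfl, rfl⟩⟩
  rw [(hz z hzU).2]
  congr 1
  ext g
  simp only [Coframe.generators, Set.mem_union, Set.mem_insert_iff, Set.mem_singleton_iff,
    Set.mem_ofPred_eq]
  constructor
  · rintro (h | h)
    exacts [Or.inl ⟨0, h⟩, Or.inr h]
  · rintro (⟨k, h⟩ | h)
    · rw [Subsingleton.elim k 0] at h
      exact Or.inl h
    · exact Or.inr h

/-- The σ of a lift are pullbacks, and the pullback of dg is d(g ∘ f). -/
theorem Coframe.IsLift.isExact {f : M → M'} {U' : Set M'} {c : Coframe (E := E) (s + 1) U}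
    {c' : Coframe (E := E') s U'} (hl : c.IsLift f c') (hU' : IsOpen U')
    (hf : ContMDiff 𝓘(ℝ, E) 𝓘(ℝ, E') ∞ f) {g : Fin 2 → M' → ℝ} (hg : c'.IsExact g) :
    c.IsExact fun k => g k ∘ f where
  smooth k := (hg.smooth k).comp hf.contMDiffOn hl.maps
  eq y hy k := by
    rw [differential_comp (hf.mdifferentiableAt (by simp))
      (ContMDiffOn.mdifferentiableAt' hU' (hg.smooth k) (hl.maps y hy)), ← hg.eq _ (hl.maps y hy),
      hl.σ y hy]

end FirstIntegralFrame
end EDS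

namespace EDS

/-! ### Three independent first integrals on the prolongation of an exact coframe. -/

namespace ProlongationChart

variable {E : Type*} [NormedAddCommGroup E] [NormedSpace ℝ E] [FiniteDimensional ℝ E]
  {M : Type*} [TopologicalSpace M] [ChartedSpace E M] [IsManifold 𝓘(ℝ, E) ∞ M] {s : ℕ}
  {H : HyperbolicSystem E M s} (d : ProlongationChart H)

open Prolongation

/-- The integral element at `y` with slopes `a`, `b`, as an element of the prolongation space. -/
def point (a b : ℝ) (y : M) : Prolongation H := d.chart.symm (d.φ y, a, b)

/-- The set of points of `M` over which the chart is defined. -/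
def baseSet : Set M := d.φ.source ∩ d.U

theorem isOpen_baseSet : IsOpen d.baseSet := (isOpen_extChartAt_source _).inter d.isOpen

variable {d} {a b : ℝ} {y : M}

theorem point_mem_target (hy : y ∈ d.baseSet) : (d.φ y, a, b) ∈ d.chart.target :=
  ⟨d.φ.map_source hy.1, by simpa only [d.φ.left_inv hy.1] using hy.2⟩

theorem point_mem (hy : y ∈ d.baseSet) : d.point a b y ∈ d.chart.source :=
  d.chart.map_target (point_mem_target hy)

theorem slopes_point (hy : y ∈ d.baseSet) : d.slopes (d.point a b y) = (a, b) :=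
  congrArg Prod.snd (d.chart.right_inv (point_mem_target (a := a) (b := b) hy))

theorem proj_point (hy : y ∈ d.baseSet) : proj (d.point a b y) = y := by
  have h : d.φ (proj (d.point a b y)) = d.φ y :=
    congrArg Prod.fst (d.chart.right_inv (point_mem_target (a := a) (b := b) hy))
  exact d.φ.injOn (point_mem hy).1 hy.1 h

theorem point_slopes {e : Prolongation H} (he : e ∈ d.chart.source) :
    d.point (d.slopes e).1 (d.slopes e).2 e.base = e := d.chart.left_inv he

theorem base_mem {e : Prolongation H} (he : e ∈ d.chart.source) : e.base ∈ d.baseSet :=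
  ⟨he.1, he.2.1⟩

variable (d)

theorem contMDiffOn_point (a b : ℝ) :
    ContMDiffOn 𝓘(ℝ, E) 𝓘(ℝ, E × ℝ × ℝ) ∞ (d.point a b) d.baseSet := by
  have h1 : ContMDiffOn 𝓘(ℝ, E) 𝓘(ℝ, E) ∞ d.φ d.baseSet :=
    (contMDiffOn_extChartAt (n := ∞) (x := d.center.base)).mono fun y hy => by
      have := hy.1
      rwa [φ, extChartAt_source] at this
  have h2 : ContMDiffOn 𝓘(ℝ, E) 𝓘(ℝ, ℝ × ℝ) ∞ (fun _ : M => (a, b)) d.baseSet := contMDiffOn_const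
  exact d.contMDiffOn_chart_symm.comp (h1.prodMk_space h2) fun y hy => point_mem_target hy

theorem contMDiff_point (a : ℝ) (hy : y ∈ d.baseSet) :
    ContMDiff 𝓘(ℝ, ℝ) 𝓘(ℝ, E × ℝ × ℝ) ∞ (fun b => d.point a b y) := by
  rw [← contMDiffOn_univ]
  have h : ContDiff ℝ ∞ (fun b : ℝ => (d.φ y, a, b)) := by fun_prop
  exact d.contMDiffOn_chart_symm.comp (h.contMDiff.contMDiffOn (s := Set.univ))
    fun b _ => point_mem_target hy

variable {d}

theorem mem_prol_ker {e : Prolongation H} (he : e ∈ d.chart.source)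
    {v : E × ℝ × ℝ} (h1 : dproj e v ∈ e.plane) (h2 : pb (d.coframe.σ d.i) e v = 0)
    (h3 : d.slopeForm e v = 0) : v ∈ d.prol.ker e :=
  ⟨(d.prol_θ_iff he).2 h1, Fin.forall_fin_two.2 ⟨h2, h3⟩⟩

section Exact

variable {g : Fin 2 → M → ℝ}

/-- Exact forms are closed, so dσ contributes nothing and da itself belongs to the singular system.
-/
theorem curv_eq_zero (hg : d.coframe.IsExact g) {e : Prolongation H} (he : e ∈ d.chart.source) :
    d.curv e = 0 := by
  have h : ∀ k v w, extDeriv₁ (d.coframe.σ k) e.base v w = 0 := fun k v w => by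
    rw [extDeriv₁_congr (β := differential E (g k))
      (by filter_upwards [d.isOpen.mem_nhds he.2.1] with y hy using hg.eq y hy k)]
    exact extDeriv₁_differential d.isOpen (hg.smooth k) he.2.1 v w
  rw [curv, h, h, mul_zero, sub_zero]

theorem slopeForm_eq (hg : d.coframe.IsExact g) {e : Prolongation H} (he : e ∈ d.chart.source) :
    d.slopeForm e = differential (E × ℝ × ℝ) d.slopeFun e := by
  rw [slopeForm, curv_eq_zero hg he, zero_smul, add_zero]

variable (d g) in
/-- The functions `g₁`, `g₂` and the slope on the prolongation space. -/
def invariants : Fin 3 → Prolongation H → ℝ := ![g d.i ∘ proj, d.slopeFun, g (1 - d.i) ∘ proj]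

theorem differential_comp_proj (hg : d.coframe.IsExact g) {e : Prolongation H}
    (he : e ∈ d.chart.source) (k : Fin 2) :
    differential (E × ℝ × ℝ) (g k ∘ proj) e = pb (d.coframe.σ k) e := by
  rw [differential_comp (contMDiff_proj.mdifferentiableAt (by simp))
    (ContMDiffOn.mdifferentiableAt' d.isOpen (hg.smooth k) he.2.1)]
  exact congrArg (fun α => ContinuousLinearMap.comp α (dproj e)) (hg.eq _ he.2.1 k).symm

theorem contMDiffOn_invariants (hg : d.coframe.IsExact g) (k : Fin 3) :
    ContMDiffOn 𝓘(ℝ, E × ℝ × ℝ) 𝓘(ℝ, ℝ) ∞ (d.invariants g k) d.chart.source := by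
  have h : ∀ k, ContMDiffOn 𝓘(ℝ, E × ℝ × ℝ) 𝓘(ℝ, ℝ) ∞ (g k ∘ proj (H := H)) d.chart.source :=
    fun k => (hg.smooth k).comp d.contMDiffOn_proj fun e he => he.2.1
  fin_cases k
  exacts [h _, d.contMDiffOn_slopeFun, h _]

/-- In the prolonged coframe dg_i and da are the two σ-forms, and dg_{1-i} is the contact form plus
a times dg_i. -/
theorem differential_invariants_mem (hg : d.coframe.IsExact g) {e : Prolongation H}
    (he : e ∈ d.chart.source) (k : Fin 3) :
    differential (E × ℝ × ℝ) (d.invariants g k) e ∈ d.prol.sing e := by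
  rw [d.prol.mem_sing he]
  intro v hv
  have h1 : pb (d.coframe.σ d.i) e v = 0 := hv.2 0
  have h2 : d.slopeForm e v = 0 := hv.2 1
  have h3 : d.contactForm e v = 0 := ((d.mem_plane_iff he).1 ((d.prol_θ_iff he).1 hv.1)).2.1
  fin_cases k
  · exact (DFunLike.congr_fun (differential_comp_proj hg he _) v).trans h1
  · exact (DFunLike.congr_fun (slopeForm_eq hg he) v).symm.trans h2
  · refine (DFunLike.congr_fun (differential_comp_proj hg he _) v).trans ?_
    change pb (d.coframe.σ (1 - d.i)) e v - d.slopeFun e * pb (d.coframe.σ d.i) e v = 0 at h3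
    rwa [h1, mul_zero, sub_zero] at h3

theorem linearIndependent_invariants (hg : d.coframe.IsExact g) {e : Prolongation H}
    (he : e ∈ d.chart.source) :
    LinearIndependent ℝ fun k => differential (E × ℝ × ℝ) (d.invariants g k) e := by
  rw [Fintype.linearIndependent_iff]
  intro r hr
  have key : ∀ v, r 0 * d.prol.σ 0 e v + r 1 * d.prol.σ 1 e v +
      r 2 * (d.prol.θ (Fin.natAdd s 0) e v + d.slopeFun e * d.prol.σ 0 e v) = 0 := fun v => by
    have h1 := DFunLike.congr_fun hr v
    have e0 : differential (E × ℝ × ℝ) (d.invariants g 0) e v = d.prol.σ 0 e v :=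
      DFunLike.congr_fun (differential_comp_proj hg he _) v
    have e1 : differential (E × ℝ × ℝ) (d.invariants g 1) e v = d.prol.σ 1 e v :=
      (DFunLike.congr_fun (slopeForm_eq hg he) v).symm
    have e2 : differential (E × ℝ × ℝ) (d.invariants g 2) e v =
        d.prol.θ (Fin.natAdd s 0) e v + d.slopeFun e * d.prol.σ 0 e v := by
      refine (DFunLike.congr_fun (differential_comp_proj hg he _) v).trans ?_
      rw [d.prol_θ_right]
      change _ = pb (d.coframe.σ (1 - d.i)) e v - d.slopeFun e * pb (d.coframe.σ d.i) e v +
        d.slopeFun e * pb (d.coframe.σ d.i) e v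
      rw [sub_add_cancel]
    rw [← e0, ← e1] at *
    simpa [Fin.sum_univ_three, e2] using h1
  -- The system is triangular. The vector dual to the contact form isolates the coefficient of
  -- dg_{1-i}, and the vectors dual to σ then give the other two.
  have h2 := key (d.prol.eθ (Fin.natAdd s 0) e)
  simp [Coframe.eθ, d.prol.θ_vec _ he, d.prol.σ_vec _ he] at h2
  have h0 := key (d.prol.eσ 0 e)
  simp [Coframe.eσ, d.prol.θ_vec _ he, d.prol.σ_vec _ he, h2] at h0
  have h1 := key (d.prol.eσ 1 e)
  simp [Coframe.eσ, d.prol.θ_vec _ he, d.prol.σ_vec _ he, h2] at h1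
  intro k
  fin_cases k
  exacts [h0, h1, h2]

end Exact

end ProlongationChart

end EDS

namespace EDS

/-! ### The prolongation has no further first integrals. -/

namespace ProlongationChart

variable {E : Type*} [NormedAddCommGroup E] [NormedSpace ℝ E] [FiniteDimensional ℝ E]
  {M : Type*} [TopologicalSpace M] [ChartedSpace E M] [IsManifold 𝓘(ℝ, E) ∞ M] {s : ℕ}
  {H : HyperbolicSystem E M s} {d : ProlongationChart H}

open Prolongation

theorem dproj_tangentMap_point (a b : ℝ) {y : M} (hy : y ∈ d.baseSet) (v : E) :
    dproj (d.point a b y) (tangentMap E (E × ℝ × ℝ) (d.point a b) y v) = v := by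
  have d1 := ContMDiffOn.mdifferentiableAt' d.isOpen_baseSet (d.contMDiffOn_point a b) hy
  have c1 := mfderiv_comp y
    ((contMDiff_proj (H := H)).mdifferentiableAt (x := d.point a b y) (by simp)) d1
  have c2 : mfderiv 𝓘(ℝ, E) 𝓘(ℝ, E) (proj ∘ d.point a b) y = mfderiv 𝓘(ℝ, E) 𝓘(ℝ, E) id y := by
    refine Filter.EventuallyEq.mfderiv_eq ?_
    filter_upwards [d.isOpen_baseSet.mem_nhds hy] with y' hy'
    exact proj_point hy'
  rw [mfderiv_id] at c2
  exact DFunLike.congr_fun (c1.symm.trans c2) v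

theorem differential_slopeFun_point (a b : ℝ) {y : M} (hy : y ∈ d.baseSet) (v : E) :
    differential (E × ℝ × ℝ) d.slopeFun (d.point a b y)
      (tangentMap E (E × ℝ × ℝ) (d.point a b) y v) = 0 := by
  have d1 := ContMDiffOn.mdifferentiableAt' d.isOpen_baseSet (d.contMDiffOn_point a b) hy
  have d2 := ContMDiffOn.mdifferentiableAt' d.isOpen_source d.contMDiffOn_slopeFun
    (point_mem (a := a) (b := b) hy)
  have c1 := differential_comp d1 d2
  rw [differential_congr (g := fun _ => a) (by
    filter_upwards [d.isOpen_baseSet.mem_nhds hy] with y' hy'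
    exact congrArg Prod.fst (slopes_point (a := a) (b := b) hy'))] at c1
  have c2 : differential E (fun _ : M => a) y = 0 := mfderiv_const
  exact (DFunLike.congr_fun (c1.symm.trans c2) v)

/-- The vector ∂/∂b moves neither the base point nor the first slope. For an exact coframe it is
therefore characteristic (`mem_ker_of_vertical`). -/
theorem tangentMap_point_fibre (a b : ℝ) {y : M} (hy : y ∈ d.baseSet) :
    dproj (d.point a b y) (tangentMap ℝ (E × ℝ × ℝ) (fun t => d.point a t y) b 1) = 0 ∧
      differential (E × ℝ × ℝ) d.slopeFun (d.point a b y)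
        (tangentMap ℝ (E × ℝ × ℝ) (fun t => d.point a t y) b 1) = 0 := by
  have d1 : MDifferentiableAt 𝓘(ℝ, ℝ) 𝓘(ℝ, E × ℝ × ℝ) (fun t => d.point a t y) b :=
    (d.contMDiff_point a hy).mdifferentiableAt (by simp)
  constructor
  · have c1 := mfderiv_comp b
      ((contMDiff_proj (H := H)).mdifferentiableAt (x := d.point a b y) (by simp)) d1
    have c2 : mfderiv 𝓘(ℝ, ℝ) 𝓘(ℝ, E) (proj ∘ fun t => d.point a t y) b = 0 := by
      have : (proj ∘ fun t => d.point a t y) = fun _ => y := funext fun t => proj_point hy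
      rw [this]
      exact mfderiv_const
    exact DFunLike.congr_fun (c1.symm.trans c2) (1 : ℝ)
  · have d2 := ContMDiffOn.mdifferentiableAt' d.isOpen_source d.contMDiffOn_slopeFun
      (point_mem (a := a) (b := b) hy)
    have c1 := differential_comp d1 d2
    have c2 : differential ℝ (d.slopeFun ∘ fun t => d.point a t y) b = 0 := by
      have : (d.slopeFun ∘ fun t => d.point a t y) = fun _ => a :=
        funext fun t => congrArg Prod.fst (slopes_point hy)
      rw [this]
      exact mfderiv_const
    exact DFunLike.congr_fun (c1.symm.trans c2) (1 : ℝ)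

variable {g : Fin 2 → M → ℝ}

/-- A tangent vector that is vertical and does not change the first slope is characteristic. -/
theorem mem_ker_of_vertical (hg : d.coframe.IsExact g) {e : Prolongation H}
    (he : e ∈ d.chart.source) {v : E × ℝ × ℝ} (h1 : dproj e v = 0)
    (h2 : differential (E × ℝ × ℝ) d.slopeFun e v = 0) : v ∈ d.prol.ker e := by
  refine mem_prol_ker he ?_ ?_ ?_
  · rw [h1]; exact Submodule.zero_mem _
  · change d.coframe.σ d.i _ (dproj _ _) = 0
    rw [h1, map_zero]
  · rw [slopeForm_eq hg he, h2]

/-- A first integral of the singular system of the prolongation that vanishes on the characteristic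
vectors is locally independent of the second slope. -/
theorem exists_point_const (hg : d.coframe.IsExact g) {e : Prolongation H}
    (he : e ∈ d.chart.source) {O : Set (Prolongation H)} (hO : IsOpen O) (heO : e ∈ O)
    {F : Prolongation H → ℝ} (hF : ContMDiffOn 𝓘(ℝ, E × ℝ × ℝ) 𝓘(ℝ, ℝ) ∞ F O)
    (hFd : ∀ y ∈ O, ∀ v ∈ d.prol.ker y, differential (E × ℝ × ℝ) F y v = 0) :
    ∃ (N : Set M) (b : ℝ), IsOpen N ∧ e.base ∈ N ∧ N ⊆ d.baseSet ∧ b ≠ (d.slopes e).2 ∧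
      ∀ y ∈ N, d.point (d.slopes e).1 (d.slopes e).2 y ∈ O ∧ d.point (d.slopes e).1 b y ∈ O ∧
        F (d.point (d.slopes e).1 (d.slopes e).2 y) = F (d.point (d.slopes e).1 b y) := by
  set a := (d.slopes e).1
  set b₀ := (d.slopes e).2
  have hcont : ContinuousOn (fun w : M × ℝ => d.point a w.2 w.1) (d.baseSet ×ˢ Set.univ) := by
    refine d.contMDiffOn_chart_symm.continuousOn.comp (f := fun w : M × ℝ => (d.φ w.1, a, w.2))
      ?_ fun w hw => point_mem_target hw.1
    refine ContinuousOn.prodMk ?_ (by fun_prop)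
    exact ((continuousOn_extChartAt d.center.base).comp continuousOn_fst fun w hw => hw.1.1)
  have hopen := hcont.isOpen_inter_preimage (d.isOpen_baseSet.prod isOpen_univ) hO
  obtain ⟨N, T, hN, hT, heN, heT, hNT⟩ := isOpen_prod_iff.1 hopen e.base b₀
    ⟨⟨base_mem he, trivial⟩, by
      change d.point a b₀ e.base ∈ O
      rwa [point_slopes he]⟩
  obtain ⟨ε, hε, hball⟩ := Metric.isOpen_iff.1 hT b₀ heT
  -- Any second value of b in the ball would do. It must differ from b₀ so that two distinct
  -- characteristic directions become available.
  have hb : b₀ + ε / 2 ∈ Metric.ball b₀ ε := by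
    rw [Metric.mem_ball, Real.dist_eq, add_sub_cancel_left, abs_of_pos (by positivity)]
    linarith
  have hpt : ∀ y ∈ N, ∀ t ∈ Metric.ball b₀ ε, y ∈ d.baseSet ∧ d.point a t y ∈ O :=
    fun y hy t ht => ⟨(hNT (Set.mk_mem_prod hy (hball ht))).1.1, (hNT (Set.mk_mem_prod hy (hball ht))).2⟩
  have hb₀ := Metric.mem_ball_self (x := b₀) hε
  refine ⟨N, b₀ + ε / 2, hN, heN, fun y hy => (hpt y hy _ hb₀).1, by linarith, fun y hy =>
    ⟨(hpt y hy _ hb₀).2, (hpt y hy _ hb).2, ?_⟩⟩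
  -- F is annihilated by the characteristic vector ∂/∂b, so its derivative in b vanishes on a
  -- connected interval.
  have hder : ∀ t ∈ Metric.ball b₀ ε,
      MDifferentiableAt 𝓘(ℝ, ℝ) 𝓘(ℝ, ℝ) (F ∘ fun t => d.point a t y) t ∧
      differential ℝ (F ∘ fun t => d.point a t y) t = 0 := by
    intro t ht
    obtain ⟨hyb, htO⟩ := hpt y hy t ht
    have d1 : MDifferentiableAt 𝓘(ℝ, ℝ) 𝓘(ℝ, E × ℝ × ℝ) (fun t => d.point a t y) t :=
      (d.contMDiff_point a hyb).mdifferentiableAt (by simp)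
    have d2 := ContMDiffOn.mdifferentiableAt' hO hF htO
    refine ⟨d2.comp t d1, ?_⟩
    rw [differential_comp d1 d2]
    refine ContinuousLinearMap.ext_ring ?_
    obtain ⟨h1, h2⟩ := tangentMap_point_fibre a t hyb
    have hsrc := point_mem (a := a) (b := t) hyb
    exact hFd _ htO _ (mem_ker_of_vertical hg hsrc h1 h2)
  exact Metric.isOpen_ball.is_const_of_fderiv_eq_zero (𝕜 := ℝ)
    (f := F ∘ fun t => d.point a t y) (convex_ball b₀ ε).isPreconnected
    (fun t ht => (mdifferentiableAt_iff_differentiableAt.1 (hder t ht).1).differentiableWithinAt)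
    (fun t ht => (mfderiv_eq_fderiv.symm.trans (hder t ht).2)) hb₀ hb

/-- The first integrals of the singular system of the prolongation depend only on `g₁`, `g₂` and
the slope. -/
theorem differential_eq_zero (hg : d.coframe.IsExact g) (hcomp : d.coframe.IsComplete)
    {e : Prolongation H} (he : e ∈ d.chart.source) {O : Set (Prolongation H)} (hO : IsOpen O)
    (heO : e ∈ O) {F : Prolongation H → ℝ} (hF : ContMDiffOn 𝓘(ℝ, E × ℝ × ℝ) 𝓘(ℝ, ℝ) ∞ F O)
    (hFd : ∀ y ∈ O, ∀ v ∈ d.prol.ker y, differential (E × ℝ × ℝ) F y v = 0) {v : E × ℝ × ℝ}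
    (hv : ∀ k, d.coframe.σ k e.base (dproj e v) = 0)
    (hv' : differential (E × ℝ × ℝ) d.slopeFun e v = 0) :
    differential (E × ℝ × ℝ) F e v = 0 := by
  obtain ⟨N, b, hN, heN, hNb, hne, hconst⟩ := exists_point_const hg he hO heO hF hFd
  set a := (d.slopes e).1
  set b₀ := (d.slopes e).2
  have hpe : d.point a b₀ e.base = e := point_slopes he
  -- F restricted to constant slopes, viewed as a function on the base. By the choice of b and N,
  -- the slope b gives the same function.
  set G : M → ℝ := F ∘ d.point a b₀ with hG
  have hGs : ContMDiffOn 𝓘(ℝ, E) 𝓘(ℝ, ℝ) ∞ G N :=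
    hF.comp ((d.contMDiffOn_point a b₀).mono hNb) fun y hy => (hconst y hy).1
  have hGd : ∀ t, (∀ y ∈ N, d.point a t y ∈ O) → ∀ y ∈ N, ∀ u,
      differential E (F ∘ d.point a t) y u = differential (E × ℝ × ℝ) F (d.point a t y)
        (tangentMap E (E × ℝ × ℝ) (d.point a t) y u) := fun t ht y hy u =>
    DFunLike.congr_fun (differential_comp
      (ContMDiffOn.mdifferentiableAt' d.isOpen_baseSet (d.contMDiffOn_point a t) (hNb hy))
      (ContMDiffOn.mdifferentiableAt' hO hF (ht y hy))) u
  -- The section with constant slopes a, t carries the direction e_j + t e_{1-j} of the τ-plane into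
  -- the characteristic plane of the prolongation. It preserves a and the vector lies in the
  -- integral element.
  have hslope : ∀ t, (∀ y ∈ N, d.point a t y ∈ O) → ∀ y ∈ N,
      differential E (F ∘ d.point a t) y
        (d.coframe.eτ d.j y + t • d.coframe.eτ (1 - d.j) y) = 0 := by
    intro t ht y hy
    have hyU : y ∈ d.U := (hNb hy).2
    have hsrc := point_mem (a := a) (b := t) (hNb hy)
    have hpy : proj (d.point a t y) = y := proj_point (hNb hy)
    have hsl := slopes_point (a := a) (b := t) (hNb hy)
    rw [hGd t ht y hy]
    refine hFd _ (ht y hy) _ (mem_prol_ker hsrc ?_ ?_ ?_)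
    · rw [dproj_tangentMap_point a t (hNb hy),
        ← d.plane_eq hsrc.2.1 hsrc.2.2.1 hsrc.2.2.2, hsl]
      change _ ∈ d.planeAt (proj (d.point a t y)) a t
      rw [hpy, planeAt, mem_slopePlane]
      have hj := fin2_ne d.j
      refine ⟨fun k => ?_, ?_, ?_⟩ <;>
        simp [Coframe.eτ, d.coframe.θ_vec _ hyU, d.coframe.σ_vec _ hyU, d.coframe.τ_vec _ hyU, hj,
          hj.symm]
    · change d.coframe.σ d.i (proj (d.point a t y)) (dproj _ _) = 0
      rw [hpy, dproj_tangentMap_point a t (hNb hy)]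
      simp [Coframe.eτ, d.coframe.σ_vec _ hyU]
    · rw [slopeForm_eq hg hsrc]
      exact differential_slopeFun_point a t (hNb hy) _
  have hGsing : ∀ y ∈ N, differential E G y ∈ d.coframe.sing y := by
    intro y hy
    have hyU : y ∈ d.U := (hNb hy).2
    have h1 := hslope b₀ (fun y hy => (hconst y hy).1) y hy
    have h2 := hslope b (fun y hy => (hconst y hy).2.1) y hy
    rw [← differential_congr (f := G) (by
      filter_upwards [hN.mem_nhds hy] with y' hy' using (hconst y' hy').2.2)] at h2
    change differential E G y _ = 0 at h1
    rw [map_add, map_smul, smul_eq_mul] at h1 h2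
    -- Subtracting the equations for the two slopes b and b₀ leaves a nonzero multiple of this
    -- value. Hence dG kills the whole τ-plane, and completeness applies to G.
    have h3 : differential E G y (d.coframe.eτ (1 - d.j) y) = 0 := by
      have : (b - b₀) * differential E G y (d.coframe.eτ (1 - d.j) y) = 0 := by linarith
      exact (mul_eq_zero.1 this).resolve_left (sub_ne_zero.2 hne)
    have h4 : differential E G y (d.coframe.eτ d.j y) = 0 := by
      rwa [h3, mul_zero, add_zero] at h1
    rw [d.coframe.mem_sing hyU]
    intro u hu
    have h5 : ∀ k, differential E G y (d.coframe.eτ k y) = 0 := fun k => by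
      rcases fin2_cases d.j k with rfl | rfl <;> assumption
    rw [d.coframe.eq_sum hyU u]
    simp [hu.1, hu.2, h5]
  have hGv := hcomp e.base he.2.1 N G hN (fun y hy => (hNb hy).2) heN hGs hGsing (dproj e v) hv
  rw [hG, hGd b₀ (fun y hy => (hconst y hy).1) _ heN] at hGv
  -- Vectors with the same projection and no change of the first slope differ by a multiple of ∂/∂b,
  -- which dF annihilates. So v may be replaced by the image of its projection under the section.
  have hw : ∀ w : E × ℝ × ℝ, dproj e w = dproj e v →
      differential (E × ℝ × ℝ) d.slopeFun e w = 0 → differential (E × ℝ × ℝ) F e w = 0 →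
      differential (E × ℝ × ℝ) F e v = 0 := by
    intro w h1 h2 h3
    have h4 : differential (E × ℝ × ℝ) F e (v - w) = 0 := by
      have h5 : dproj e (v - w) = 0 := by rw [map_sub, h1, sub_self]
      exact hFd e heO _ (mem_ker_of_vertical hg he h5 (by rw [map_sub, hv', h2, sub_zero]))
    rw [map_sub, h3, sub_zero] at h4
    exact h4
  have k1 := dproj_tangentMap_point a b₀ (base_mem he) (dproj e v)
  have k2 := differential_slopeFun_point a b₀ (base_mem he) (dproj e v)
  rw [hpe] at k1 k2 hGv
  exact hw _ k1 k2 hGv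

/-- The bundle of first integrals of the singular system of the prolongation has rank 3. -/
theorem firstIntegrals_prol (hg : d.coframe.IsExact g) (hcomp : d.coframe.IsComplete)
    {e : Prolongation H} (he : e ∈ d.chart.source) :
    firstIntegrals d.prol.sing e =
      Submodule.span ℝ (Set.range fun k => differential (E × ℝ × ℝ) (d.invariants g k) e) := by
  apply le_antisymm
  · refine Submodule.span_le.2 ?_
    rintro _ ⟨O, F, hO, heO, hF, hFd, rfl⟩
    set S := Submodule.span ℝ (Set.range fun k => differential (E × ℝ × ℝ) (d.invariants g k) e)
    have hO' := hO.inter d.isOpen_source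
    have hz := fun {v} => differential_eq_zero (v := v) hg hcomp he hO' ⟨heO, he⟩
      (hF.mono Set.inter_subset_left) fun y hy => (d.prol.mem_sing hy.2).1 (hFd y hy.1)
    have hmem := fun k => Submodule.subset_span (R := ℝ)
      (Set.mem_range_self (f := fun k => differential (E × ℝ × ℝ) (d.invariants g k) e) k)
    have hker : ∀ v, (∀ k, differential (E × ℝ × ℝ) (d.invariants g k) e v = 0) →
        differential (E × ℝ × ℝ) F e v = 0 := by
      intro v hv
      refine hz (fun k => ?_) (hv 1)
      have e1 := fun k => DFunLike.congr_fun (differential_comp_proj hg he k) v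
      rcases fin2_cases d.i k with rfl | rfl
      · exact (e1 _).symm.trans (hv 0)
      · exact (e1 _).symm.trans (hv 2)
    -- A covector that vanishes on the common kernel of finitely many covectors is a combination of
    -- them.
    have := mem_span_of_iInf_ker_le_ker (𝕜 := ℝ)
      (L := fun k => (differential (E × ℝ × ℝ) (d.invariants g k) e).toLinearMap)
      (K := (differential (E × ℝ × ℝ) F e).toLinearMap) (fun v hv => hker v fun k => by
        simpa using (Submodule.mem_iInf _).1 hv k)
    obtain ⟨r, hr⟩ := (Submodule.mem_span_range_iff_exists_fun ℝ).1 this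
    refine (Submodule.mem_span_range_iff_exists_fun ℝ).2 ⟨r, ?_⟩
    refine ContinuousLinearMap.ext fun v => ?_
    have := LinearMap.congr_fun hr v
    simpa using this
  · refine Submodule.span_le.2 ?_
    rintro _ ⟨k, rfl⟩
    exact differential_mem_firstIntegrals d.isOpen_source (contMDiffOn_invariants hg k)
      (fun y hy => differential_invariants_mem hg hy k) he

end ProlongationChart

end EDS

namespace EDS

/-! ### Semi-basic first integrals: descent and dimension count. -/

section Descent

variable {E : Type*} [NormedAddCommGroup E] [NormedSpace ℝ E] [FiniteDimensional ℝ E]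
  {E' : Type*} [NormedAddCommGroup E'] [NormedSpace ℝ E'] [FiniteDimensional ℝ E']
  {M : Type*} [TopologicalSpace M] [ChartedSpace E M] [IsManifold 𝓘(ℝ, E) ∞ M]
  {M' : Type*} [TopologicalSpace M'] [ChartedSpace E' M'] [IsManifold 𝓘(ℝ, E') ∞ M']
  {s : ℕ} {U : Set M} {U' : Set M'} {f : M → M'}

/-- A function with prescribed non-vanishing derivative in the direction of a non-zero vector. -/
theorem exists_differential_ne_zero (x : M) {v : E} (hv : v ≠ 0) :
    ∃ (O : Set M) (g : M → ℝ), IsOpen O ∧ x ∈ O ∧ ContMDiffOn 𝓘(ℝ, E) 𝓘(ℝ, ℝ) ∞ g O ∧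
      differential E g x v ≠ 0 := by
  have hinv : (tangentMap E E (extChartAt 𝓘(ℝ, E) x) x).IsInvertible :=
    isInvertible_mfderiv_extChartAt (mem_extChartAt_source _)
  have hne : tangentMap E E (extChartAt 𝓘(ℝ, E) x) x v ≠ 0 := fun h =>
    hv (hinv.bijective.1 (h.trans (map_zero _).symm))
  obtain ⟨l, hl⟩ := SeparatingDual.exists_ne_zero (R := ℝ) hne
  refine ⟨(chartAt E x).source, l ∘ extChartAt 𝓘(ℝ, E) x, (chartAt E x).open_source,
    mem_chart_source _ _, (l.contDiff (n := ∞)).contMDiff.comp_contMDiffOn contMDiffOn_extChartAt,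
    ?_⟩
  have h := tangentMap_clm_comp (mdifferentiableAt_extChartAt (I := 𝓘(ℝ, E)) (mem_chart_source E x)) l
  exact (DFunLike.congr_fun h v).trans_ne hl

/-- Independent semi-basic first integrals of the singular system of a lift descend. -/
theorem Coframe.IsLift.le_finrank_firstIntegrals {c : Coframe (E := E) (s + 1) U}
    {c' : Coframe (E := E') s U'} (hl : c.IsLift f c')
    (hdim : Module.finrank ℝ E = Module.finrank ℝ E' + 1)
    (hf : ContMDiffOn 𝓘(ℝ, E) 𝓘(ℝ, E') ∞ f U) {n : ℕ} {T : Fin n → M → ℝ} {O : Set M}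
    (hO : IsOpen O) (hOU : O ⊆ U) (hT : ∀ k, ContMDiffOn 𝓘(ℝ, E) 𝓘(ℝ, ℝ) ∞ (T k) O)
    (hd : ∀ k, ∀ y ∈ O, differential E (T k) y ∈ c.sing y)
    (hb : ∀ k, ∀ y ∈ O, differential E (T k) y ∈ semibasic (E' := E') f y) {x : M} (hx : x ∈ O)
    (hli : LinearIndependent ℝ fun k => differential E (T k) x) :
    n ≤ Module.finrank ℝ (firstIntegrals c'.sing (f x)) := by
  have hX : c.eθ 0 x ≠ 0 := fun h => by
    have := c.θ_vec (Pi.single 0 1, 0, 0) (hOU hx) 0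
    change c.θ 0 x (c.eθ 0 x) = _ at this
    simp [h] at this
  -- An auxiliary function that varies along the fibre, needed only to cut out a local section. It
  -- has no relation to the differential system.
  obtain ⟨N, g, hN, hxN, hg, hgx⟩ := exists_differential_ne_zero x hX
  let L : (E' →L[ℝ] ℝ) →ₗ[ℝ] (E →L[ℝ] ℝ) :=
    { toFun := fun β => β.comp (tangentMap E E' f x)
      map_add' := fun _ _ => rfl
      map_smul' := fun _ _ => rfl }
  have hle : Submodule.span ℝ (Set.range fun k => differential E (T k) x) ≤
      (firstIntegrals c'.sing (f x)).map L := by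
    rw [Submodule.span_le]
    rintro _ ⟨k, rfl⟩
    obtain ⟨β, hβ, a, he⟩ := hl.exists_firstIntegral (hO.inter hN)
      (Set.inter_subset_left.trans hOU) hdim (hf.mono (Set.inter_subset_left.trans hOU))
      (hg.mono Set.inter_subset_right) ((hT k).mono Set.inter_subset_left) ⟨hx, hxN⟩ hgx
      fun y hy => ⟨0, by
        rw [zero_smul, sub_zero]
        exact ⟨hd k y hy.1, (hl.mem_semibasic (hOU hy.1)).1 (hb k y hy.1)⟩⟩
    have h1 := DFunLike.congr_fun he (c.eθ 0 x)
    rw [(hl.mem_semibasic (hOU hx)).1 (hb k x hx)] at h1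
    -- Evaluating on the fibre vector kills both semi-basic terms and forces a = 0, so the
    -- differential is exactly a pullback.
    have h2 : a * differential E g x (c.eθ 0 x) = 0 := by
      simpa [hl.tangentMap_eθ (hOU hx)] using h1.symm
    refine ⟨β, hβ, ?_⟩
    change β.comp (tangentMap E E' f x) = differential E (T k) x
    rw [he, (mul_eq_zero.1 h2).resolve_right hgx, zero_smul, zero_add]
  have h1 := Submodule.finrank_mono hle
  rw [finrank_span_eq_card hli, Fintype.card_fin] at h1
  exact h1.trans (Submodule.finrank_map_le L _)

/-- The semi-basic part of a 3-dimensional space of covectors has dimension 2 if and only if it is a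
proper subspace. -/
theorem Coframe.IsLift.finrank_inf_semibasic {c : Coframe (E := E) (s + 1) U}
    {c' : Coframe (E := E') s U'} (hl : c.IsLift f c') {x : M} (hx : x ∈ U)
    {α : Fin 3 → E →L[ℝ] ℝ} (hα : LinearIndependent ℝ α) :
    Module.finrank ℝ ↥(Submodule.span ℝ (Set.range α) ⊓ semibasic (E' := E') f x) = 2 ↔
      ∃ k, α k ∉ semibasic (E' := E') f x := by
  have hcard := finrank_span_eq_card hα
  rw [Fintype.card_fin] at hcard
  set F := Submodule.span ℝ (Set.range α)
  have hmem : ∀ k, α k ∈ F := fun k => Submodule.subset_span ⟨k, rfl⟩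
  constructor
  · intro h
    by_contra! hk
    have hle : F ≤ semibasic (E' := E') f x := Submodule.span_le.2 (by rintro _ ⟨k, rfl⟩; exact hk k)
    rw [inf_eq_left.2 hle] at h
    omega
  · rintro ⟨k, hk⟩
    rw [hl.mem_semibasic hx] at hk
    -- The semi-basic part is the kernel of evaluation on the fibre vector. A nonzero functional on
    -- a 3-dimensional space has a kernel of dimension 2.
    let ev : F →ₗ[ℝ] ℝ :=
      { toFun := fun β => β.1 (c.eθ 0 x)
        map_add' := fun _ _ => rfl
        map_smul' := fun _ _ => rfl }
    have hker : (LinearMap.ker ev).map F.subtype = F ⊓ semibasic (E' := E') f x := by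
      ext β
      rw [Submodule.mem_inf, hl.mem_semibasic hx, Submodule.mem_map]
      constructor
      · rintro ⟨⟨γ, hγ⟩, h0, rfl⟩
        exact ⟨hγ, h0⟩
      · rintro ⟨hβ, h0⟩
        exact ⟨⟨β, hβ⟩, h0, rfl⟩
    have h1 := LinearMap.finrank_range_add_finrank_ker (K := ℝ) (V := F) (V₂ := ℝ) ev
    have h2 : LinearMap.range ev = ⊤ :=
      LinearMap.range_eq_top.2 (LinearMap.surjective fun h0 =>
        hk (LinearMap.congr_fun h0 ⟨α k, hmem k⟩))
    rw [h2, finrank_top, Module.finrank_self, hcard] at h1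
    have h3 := Submodule.finrank_map_subtype_eq F (LinearMap.ker ev)
    rw [hker] at h3
    omega

end Descent

/-! ### Openness and density of the transverse sets. -/

section Prolonged

variable {E : Type*} [NormedAddCommGroup E] [NormedSpace ℝ E] [FiniteDimensional ℝ E]
  {E' : Type*} [NormedAddCommGroup E'] [NormedSpace ℝ E'] [FiniteDimensional ℝ E']
  {M : Type*} [TopologicalSpace M] [ChartedSpace E M] [IsManifold 𝓘(ℝ, E) ∞ M]
  {M' : Type*} [TopologicalSpace M'] [ChartedSpace E' M'] [IsManifold 𝓘(ℝ, E') ∞ M'] {s : ℕ}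
  {f : M → M'} {𝓔 : ExtDiffSystem E M} {I : HyperbolicSystem E' M' s}
  (h : IsIntegrableExtension f 𝓔 I.toExtDiffSystem)
  (hdim : Module.finrank ℝ E = Module.finrank ℝ E' + 1)

namespace ProlongationChart

variable (d : ProlongationChart (h.hyperbolic hdim)) (g : Fin 2 → M → ℝ)

/-- The set of points at which not all first integrals of the singular system are semi-basic. -/
def transverseSet : Set (Prolongation (h.hyperbolic hdim)) :=
  {e ∈ d.chart.source | ∃ k, differential (E × ℝ × ℝ) (d.invariants g k) e ∉
    semibasic (E' := E' × ℝ × ℝ) (h.prolongation hdim) e}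

variable {h hdim d g}

theorem mem_transverseSet_iff (hg : d.coframe.IsExact g) (hcomp : d.coframe.IsComplete)
    {e : Prolongation (h.hyperbolic hdim)} (he : e ∈ d.chart.source) :
    e ∈ d.transverseSet h hdim g ↔ Module.finrank ℝ ↥(firstIntegrals d.prol.sing e ⊓
      semibasic (E' := E' × ℝ × ℝ) (h.prolongation hdim) e) = 2 := by
  obtain ⟨dl, dl', rfl, hc⟩ := exists_compatibleCharts h hdim e
  rw [firstIntegrals_prol hg hcomp he,
    hc.isLift.finrank_inf_semibasic dl.center_mem (linearIndependent_invariants hg he)]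
  exact and_iff_right he

/-- Failure of an invariant to be semi-basic is the nonvanishing of its derivative along a smooth
fibre vector field. -/
theorem isOpen_transverseSet (hg : d.coframe.IsExact g) :
    IsOpen (d.transverseSet h hdim g) := by
  rw [isOpen_iff_mem_nhds]
  rintro e ⟨he, k, hk⟩
  obtain ⟨dl, dl', rfl, hc⟩ := exists_compatibleCharts h hdim e
  have hl := hc.isLift
  have hel := dl.center_mem
  rw [hl.mem_semibasic hel] at hk
  have hO := d.isOpen_source.inter dl.isOpen_source
  have hsm := ((smoothCovectorOn_differential d.isOpen_source (contMDiffOn_invariants hg k)).mono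
    (Set.inter_subset_left (t := dl.chart.source))).apply
    (X := Coframe.eθ (s := s + 2 + 1) dl.prol 0) fun x₀ =>
      (dl.prol.smooth_vec (Pi.single 0 1, 0, 0) x₀).mono fun z hz => ⟨hz.1, hz.2.2⟩
  have hev := (hsm.continuousOn.continuousAt (hO.mem_nhds ⟨he, hel⟩)).eventually_ne hk
  filter_upwards [hev, hO.mem_nhds ⟨he, hel⟩] with y hy hyO
  exact ⟨hyO.1, k, fun hmem => hy ((hl.mem_semibasic hyO.2).1 hmem)⟩

/-- If all three invariants were semi-basic throughout O, they would descend to three independent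
first integrals of a singular system of the prolonged base system, which has rank two. Applied to
every nonempty open part of the chart domain, this is density. -/
theorem exists_mem_transverseSet (hg : d.coframe.IsExact g)
    (hrank : FirstIntegralsHaveRank (s + 2) (prolongedIdeal I) 2)
    {O : Set (Prolongation (h.hyperbolic hdim))} (hO : IsOpen O) (hOd : O ⊆ d.chart.source)
    (hne : O.Nonempty) : ∃ e ∈ O, e ∈ d.transverseSet h hdim g := by
  by_contra! hcon
  have hb : ∀ k, ∀ e ∈ O, differential (E × ℝ × ℝ) (d.invariants g k) e ∈
      semibasic (E' := E' × ℝ × ℝ) (h.prolongation hdim) e := by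
    intro k e he
    by_contra hk
    exact hcon e he ⟨hOd he, k, hk⟩
  obtain ⟨e, he⟩ := hne
  obtain ⟨dl, dl', rfl, hc⟩ := exists_compatibleCharts h hdim e
  have hel := dl.center_mem
  have hr := hrank dl'.chart.source dl'.prol.sing dl'.prol.swap.sing dl'.isOpen_source
    (dl'.prol.isSingularPair dl'.prol_adapted dl'.isOpen_source) _ (hc.prolongation_mem hel)
  have hdim' : Module.finrank ℝ (E × ℝ × ℝ) = Module.finrank ℝ (E' × ℝ × ℝ) + 1 := by
    simp [hdim]
  -- The coframe of d and the lifted one may match with σ and τ interchanged. Both singular systems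
  -- below have rank two, so either matching gives a contradiction.
  have main : ∀ (c : Coframe (E := E × ℝ × ℝ) (s + 2 + 1) dl.chart.source)
      (c' : Coframe (E := E' × ℝ × ℝ) (s + 2) dl'.chart.source),
      c.IsLift (h.prolongation hdim) c' → (∀ᶠ y in 𝓝 dl.center, d.prol.ker y = c.ker y) →
      3 ≤ Module.finrank ℝ (firstIntegrals c'.sing (h.prolongation hdim dl.center)) := by
    intro c c' hl hev
    obtain ⟨S, hS, hSo, hxS⟩ := eventually_nhds_iff.1 hev
    refine hl.le_finrank_firstIntegrals hdim' hc.contMDiffOn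
      (T := d.invariants g) (O := O ∩ (dl.chart.source ∩ S))
      (hO.inter (dl.isOpen_source.inter hSo)) (fun y hy => hy.2.1) (fun k =>
        (contMDiffOn_invariants hg k).mono fun y hy => hOd hy.1) (fun k y hy => ?_)
      (fun k y hy => hb k y hy.1) ⟨he, hel, hxS⟩ (linearIndependent_invariants hg (hOd he))
    rw [← Coframe.sing_eq (s := s + 2 + 1) d.prol c (hOd hy.1) hy.2.1 (hS y hy.2.2)]
    exact differential_invariants_mem hg (hOd hy.1) k
  rcases d.prol.eventually_ker_eq_or dl.prol d.prol_adapted dl.prol_adapted d.isOpen_source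
    dl.isOpen_source (hOd he) hel with hev | hev
  · have := main dl.prol dl'.prol hc.isLift (hev.mono fun y hy => hy.1)
    omega
  · have := main (Coframe.swap (s := s + 2 + 1) dl.prol) dl'.prol.swap
      (Coframe.IsLift.swap (s := s + 2) hc.isLift) (hev.mono fun y hy => hy.1)
    omega

theorem firstIntegrals_swap {H : HyperbolicSystem E M s} (d : ProlongationChart H)
    {e : Prolongation H} (he : e ∈ d.chart.source) :
    firstIntegrals d.prol.swap.sing e = firstIntegrals d.swap.prol.sing e := by
  refine firstIntegrals_congr ?_
  filter_upwards [d.isOpen_source.mem_nhds he] with y hy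
  exact d.prol.swap.sing_eq d.swap.prol hy (by rw [d.swap_source]; exact hy) (d.prol_swap_ker hy)

/-- The singular pair in the definition is arbitrary, but near e it is the pair of d up to
interchange, and the rank conditions are symmetric in the two systems. -/
theorem mem_semibasicRankTwo_iff {g' : Fin 2 → M → ℝ} (hg : d.coframe.IsExact g)
    (hcomp : d.coframe.IsComplete) (hg' : d.coframe.swap.IsExact g')
    (hcomp' : d.coframe.swap.IsComplete) {e : Prolongation (h.hyperbolic hdim)}
    (he : e ∈ d.chart.source) :
    e ∈ semibasicRankTwo (E' := E' × ℝ × ℝ) (h.hyperbolic hdim) (h.prolongation hdim) ↔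
      e ∈ d.transverseSet h hdim g ∧ e ∈ d.swap.transverseSet h hdim g' := by
  have he' : e ∈ d.swap.chart.source := by rw [d.swap_source]; exact he
  rw [mem_transverseSet_iff hg hcomp he, mem_transverseSet_iff (d := d.swap) hg' hcomp' he',
    ← firstIntegrals_swap d he]
  constructor
  · rintro ⟨U, W₁, W₂, hU, heU, hW, h1, h2⟩
    obtain ⟨V, hV, heV, c, hc, hcW⟩ := hW e heU
    have e1 : firstIntegrals W₁ e = firstIntegrals c.sing e :=
      firstIntegrals_congr (by filter_upwards [hV.mem_nhds heV] with y hy using (hcW y hy).1)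
    have e2 : firstIntegrals W₂ e = firstIntegrals c.swap.sing e :=
      firstIntegrals_congr (by filter_upwards [hV.mem_nhds heV] with y hy using (hcW y hy).2)
    rw [e1] at h1
    rw [e2] at h2
    have key : ∀ (a : Coframe (E := E × ℝ × ℝ) (s + 1 + 2) V)
        (b : Coframe (E := E × ℝ × ℝ) (s + 1 + 2) d.chart.source),
        (∀ᶠ y in 𝓝 e, a.ker y = b.ker y) → firstIntegrals a.sing e = firstIntegrals b.sing e := by
      intro a b hab
      refine firstIntegrals_congr ?_
      filter_upwards [hab, hV.mem_nhds heV, d.isOpen_source.mem_nhds he] with y hy hyV hyd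
      exact a.sing_eq b hyV hyd hy
    rcases c.eventually_ker_eq_or d.prol hc d.prol_adapted hV d.isOpen_source heV he with hev | hev
    · rw [key c d.prol (hev.mono fun y hy => hy.1)] at h1
      rw [key c.swap d.prol.swap (hev.mono fun y hy => hy.2)] at h2
      exact ⟨h1, h2⟩
    · rw [key c d.prol.swap (hev.mono fun y hy => hy.1)] at h1
      rw [key c.swap d.prol (hev.mono fun y hy => hy.2)] at h2
      exact ⟨h2, h1⟩
  · rintro ⟨h1, h2⟩
    exact ⟨d.chart.source, d.prol.sing, d.prol.swap.sing, d.isOpen_source, he,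
      d.prol.isSingularPair d.prol_adapted d.isOpen_source, h1, h2⟩

end ProlongationChart

/-- If every integral element is the center of a chart whose coframe consists of exact forms and is
complete, then the set of points where the semi-basic parts have rank 2 is open and dense. -/
theorem isOpen_dense_semibasicRankTwo
    (hrank : FirstIntegralsHaveRank (s + 2) (prolongedIdeal I) 2)
    (hchart : ∀ e : Prolongation (h.hyperbolic hdim),
      ∃ d : ProlongationChart (h.hyperbolic hdim), d.center = e ∧
        (∃ g, d.coframe.IsExact g) ∧ d.coframe.IsComplete ∧
        (∃ g, d.coframe.swap.IsExact g) ∧ d.coframe.swap.IsComplete) :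
    IsOpen (semibasicRankTwo (E' := E' × ℝ × ℝ) (h.hyperbolic hdim) (h.prolongation hdim)) ∧
      Dense (semibasicRankTwo (E' := E' × ℝ × ℝ) (h.hyperbolic hdim) (h.prolongation hdim)) := by
  constructor
  · rw [isOpen_iff_mem_nhds]
    intro e he
    obtain ⟨d, rfl, ⟨g, hg⟩, hcomp, ⟨g', hg'⟩, hcomp'⟩ := hchart e
    have hiff := fun {e} => ProlongationChart.mem_semibasicRankTwo_iff (e := e) hg hcomp hg' hcomp'
    obtain ⟨h1, h2⟩ := (hiff d.center_mem).1 he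
    filter_upwards [d.isOpen_source.mem_nhds d.center_mem,
      (ProlongationChart.isOpen_transverseSet hg).mem_nhds h1,
      (ProlongationChart.isOpen_transverseSet (d := d.swap) hg').mem_nhds h2] with y hy hy1 hy2
    exact (hiff hy).2 ⟨hy1, hy2⟩
  · intro e
    obtain ⟨d, rfl, ⟨g, hg⟩, hcomp, ⟨g', hg'⟩, hcomp'⟩ := hchart e
    refine mem_closure_iff.2 fun O hO heO => ?_
    obtain ⟨e₁, he₁, ht₁⟩ := ProlongationChart.exists_mem_transverseSet hg hrank
      (hO.inter d.isOpen_source) Set.inter_subset_right ⟨_, heO, d.center_mem⟩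
    -- The first transverse set is open, so the density of the second can be used inside it.
    obtain ⟨e₂, he₂, ht₂⟩ := ProlongationChart.exists_mem_transverseSet (d := d.swap) hg' hrank
      ((hO.inter d.isOpen_source).inter (ProlongationChart.isOpen_transverseSet hg))
      (fun y hy => by rw [d.swap_source]; exact hy.1.2) ⟨e₁, he₁, ht₁⟩
    exact ⟨e₂, he₂.1.1, (ProlongationChart.mem_semibasicRankTwo_iff hg hcomp hg' hcomp' he₂.1.2).2
      ⟨he₂.2, ht₂⟩⟩

end Prolonged
end EDS

end

/-! ### Bäcklund transformations of the wave equation. -/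

theorem mainTheorem9
    {N₁ N₂ N : Type*}
    [TopologicalSpace N₁] [ChartedSpace EDS.E5 N₁] [IsManifold 𝓘(ℝ, EDS.E5) ∞ N₁]
    [TopologicalSpace N₂] [ChartedSpace EDS.E5 N₂] [IsManifold 𝓘(ℝ, EDS.E5) ∞ N₂]
    [TopologicalSpace N] [ChartedSpace EDS.E6 N] [IsManifold 𝓘(ℝ, EDS.E6) ∞ N]
    -- the Monge-Ampère system of the wave equation
    (I₁ : EDS.ExtDiffSystem EDS.E5 N₁) (hwave : EDS.IsWaveSystem I₁)
    -- the hyperbolic Monge-Ampère system, with the rank conditions on first integrals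
    (I₂ : EDS.HyperbolicSystem EDS.E5 N₂ 1) (hMA : EDS.IsMongeAmpere I₂)
    (hrank : EDS.FirstIntegralsHaveRank 1 I₂.ideal 1)
    (hrank' : EDS.FirstIntegralsHaveRank 3 (EDS.prolongedIdeal I₂) 2)
    -- the Bäcklund transformation
    (B : EDS.ExtDiffSystem EDS.E6 N) (p₁ : N → N₁) (p₂ : N → N₂)
    (hp₁ : EDS.IsIntegrableExtension p₁ B I₁)
    (hp₂ : EDS.IsIntegrableExtension p₂ B I₂.toExtDiffSystem) :
    IsOpen (EDS.semibasicRankTwo (E' := EDS.E5 × ℝ × ℝ) (hp₂.hyperbolic EDS.finrank_E6)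
        (hp₂.prolongation EDS.finrank_E6)) ∧
      Dense (EDS.semibasicRankTwo (E' := EDS.E5 × ℝ × ℝ) (hp₂.hyperbolic EDS.finrank_E6)
        (hp₂.prolongation EDS.finrank_E6)) := by
  refine EDS.isOpen_dense_semibasicRankTwo hp₂ EDS.finrank_E6 hrank' fun e => ?_
  -- The coframe is taken from the wave equation through `p₁`. It is adapted to B itself, so it may
  -- serve as chart data for B regarded as an extension of I₂ through `p₂`.
  obtain ⟨U', hU', hxU', c', hc', ⟨g, hg⟩, g', hg'⟩ := hwave.exists_coframe (p₁ e.base)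
  obtain ⟨V, hV, hxV, c, hc, hl⟩ := EDS.Coframe.exists_lift hp₁ EDS.finrank_E6 hU' c' hc' hxU'
  have h1 := hl.isExact hU' hp₁.1 hg
  have h2 := hl.swap.isExact hU' hp₁.1 hg'
  obtain ⟨i, j, hi, hj⟩ := EDS.exists_indices (H := hp₂.hyperbolic EDS.finrank_E6) c hc e hxV
  exact ⟨⟨e, V, hV, hxV, c, hc, i, j, hi, hj⟩, rfl, ⟨_, h1⟩,
    -- Exactness comes from `p₁`, completeness from the contact and rank conditions through `p₂`.
    h1.isComplete hp₂ EDS.finrank_E6 hMA hrank hV hc, ⟨_, h2⟩,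
    h2.isComplete hp₂ EDS.finrank_E6 hMA hrank hV hc.swap⟩
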